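/- Let $n\ge 1$, let $\Omega\subset\mathbb R^n$ be a bounded open set, and let $\mu$ be a finite nonnegative Borel measure on $[0,1]$ whose support is bounded away from $0$, with $\mu(\{1\})>0$. For $u\in\mathcal D(\mathbb R^n)=C_c^\infty(\mathbb R^n)$ let $D^1u=\nabla u$ and, for $s\in(0,1)$, $$D^su(x)=c_{s,n}\int_{\mathbb R^n}\frac{(u(y)-u(x))\,(y-x)}{|x-y|^{n+s+1}}\,dy,\qquad c_{s,n}=\frac{2^s\pi^{-n/2}\,\Gamma(\frac{n+s+1}{2})}{\Gamma(\frac{1-s}{2})}.$$ Coefficients. Let $\mathcal A=[a^{ij}]$, $a^i$, $b^i$ be measurable on $(0,1]\times\mathbb R^n$ and $a$ measurable on $\Omega$ (all real-valued), and let $\mathcal A(s,x)$ be positive definite (not necessarily symmetric) for all $s\in(0,1]$, $x\in\mathbb R^n$. Suppose there are $\lambda,\Lambda:\mathbb R^n\to[0,\infty)$, constants $R,C,\mathcal K_{\mathcal A}>0$ and $p<n$ such that, for all $s\in(0,1]$ and $x,\xi,\psi\in\mathbb R^n$, $$\lambda(x)|\xi|^2\le \xi^T\mathcal A(s,x)\xi\le\Lambda(x)|\xi|^2,\qquad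 |\xi^T\mathcal A(s,x)\psi|^2\le\mathcal K_{\mathcal A}\,(\xi^T\mathcal A(s,x)\xi)(\psi^T\mathcal A(s,x)\psi),$$ $\Lambda\in L^1(B_R)$, $\Lambda(x)\le C|x|^p$ for $x\notin B_R$, and only $$\lambda^{-1}\in L^1(\Omega)$$ (in particular this holds if $\lambda^{-1}\in L^1_{\rm loc}(\mathbb R^n)$). Let $b^{ij}(x),a^i(x),b^i(x)$ be such that $|(\mathcal A(s,x)^{-1})_{ij}|\le b^{ij}(x)$, $|a^i(s,x)|\le a^i(x)$, $|b^i(s,x)|\le b^i(x)$ for all $i,j$, $s\in(0,1]$, $x\in\mathbb R^n$, and put $$f(x)=\sum_{i,j}b^{ij}(x)\big(a^i(x)a^j(x)+b^i(x)b^j(x)\big)+|a(x)|.$$ Let $H=H^0(\mathcal A,\Omega)$ be the completion of $\mathcal D(\Omega)$ with respect to the scalar product $$\langle u,v\rangle_H=\int_{\mathbb R^n}\int_{(0,1]}a_S^{ij}(s,x)\,D^s_iu\,D^s_jv\,d\mu(s)\,dx,\qquad \mathcal A_S=\tfrac12(\mathcal A+\mathcal A^T),$$ realised as the space of functions $u\in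 L^1(\mathbb R^n)$, with fields $D^su(x)$, that are limits in $L^1$ and in energy of test functions and their fields. Assume that $f$ is measurable on $\Omega$ and compactly bounded on $H$: for every $\epsilon>0$ there is $K_\epsilon\ge0$ such that $\int_\Omega f\phi^2\,dx\le\epsilon\|\phi\|_H^2+K_\epsilon\|\phi\|_{L^1(\Omega)}^2$ for all $\phi\in\mathcal D(\Omega)$. Then $H$ is a Hilbert space containing $\mathcal D(\Omega)$, and, with absolutely convergent integrals, the formulas $$(\mathcal Lu,v)=\int_{\mathbb R^n}\int_{(0,1]}\big(a^{ij}D^s_ju\,D^s_iv+a^iu\,D^s_iv+b^iv\,D^s_iu\big)d\mu(s)\,dx+\int_\Omega a\,u\,v\,dx,$$ $$(\mathcal L^*u,v)=\int_{\mathbb R^n}\int_{(0,1]}\big(a^{ji}D^s_ju\,D^s_iv+b^iu\,D^s_iv+a^iv\,D^s_iu\big)d\mu(s)\,dx+\int_\Omega a\,u\,v\,dx,$$ $$(\mathcal I(f)u,v)=\int_\Omega f\,u\,v\,dx$$ define bounded operators $\mathcal L,\mathcal L^*,\mathcal I(f):H\to H'$. For $\sigma\in\mathbb R$ set $\mathcal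 L_\sigma=\mathcal L+\sigma\mathcal I(f)$ and $\mathcal L^*_\sigma=\mathcal L^*+\sigma\mathcal I(f)$. There exist $\sigma_0\in\mathbb R$ and a countable set $\Sigma\subset(-\infty,\sigma_0)$, without accumulation points in $\mathbb R$, such that: 1. $\sigma\in\Sigma$ if and only if $\mathcal L_\sigma u=0$ for some $u\in H\setminus\{0\}$. 2. If $\sigma\notin\Sigma$, then $\mathcal L_\sigma:H\to H'$ is bijective; thus for every $T\in H'$ the problem $\mathcal L_\sigma u=T$ has a unique solution. 3. If $\sigma\in\Sigma$, then the kernels of $\mathcal L_\sigma$ and $\mathcal L^*_\sigma$ have the same dimension, which is positive and finite; and for every $T\in H'$ the problem $\mathcal L_\sigma u=T$ has either no solution or infinitely many. 4. For every $\sigma\in\mathbb R$ and $T\in H'$, the problem $\mathcal L_\sigma u=T$ has a solution $u\in H$ if and only if $\langle T,u^*\rangle=0$ for every $u^*\in H$ with $\mathcal L^*_\sigma u^*=0$. (For $\mu=\delta_1$ this is Trudinger's Fredholm alternative for $-\partial_i(a^{ij}\partial_ju+a^iu)+b^i\partial_iu+au$ with measurable coefficients.) -/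

import Mathlib

open MeasureTheory Set Filter Topology TopologicalSpace
open scoped ENNReal Distributions

noncomputable section

namespace MixedOrder

/-- Euclidean space `ℝⁿ`. -/
abbrev E (n : ℕ) : Type := EuclideanSpace ℝ (Fin n)

/-! ### The fractional gradient -/

/-- The normalising constant
`c_{s,n} = 2^s π^{-n/2} Γ((n+s+1)/2) / Γ((1-s)/2)`. -/
def gradConst (n : ℕ) (s : ℝ) : ℝ :=
  (2 : ℝ) ^ s * Real.pi ^ (-(n : ℝ) / 2) * Real.Gamma ((n + s + 1) / 2) /
    Real.Gamma ((1 - s) / 2)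

/-- The integrand of the fractional gradient of order `s` at the point `x`,
after the change of variables `y = x + z`. -/
def gradKernel {n : ℕ} (s : ℝ) (u : E n → ℝ) (x z : E n) : E n :=
  ((u (x + z) - u x) / ‖z‖ ^ ((n : ℝ) + s + 1)) • z

/-- The fractional gradient `D^s u (x)` of a test function:
`c_{s,n} ∫ (u(x+z) - u(x)) z / |z|^{n+s+1} dz` for `s ∈ (0,1)` (an absolutely convergent integral;
by oddness of `z / |z|^{n+s+1}` it equals the principal value of
`c_{s,n} ∫ u(x+z) z / |z|^{n+s+1} dz`), and the classical gradient for `s = 1`. -/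
def fracGrad {n : ℕ} (s : ℝ) (u : E n → ℝ) (x : E n) : E n :=
  if s = 1 then gradient u x else gradConst n s • ∫ z, gradKernel s u x z

lemma integrable_gradKernel {n : ℕ} {s : ℝ} (hs0 : 0 < s) (hs1 : s < 1) {Ω : Opens (E n)}
    (φ : 𝓓(Ω, ℝ)) (x : E n) : Integrable (gradKernel s φ x) := by
  rcases Nat.eq_zero_or_pos n with rfl | hn
  · have : gradKernel s φ x = 0 := by
      funext z; exact Subsingleton.elim _ _
    rw [this]; exact integrable_zero _ _ _
  have hmeas : Measurable (gradKernel s φ x) := by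
    unfold gradKernel
    have h1 : Measurable fun z : E n => φ (x + z) :=
      (φ.continuous.comp (continuous_const.add continuous_id)).measurable
    exact ((h1.sub_const _).div (measurable_norm.pow_const _)).smul measurable_id
  have hdim : Module.finrank ℝ (E n) = n := by simp
  obtain ⟨C, hC⟩ := (ContDiff.lipschitzWith_of_hasCompactSupport
    φ.hasCompactSupport φ.contDiff (by simp))
  obtain ⟨M, hM⟩ := φ.continuous.bounded_above_of_compact_support φ.hasCompactSupport
  have hM0 : 0 ≤ M := (norm_nonneg _).trans (hM 0)
  have key : ∀ z : E n, z ≠ 0 → ‖gradKernel s φ x z‖ =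
      |φ (x + z) - φ x| * ‖z‖ ^ (-((n : ℝ) + s)) := by
    intro z hz
    have hz' : 0 < ‖z‖ := norm_pos_iff.2 hz
    unfold gradKernel
    rw [norm_smul, norm_div, Real.norm_eq_abs, Real.norm_of_nonneg (by positivity : (0 : ℝ) ≤
      ‖z‖ ^ ((n : ℝ) + s + 1)), Real.rpow_add hz', Real.rpow_one, Real.rpow_neg hz'.le]
    field_simp
  rw [← integrableOn_univ, ← union_compl_self (Metric.ball (0 : E n) 1)]
  refine IntegrableOn.union ?_ ?_
  · refine integrableOn_ball_of_norm_le_rpow (C := C) (α := n + s - 1) (by omega)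
      (by rw [hdim]; linarith) (ae_of_all _ fun z => ?_) hmeas.aestronglyMeasurable
    by_cases hz : z = 0
    · subst hz
      simp only [gradKernel, smul_zero, norm_zero]
      positivity
    · have hz' : 0 < ‖z‖ := norm_pos_iff.2 hz
      rw [key z hz]
      have h1 : |φ (x + z) - φ x| ≤ C * ‖z‖ := by
        have := hC.dist_le_mul (x + z) x
        simpa [Real.dist_eq, dist_eq_norm] using this
      calc |φ (x + z) - φ x| * ‖z‖ ^ (-((n : ℝ) + s))
          ≤ C * ‖z‖ * ‖z‖ ^ (-((n : ℝ) + s)) := by gcongr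
        _ = C * ‖z‖ ^ (-((n : ℝ) + s - 1)) := by
          rw [show -((n : ℝ) + s - 1) = 1 + -((n : ℝ) + s) by ring, Real.rpow_add hz',
            Real.rpow_one]
          ring
  · have hint : Integrable (fun z : E n => (2 * M * 2 ^ ((n : ℝ) + s)) *
        (1 + ‖z‖) ^ (-((n : ℝ) + s))) :=
      (integrable_one_add_norm (by rw [hdim]; linarith)).const_mul _
    refine Integrable.mono' hint.integrableOn hmeas.aestronglyMeasurable.restrict ?_
    refine (ae_restrict_iff' Metric.isOpen_ball.measurableSet.compl).2 (ae_of_all _ fun z hz => ?_)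
    have hz1 : 1 ≤ ‖z‖ := by simpa using hz
    have hz' : 0 < ‖z‖ := by linarith
    rw [key z (norm_pos_iff.1 hz')]
    have h1 : |φ (x + z) - φ x| ≤ 2 * M := by
      have h := (abs_sub (φ (x + z)) (φ x)).trans
        (add_le_add (hM (x + z)) (hM x))
      linarith
    have h2 : ‖z‖ ^ (-((n : ℝ) + s)) ≤ 2 ^ ((n : ℝ) + s) * (1 + ‖z‖) ^ (-((n : ℝ) + s)) := by
      rw [Real.rpow_neg hz'.le, Real.rpow_neg (by positivity), ← div_eq_mul_inv,
        ← Real.div_rpow (by positivity) (by positivity), inv_eq_one_div,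
        div_le_iff₀ (by positivity), ← Real.mul_rpow (by positivity) (by positivity)]
      refine Real.one_le_rpow ?_ (by positivity)
      rw [div_mul_eq_mul_div, le_div_iff₀ (by positivity)]
      linarith
    calc |φ (x + z) - φ x| * ‖z‖ ^ (-((n : ℝ) + s))
        ≤ (2 * M) * (2 ^ ((n : ℝ) + s) * (1 + ‖z‖) ^ (-((n : ℝ) + s))) := by gcongr
      _ = _ := by ring

lemma fracGrad_add {n : ℕ} {s : ℝ} (hs : s ∈ Ioc (0 : ℝ) 1) {Ω : Opens (E n)}
    (φ ψ : 𝓓(Ω, ℝ)) (x : E n) :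
    fracGrad s (φ + ψ : 𝓓(Ω, ℝ)) x = fracGrad s φ x + fracGrad s ψ x := by
  unfold fracGrad
  split_ifs with h
  · unfold gradient
    rw [← map_add]
    congr 1
    exact fderiv_add (φ.contDiff.differentiable (by simp) x) (ψ.contDiff.differentiable (by simp) x)
  · have hs1 : s < 1 := lt_of_le_of_ne hs.2 h
    rw [← smul_add, ← integral_add (integrable_gradKernel hs.1 hs1 φ x)
      (integrable_gradKernel hs.1 hs1 ψ x)]
    congr 2
    funext z
    have e : ∀ y, (φ + ψ : 𝓓(Ω, ℝ)) y = φ y + ψ y := fun _ => rfl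
    simp only [gradKernel, ← add_smul, e]
    congr 1
    ring

lemma fracGrad_smul {n : ℕ} (s : ℝ) {Ω : Opens (E n)}
    (c : ℝ) (φ : 𝓓(Ω, ℝ)) (x : E n) :
    fracGrad s (c • φ : 𝓓(Ω, ℝ)) x = c • fracGrad s φ x := by
  unfold fracGrad
  split_ifs with h
  · unfold gradient
    rw [← map_smul]
    congr 1
    exact fderiv_const_smul (φ.contDiff.differentiable (by simp) x) c
  · rw [smul_comm c, ← integral_smul c]
    congr 2
    funext z
    have e : ∀ y, (c • φ : 𝓓(Ω, ℝ)) y = c * φ y := fun _ => rfl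
    simp only [gradKernel, smul_smul, e]
    congr 1
    ring

/-! ### The coefficient matrix and its energy -/

/-- The product measure `dμ(s) dx` on `(0,1] × ℝⁿ`. -/
abbrev mixedMeasure (n : ℕ) (μ : Measure ℝ) : Measure (ℝ × E n) :=
  (μ.restrict (Ioc 0 1)).prod volume

/-- The bilinear form `ξᵀ M ψ` of a square matrix. -/
def matForm {n : ℕ} (M : Matrix (Fin n) (Fin n) ℝ) (ξ ψ : E n) : ℝ :=
  ∑ i, ∑ j, M i j * ξ i * ψ j

/-- The symmetric part of a square matrix. -/
def symPart {n : ℕ} (M : Matrix (Fin n) (Fin n) ℝ) : Matrix (Fin n) (Fin n) ℝ :=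
  (1 / 2 : ℝ) • (M + M.transpose)

/-- A measurable coefficient matrix `A(s,x) = [a^{ij}(s,x)]`, positive definite (not necessarily
symmetric) for all `s ∈ (0,1]` and `x ∈ ℝⁿ`. -/
structure CoeffMatrix (n : ℕ) (μ : Measure ℝ) where
  /-- the matrix `A(s,x)` -/
  mat : ℝ → E n → Matrix (Fin n) (Fin n) ℝ
  aemeasurable_mat : ∀ i j,
    AEMeasurable (fun p : ℝ × E n => mat p.1 p.2 i j) (mixedMeasure n μ)
  posDef_mat : ∀ s ∈ Ioc (0 : ℝ) 1, ∀ x ξ, ξ ≠ 0 → 0 < matForm (mat s x) ξ ξ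

variable {n : ℕ} {μ : Measure ℝ}

/-- The energy `∫∫ A F · F dμ(s) dx ∈ [0,∞]` of a field `F` on `(0,1] × ℝⁿ`. -/
def energy (A : CoeffMatrix n μ) (F : ℝ × E n → E n) : ℝ≥0∞ :=
  ∫⁻ p, ENNReal.ofReal (matForm (A.mat p.1 p.2) (F p) (F p)) ∂(mixedMeasure n μ)

lemma matForm_symPart_self (M : Matrix (Fin n) (Fin n) ℝ) (ξ : E n) :
    matForm (symPart M) ξ ξ = matForm M ξ ξ := by
  have h : ∑ i, ∑ j, M j i * ξ i * ξ j = ∑ i, ∑ j, M i j * ξ i * ξ j := by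
    rw [Finset.sum_comm]
    exact Finset.sum_congr rfl fun i _ => Finset.sum_congr rfl fun j _ => by ring
  have h2 : matForm (symPart M) ξ ξ = (1 / 2) * (matForm M ξ ξ + ∑ i, ∑ j, M j i * ξ i * ξ j) := by
    simp only [matForm, symPart, Matrix.smul_apply, Matrix.add_apply, Matrix.transpose_apply,
      smul_eq_mul, ← Finset.sum_add_distrib, Finset.mul_sum]
    exact Finset.sum_congr rfl fun i _ => Finset.sum_congr rfl fun j _ => by ring
  rw [h2, h, matForm]; ring

lemma matForm_symPart_comm (M : Matrix (Fin n) (Fin n) ℝ) (ξ ψ : E n) :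
    matForm (symPart M) ξ ψ = matForm (symPart M) ψ ξ := by
  unfold matForm
  rw [Finset.sum_comm]
  refine Finset.sum_congr rfl fun i _ => Finset.sum_congr rfl fun j _ => ?_
  simp only [symPart, Matrix.smul_apply, Matrix.add_apply, Matrix.transpose_apply, smul_eq_mul]
  ring

lemma matForm_add_left (M : Matrix (Fin n) (Fin n) ℝ) (ξ η ψ : E n) :
    matForm M (ξ + η) ψ = matForm M ξ ψ + matForm M η ψ := by
  simp only [matForm, ← Finset.sum_add_distrib]
  refine Finset.sum_congr rfl fun i _ => Finset.sum_congr rfl fun j _ => ?_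
  simp only [PiLp.add_apply]; ring

lemma matForm_smul_left (M : Matrix (Fin n) (Fin n) ℝ) (c : ℝ) (ξ ψ : E n) :
    matForm M (c • ξ) ψ = c * matForm M ξ ψ := by
  simp only [matForm, Finset.mul_sum]
  refine Finset.sum_congr rfl fun i _ => Finset.sum_congr rfl fun j _ => ?_
  simp only [PiLp.smul_apply, smul_eq_mul]; ring

lemma matForm_symPart_add_self (M : Matrix (Fin n) (Fin n) ℝ) (ξ ψ : E n) (t : ℝ) :
    matForm M (ξ + t • ψ) (ξ + t • ψ) =
      matForm M ξ ξ + 2 * t * matForm (symPart M) ξ ψ + t ^ 2 * matForm M ψ ψ := by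
  simp only [← matForm_symPart_self M]
  rw [matForm_add_left, matForm_smul_left, matForm_symPart_comm M ξ (ξ + t • ψ),
    matForm_symPart_comm M ψ (ξ + t • ψ), matForm_add_left, matForm_add_left, matForm_smul_left,
    matForm_smul_left, matForm_symPart_comm M ψ ξ]
  ring

lemma matForm_self_nonneg (A : CoeffMatrix n μ) {s : ℝ} (hs : s ∈ Ioc (0 : ℝ) 1) (x ξ : E n) :
    0 ≤ matForm (A.mat s x) ξ ξ := by
  by_cases h : ξ = 0
  · subst h; simp [matForm]
  · exact (A.posDef_mat s hs x ξ h).le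

lemma ae_mem_Ioc (n : ℕ) (μ : Measure ℝ) : ∀ᵐ p ∂(mixedMeasure n μ), p.1 ∈ Ioc (0 : ℝ) 1 :=
  Measure.quasiMeasurePreserving_fst.ae (ae_restrict_mem measurableSet_Ioc)

lemma aemeasurable_matForm (A : CoeffMatrix n μ) {F G : ℝ × E n → E n}
    (hF : AEMeasurable F (mixedMeasure n μ)) (hG : AEMeasurable G (mixedMeasure n μ)) :
    AEMeasurable (fun p => matForm (A.mat p.1 p.2) (F p) (G p)) (mixedMeasure n μ) := by
  have hc : ∀ i : Fin n, Measurable fun v : E n => v i := fun i => by fun_prop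
  unfold matForm
  refine Finset.aemeasurable_fun_sum _ fun i _ => Finset.aemeasurable_fun_sum _ fun j _ => ?_
  exact ((A.aemeasurable_mat i j).mul ((hc i).comp_aemeasurable hF)).mul
    ((hc j).comp_aemeasurable hG)

lemma aemeasurable_matForm_symPart (A : CoeffMatrix n μ) {F G : ℝ × E n → E n}
    (hF : AEMeasurable F (mixedMeasure n μ)) (hG : AEMeasurable G (mixedMeasure n μ)) :
    AEMeasurable (fun p => matForm (symPart (A.mat p.1 p.2)) (F p) (G p))
      (mixedMeasure n μ) := by
  have hc : ∀ i : Fin n, Measurable fun v : E n => v i := fun i => by fun_prop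
  unfold matForm
  refine Finset.aemeasurable_fun_sum _ fun i _ => Finset.aemeasurable_fun_sum _ fun j _ => ?_
  refine AEMeasurable.mul (AEMeasurable.mul ?_ ((hc i).comp_aemeasurable hF))
    ((hc j).comp_aemeasurable hG)
  simp only [symPart, Matrix.smul_apply, Matrix.add_apply, Matrix.transpose_apply, smul_eq_mul]
  exact ((A.aemeasurable_mat i j).add (A.aemeasurable_mat j i)).const_mul _

lemma energy_congr (A : CoeffMatrix n μ) {F G : ℝ × E n → E n}
    (h : F =ᵐ[mixedMeasure n μ] G) : energy A F = energy A G :=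
  lintegral_congr_ae (h.mono fun p hp => by simp only [hp])

lemma energy_add_le (A : CoeffMatrix n μ) {F G : ℝ × E n → E n}
    (hF : AEMeasurable F (mixedMeasure n μ)) (hG : AEMeasurable G (mixedMeasure n μ)) :
    energy A (F + G) ≤ 2 * energy A F + 2 * energy A G := by
  unfold energy
  rw [← lintegral_const_mul'' _ (aemeasurable_matForm A hF hF).ennreal_ofReal,
    ← lintegral_const_mul'' _ (aemeasurable_matForm A hG hG).ennreal_ofReal,
    ← lintegral_add_left' ((aemeasurable_matForm A hF hF).ennreal_ofReal.const_mul _)]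
  refine lintegral_mono_ae ((ae_mem_Ioc n μ).mono fun p hp => ?_)
  have h1 := matForm_symPart_add_self (A.mat p.1 p.2) (F p) (G p) 1
  have h2 := matForm_symPart_add_self (A.mat p.1 p.2) (F p) (G p) (-1)
  have h3 := matForm_self_nonneg A hp p.2 (F p + (-1 : ℝ) • G p)
  have h4 := matForm_self_nonneg A hp p.2 (F p)
  have h5 := matForm_self_nonneg A hp p.2 (G p)
  rw [one_smul] at h1
  have h6 : ∀ r : ℝ, 2 * ENNReal.ofReal r = ENNReal.ofReal (2 * r) := fun r => by
    rw [ENNReal.ofReal_mul (by norm_num), ENNReal.ofReal_ofNat]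
  simp only [h6]
  rw [← ENNReal.ofReal_add (by positivity) (by positivity)]
  refine ENNReal.ofReal_le_ofReal ?_
  rw [Pi.add_apply]
  linarith

lemma energy_smul (A : CoeffMatrix n μ) (c : ℝ) (F : ℝ × E n → E n) :
    energy A (c • F) = ENNReal.ofReal (c ^ 2) * energy A F := by
  unfold energy
  rw [← lintegral_const_mul' _ _ ENNReal.ofReal_ne_top]
  refine lintegral_congr fun p => ?_
  rw [← ENNReal.ofReal_mul (by positivity), ← matForm_symPart_self, Pi.smul_apply,
    matForm_smul_left, matForm_symPart_comm, matForm_smul_left, matForm_symPart_self]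
  congr 1
  ring

lemma integrable_matForm_symPart (A : CoeffMatrix n μ) {F G : ℝ × E n → E n}
    (hF : AEMeasurable F (mixedMeasure n μ)) (hG : AEMeasurable G (mixedMeasure n μ))
    (hF' : energy A F < ∞) (hG' : energy A G < ∞) :
    Integrable (fun p => matForm (symPart (A.mat p.1 p.2)) (F p) (G p)) (mixedMeasure n μ) := by
  have key : ∀ {H : ℝ × E n → E n}, AEMeasurable H (mixedMeasure n μ) → energy A H < ∞ →
      Integrable (fun p => matForm (A.mat p.1 p.2) (H p) (H p)) (mixedMeasure n μ) := by
    intro H hH hH'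
    refine ⟨(aemeasurable_matForm A hH hH).aestronglyMeasurable, ?_⟩
    rw [hasFiniteIntegral_iff_ofReal ((ae_mem_Ioc n μ).mono fun p hp =>
      matForm_self_nonneg A hp p.2 (H p))]
    exact hH'
  refine Integrable.mono' ((key hF hF').add (key hG hG'))
    (aemeasurable_matForm_symPart A hF hG).aestronglyMeasurable
    ((ae_mem_Ioc n μ).mono fun p hp => ?_)
  have h1 := matForm_symPart_add_self (A.mat p.1 p.2) (F p) (G p) 1
  have h2 := matForm_symPart_add_self (A.mat p.1 p.2) (F p) (G p) (-1)
  have h3 := matForm_self_nonneg A hp p.2 (F p + (-1 : ℝ) • G p)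
  have h4 := matForm_self_nonneg A hp p.2 (F p + (1 : ℝ) • G p)
  have h5 := matForm_self_nonneg A hp p.2 (F p)
  have h6 := matForm_self_nonneg A hp p.2 (G p)
  rw [Real.norm_eq_abs, Pi.add_apply, abs_le]
  constructor <;> linarith

/-! ### The space `H⁰(A, Ω)` -/

/-- Pairs `(u, G)` of an integrable function `u` on `ℝⁿ` and a measurable field `G` on
`(0,1] × ℝⁿ`, up to almost everywhere equality; `G(s,x)` stands for `D^s u (x)`. -/
abbrev FieldPair (n : ℕ) (μ : Measure ℝ) : Type :=
  Lp ℝ 1 (volume : Measure (E n)) × ((ℝ × E n) →ₘ[mixedMeasure n μ] E n)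

/-- The pair `p` is the pair `(φ, (s,x) ↦ D^s φ (x))` of the test function `φ`. -/
def IsGradPair {Ω : Opens (E n)} (φ : 𝓓(Ω, ℝ)) (p : FieldPair n μ) : Prop :=
  p.1 =ᵐ[volume] φ ∧ p.2 =ᵐ[mixedMeasure n μ] fun q => fracGrad q.1 φ q.2

lemma IsGradPair.add {Ω : Opens (E n)} {φ ψ : 𝓓(Ω, ℝ)} {p q : FieldPair n μ}
    (hp : IsGradPair φ p) (hq : IsGradPair ψ q) : IsGradPair (φ + ψ) (p + q) := by
  refine ⟨?_, ?_⟩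
  · filter_upwards [Lp.coeFn_add p.1 q.1, hp.1, hq.1] with x h1 h2 h3
    rw [Prod.fst_add, h1, Pi.add_apply, h2, h3]; rfl
  · filter_upwards [AEEqFun.coeFn_add p.2 q.2, hp.2, hq.2, ae_mem_Ioc n μ] with x h1 h2 h3 h4
    rw [Prod.snd_add, h1, Pi.add_apply, h2, h3, fracGrad_add h4]

lemma IsGradPair.smul {Ω : Opens (E n)} {φ : 𝓓(Ω, ℝ)} {p : FieldPair n μ} (c : ℝ)
    (hp : IsGradPair φ p) : IsGradPair (c • φ) (c • p) := by
  refine ⟨?_, ?_⟩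
  · filter_upwards [Lp.coeFn_smul c p.1, hp.1] with x h1 h2
    rw [Prod.smul_fst, h1, Pi.smul_apply, h2]; rfl
  · filter_upwards [AEEqFun.coeFn_smul c p.2, hp.2] with x h1 h2
    rw [Prod.smul_snd, h1, Pi.smul_apply, h2, fracGrad_smul]

lemma isGradPair_zero (Ω : Opens (E n)) : IsGradPair (0 : 𝓓(Ω, ℝ)) (0 : FieldPair n μ) := by
  refine ⟨?_, ?_⟩
  · filter_upwards [Lp.coeFn_zero ℝ 1 (volume : Measure (E n))] with x h1
    rw [Prod.fst_zero, h1]; rfl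
  · filter_upwards [AEEqFun.coeFn_zero (α := ℝ × E n) (β := E n) (μ := mixedMeasure n μ)]
      with x h1
    have := fracGrad_smul x.1 (0 : ℝ) (0 : 𝓓(Ω, ℝ)) x.2
    rw [zero_smul, zero_smul] at this
    rw [Prod.snd_zero, h1, this]; rfl

/-- The space `H⁰(A, Ω)`, the closure of `𝓓(Ω)` in the energy norm: the pairs `(u, G)` of finite
energy for which there are test functions `φ_k ∈ 𝓓(Ω)` with `φ_k → u` in `L¹` and `D^s φ_k → G` in
energy. -/
def energySubmodule (A : CoeffMatrix n μ) (Ω : Opens (E n)) : Submodule ℝ (FieldPair n μ) where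
  carrier := {p | energy A p.2 < ∞ ∧ ∃ (φ : ℕ → 𝓓(Ω, ℝ)) (q : ℕ → FieldPair n μ),
    (∀ k, IsGradPair (φ k) (q k)) ∧
    Tendsto (fun k => (q k).1) atTop (𝓝 p.1) ∧
    Tendsto (fun k => energy A ((q k).2 - p.2 : (ℝ × E n) →ₘ[mixedMeasure n μ] E n)) atTop (𝓝 0)}
  zero_mem' := by
    have h0 : energy A ((0 : (ℝ × E n) →ₘ[mixedMeasure n μ] E n)) = 0 := by
      rw [energy_congr A AEEqFun.coeFn_zero]
      simp [energy, matForm]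
    refine ⟨by rw [Prod.snd_zero, h0]; simp, fun _ => 0, fun _ => 0,
      fun _ => isGradPair_zero Ω, tendsto_const_nhds, ?_⟩
    simp only [Prod.snd_zero, sub_zero, h0]
    exact tendsto_const_nhds
  add_mem' := by
    rintro p p' ⟨hp, φ, q, hq, h1, h2⟩ ⟨hp', φ', q', hq', h1', h2'⟩
    have hadd : ∀ F G : (ℝ × E n) →ₘ[mixedMeasure n μ] E n,
        energy A (F + G : (ℝ × E n) →ₘ[mixedMeasure n μ] E n) ≤ 2 * energy A F + 2 * energy A G :=
      fun F G => by
        rw [energy_congr A (AEEqFun.coeFn_add F G)]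
        exact energy_add_le A F.aemeasurable G.aemeasurable
    refine ⟨(hadd p.2 p'.2).trans_lt ?_, φ + φ', q + q', fun k => (hq k).add (hq' k),
      h1.add h1', ?_⟩
    · exact ENNReal.add_lt_top.2 ⟨ENNReal.mul_lt_top (by simp) hp, ENNReal.mul_lt_top (by simp) hp'⟩
    · have hlim : Tendsto (fun k => 2 * energy A ((q k).2 - p.2 : (ℝ × E n) →ₘ[mixedMeasure n μ] E n)
          + 2 * energy A ((q' k).2 - p'.2 : (ℝ × E n) →ₘ[mixedMeasure n μ] E n)) atTop (𝓝 0) := by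
        have ha := ENNReal.Tendsto.const_mul (a := 2) h2 (Or.inr (by simp))
        have hb := ENNReal.Tendsto.const_mul (a := 2) h2' (Or.inr (by simp))
        simpa using ha.add hb
      refine tendsto_of_tendsto_of_tendsto_of_le_of_le tendsto_const_nhds hlim
        (fun _ => zero_le) fun k => ?_
      have : ((q + q') k).2 - (p + p').2 = ((q k).2 - p.2) + ((q' k).2 - p'.2) := by
        simp only [Pi.add_apply, Prod.snd_add]; abel
      simp only [this]
      exact hadd _ _
  smul_mem' := by
    rintro c p ⟨hp, φ, q, hq, h1, h2⟩
    have hsmul : ∀ F : (ℝ × E n) →ₘ[mixedMeasure n μ] E n,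
        energy A (c • F : (ℝ × E n) →ₘ[mixedMeasure n μ] E n) = ENNReal.ofReal (c ^ 2) * energy A F :=
      fun F => by rw [energy_congr A (AEEqFun.coeFn_smul c F), energy_smul]
    refine ⟨?_, c • φ, c • q, fun k => (hq k).smul c, h1.const_smul c, ?_⟩
    · rw [Prod.smul_snd, hsmul]
      exact ENNReal.mul_lt_top (by simp) hp
    · have : ∀ k, ((c • q) k).2 - (c • p).2 = c • ((q k).2 - p.2) := fun k => by
        simp only [Pi.smul_apply, Prod.smul_snd, smul_sub]
      simp only [this, hsmul]
      simpa using ENNReal.Tendsto.const_mul (a := ENNReal.ofReal (c ^ 2)) h2 (Or.inr (by simp))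

/-- The type of elements of `H⁰(A, Ω)`. -/
def H0 (A : CoeffMatrix n μ) (Ω : Opens (E n)) : Type := energySubmodule A Ω

namespace H0

variable {A : CoeffMatrix n μ} {Ω : Opens (E n)}

instance : AddCommGroup (H0 A Ω) := inferInstanceAs (AddCommGroup (energySubmodule A Ω))

instance : Module ℝ (H0 A Ω) := inferInstanceAs (Module ℝ (energySubmodule A Ω))

/-- The function `u : ℝⁿ → ℝ` underlying an element of `H⁰(A, Ω)`. -/
def val (u : H0 A Ω) : E n → ℝ := (u : energySubmodule A Ω).1.1

/-- The field `(s, x) ↦ D^s u (x)` of an element of `H⁰(A, Ω)`. -/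
def grad (u : H0 A Ω) : ℝ × E n → E n := (u : energySubmodule A Ω).1.2

/-- The scalar product `⟨u, v⟩ = ∫∫ a_S^{ij}(s,x) D_i^s u D_j^s v dμ(s) dx`. -/
@[reducible] def core (A : CoeffMatrix n μ) (Ω : Opens (E n)) : PreInnerProductSpace.Core ℝ (H0 A Ω) where
  inner u v := ∫ p, matForm (symPart (A.mat p.1 p.2)) (u.grad p) (v.grad p) ∂(mixedMeasure n μ)
  conj_inner_symm u v := by
    simp only [conj_trivial]
    exact integral_congr_ae (ae_of_all _ fun p => matForm_symPart_comm _ _ _)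
  re_inner_nonneg u := by
    refine integral_nonneg_of_ae ((ae_mem_Ioc n μ).mono fun p hp => ?_)
    simp only [Pi.zero_apply, matForm_symPart_self]
    exact matForm_self_nonneg A hp _ _
  add_left u v w := by
    rw [← integral_add]
    · refine integral_congr_ae ?_
      filter_upwards [AEEqFun.coeFn_add (u : energySubmodule A Ω).1.2
        (v : energySubmodule A Ω).1.2] with p hp
      rw [← matForm_add_left]
      exact congrArg (fun ξ => matForm _ ξ _) hp
    · exact integrable_matForm_symPart A (AEEqFun.aemeasurable _) (AEEqFun.aemeasurable _)
        (u : energySubmodule A Ω).2.1 (w : energySubmodule A Ω).2.1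
    · exact integrable_matForm_symPart A (AEEqFun.aemeasurable _) (AEEqFun.aemeasurable _)
        (v : energySubmodule A Ω).2.1 (w : energySubmodule A Ω).2.1
  smul_left u v c := by
    simp only [conj_trivial]
    rw [← integral_const_mul]
    refine integral_congr_ae ?_
    filter_upwards [AEEqFun.coeFn_smul c (u : energySubmodule A Ω).1.2] with p hp
    rw [← matForm_smul_left]
    exact congrArg (fun ξ => matForm _ ξ _) hp

instance : SeminormedAddCommGroup (H0 A Ω) :=
  @InnerProductSpace.Core.toSeminormedAddCommGroup ℝ (H0 A Ω) _ _ _ (core A Ω)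

instance : InnerProductSpace ℝ (H0 A Ω) := InnerProductSpace.ofCore (core A Ω)

/-- `u` is the test function `φ`, seen as an element of `H⁰(A, Ω)`. -/
def IsTest (u : H0 A Ω) (φ : 𝓓(Ω, ℝ)) : Prop := IsGradPair φ (u : energySubmodule A Ω).1

end H0

/-! ### The bilinear forms and compact boundedness -/

variable {A : CoeffMatrix n μ} {Ω : Opens (E n)}

/-- The integrand `m^{ij} D_j^s u D_i^s v + a^i u D_i^s v + b^i v D_i^s u`. -/
def formDensity (m : ℝ → E n → Matrix (Fin n) (Fin n) ℝ) (a b : ℝ → E n → Fin n → ℝ)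
    (u v : H0 A Ω) (p : ℝ × E n) : ℝ :=
  (∑ i, ∑ j, m p.1 p.2 i j * u.grad p j * v.grad p i) +
    ∑ i, (a p.1 p.2 i * u.val p.2 * v.grad p i + b p.1 p.2 i * v.val p.2 * u.grad p i)

/-- The continuous bilinear form `B`, regarded as a map from `H⁰(A, Ω)` to its dual, is
`(u, v) ↦ ∫∫ (m^{ij} D_j^s u D_i^s v + a^i u D_i^s v + b^i v D_i^s u) dμ(s) dx + ∫_Ω a₀ u v dx`,
with absolutely convergent integrals. -/
def IsWeakForm (m : ℝ → E n → Matrix (Fin n) (Fin n) ℝ) (a b : ℝ → E n → Fin n → ℝ)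
    (a₀ : E n → ℝ) (B : H0 A Ω →L[ℝ] StrongDual ℝ (H0 A Ω)) : Prop :=
  ∀ u v : H0 A Ω,
    Integrable (formDensity m a b u v) (mixedMeasure n μ) ∧
    IntegrableOn (fun x => a₀ x * u.val x * v.val x) Ω ∧
    B u v = (∫ p, formDensity m a b u v p ∂(mixedMeasure n μ)) +
      ∫ x in (Ω : Set (E n)), a₀ x * u.val x * v.val x

/-- `f(x) = b^{ij}(x) (a^i(x) a^j(x) + b^i(x) b^j(x)) + |a(x)|`. -/
def weight (bm : E n → Matrix (Fin n) (Fin n) ℝ) (am bv : E n → Fin n → ℝ) (a₀ : E n → ℝ)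
    (x : E n) : ℝ :=
  (∑ i, ∑ j, bm x i j * (am x i * am x j + bv x i * bv x j)) + |a₀ x|

/-- A nonnegative measurable function `f` on `Ω` is compactly bounded on `H⁰(A, Ω)` if for every
`ε > 0` there is `K ≥ 0` with `∫_Ω f φ² ≤ ε ‖φ‖²_{H⁰(A,Ω)} + K ‖φ‖²_{L¹(Ω)}` for all
`φ ∈ 𝓓(Ω)`. -/
def CompactlyBounded (A : CoeffMatrix n μ) (Ω : Opens (E n)) (f : E n → ℝ) : Prop :=
  AEMeasurable f (volume.restrict Ω) ∧ (∀ x ∈ Ω, 0 ≤ f x) ∧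
  ∀ ε : ℝ, 0 < ε → ∃ K : ℝ, 0 ≤ K ∧ ∀ φ : 𝓓(Ω, ℝ),
    ∫⁻ x in (Ω : Set (E n)), ENNReal.ofReal (f x * φ x ^ 2) ≤
      ENNReal.ofReal ε * energy A (fun p => fracGrad p.1 φ p.2) +
        ENNReal.ofReal K * (∫⁻ x in (Ω : Set (E n)), ENNReal.ofReal |φ x|) ^ 2

end MixedOrder

end

/-!
# The Fredholm alternative for mixed order operators with measurable coefficients

The theorem is the Riesz-Schauder theory of the pencil `L + σ J` on the Hilbert space
`H = H⁰(A, Ω)`, where `J = I(f)` is the form `∫_Ω f u v`. If `L + σ₀ J` is coercive, it is an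
isomorphism `e` of `H` onto its dual by the Lax-Milgram theorem, and
`L + σ J = e (1 + (σ - σ₀) e⁻¹ J)`. If moreover `J` is compact, symmetric and nonnegative, then
`1 + (σ - σ₀) e⁻¹ J` is a Fredholm operator of index zero, it fails to be invertible only if
`-(σ - σ₀)⁻¹` is an eigenvalue of the compact operator `e⁻¹ J`, and this cannot happen for
`σ ≥ σ₀`. This is `fredholm_alternative_pencil`. What remains is analysis.

*Test functions have finite energy* (`energy_fracGrad_lt_top`). The field `D^s φ` is bounded and
decays like `|x|⁻ⁿ`, uniformly for `s` in the support of `μ`: near `s = 1` the singular integral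
grows like `(1 - s)⁻¹` but `c_{s,n}` vanishes like `1 - s`. Hence `|D^s φ|²` is integrable against
`Λ`.

*`H` embeds compactly into `L¹`* (`H0.isCompactOperator_of_gradient_le`). As `μ` charges `s = 1`
and `λ⁻¹ ∈ L¹(Ω)`, the Cauchy-Schwarz inequality bounds `∫ |∇φ|` by the energy norm. Therefore
translating `φ` by `z` changes it by at most `C |z| ‖φ‖` in `L¹`. A translation out of `Ω` gives
Poincaré's inequality, so that the norm of `H` separates points and `H` is complete
(`H0.completeSpace`); averaging over small cubes approximates the embedding by operators of finite
rank.

*`J` is compact* (`isCompactOperator_of_apply_self_le`). By Fatou's lemma compact boundedness holds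
on all of `H`: `J u u ≤ ε ‖u‖² + K_ε ‖u‖²_{L¹}`. With the Cauchy-Schwarz inequality for `J` this
gives `‖J u‖ ≤ δ ‖u‖ + K ‖u‖_{L¹}` for every `δ > 0`, and the last norm is that of a compact
operator.

*`L + σ₀ J` is coercive* (`exists_isWeakForm_coercive`). The sector condition on `A`, applied to
`ψ = A⁻¹ α`, gives `|α · ξ|² ≤ K (αᵀ A⁻¹ α)(ξᵀ A ξ)` (`sq_sum_mul_le`). Therefore
`|a · D^s v|²` and `|b · D^s v|²` are at most `K f (D^s v)ᵀ A (D^s v)`, which makes all integrals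
absolutely convergent and bounds the lower order terms of `L` by half of the energy plus a multiple
of `J u u`.
-/

noncomputable section

namespace MixedOrder

/-! ### The Fredholm alternative for pencils of forms -/

section Fredholm

/-- A finite-rank perturbation of the identity has kernel and cokernel of the same finite
dimension. -/
lemma finrank_ker_one_add_of_finite_range {V : Type*} [AddCommGroup V] [Module ℝ V]
    (F : V →ₗ[ℝ] V) [FiniteDimensional ℝ F.range] :
    FiniteDimensional ℝ (LinearMap.ker (1 + F)) ∧
      FiniteDimensional ℝ (V ⧸ LinearMap.range (1 + F)) ∧
      Module.finrank ℝ (LinearMap.ker (1 + F)) =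
        Module.finrank ℝ (V ⧸ LinearMap.range (1 + F)) := by
  set W := F.range with hW
  have hT : ∀ v ∈ W, (1 + F) v ∈ W := fun v hv => W.add_mem hv ⟨v, rfl⟩
  set TW : W →ₗ[ℝ] W := (1 + F).restrict hT with hTW
  -- vectors of the kernel satisfy `v = -F v`, hence lie in the range of `F`
  have hker : LinearMap.ker (1 + F) ≤ W := by
    intro v hv
    have h : v + F v = 0 := hv
    rw [eq_neg_of_add_eq_zero_left h]
    exact W.neg_mem ⟨v, rfl⟩
  have hkerW : LinearMap.ker TW = (LinearMap.ker (1 + F)).comap W.subtype := by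
    ext w
    simp [hTW, LinearMap.mem_ker, ← Subtype.coe_inj]
  let e₁ : LinearMap.ker TW ≃ₗ[ℝ] LinearMap.ker (1 + F) :=
    (LinearEquiv.ofEq _ _ hkerW).trans (Submodule.comapSubtypeEquivOfLe hker)
  let g : W →ₗ[ℝ] V ⧸ LinearMap.range (1 + F) := (LinearMap.range (1 + F)).mkQ ∘ₗ W.subtype
  have hgker : LinearMap.ker g = LinearMap.range TW := by
    ext w
    simp only [g, LinearMap.mem_ker, LinearMap.comp_apply, Submodule.subtype_apply,
      Submodule.mkQ_apply, Submodule.Quotient.mk_eq_zero]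
    constructor
    · rintro ⟨v, hv⟩
      have h : v + F v = w := hv
      have hvW : v ∈ W := by
        rw [eq_sub_of_add_eq h]
        exact W.sub_mem w.2 ⟨v, rfl⟩
      exact ⟨⟨v, hvW⟩, Subtype.ext hv⟩
    · rintro ⟨v, hv⟩
      exact ⟨v, congrArg Subtype.val hv⟩
  have hgsurj : Function.Surjective g := by
    intro q
    obtain ⟨v, rfl⟩ := Submodule.mkQ_surjective _ q
    refine ⟨⟨-F v, W.neg_mem ⟨v, rfl⟩⟩, ?_⟩
    simp only [g, LinearMap.comp_apply, Submodule.subtype_apply, Submodule.mkQ_apply]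
    rw [Submodule.Quotient.eq]
    refine ⟨-v, ?_⟩
    simp only [map_neg, LinearMap.add_apply, Module.End.one_apply]
    abel
  let e₂ : (W ⧸ LinearMap.ker g) ≃ₗ[ℝ] V ⧸ LinearMap.range (1 + F) :=
    g.quotKerEquivOfSurjective hgsurj
  refine ⟨e₁.finiteDimensional, e₂.finiteDimensional, ?_⟩
  rw [← e₁.finrank_eq, ← e₂.finrank_eq, hgker]
  have h1 := LinearMap.finrank_range_add_finrank_ker TW
  have h2 := Submodule.finrank_quotient_add_finrank (LinearMap.range TW)
  omega

variable {V : Type*} [NormedAddCommGroup V] [InnerProductSpace ℝ V]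

/-- On a Hilbert space compact operators are norm limits of finite-rank operators: compose with
the orthogonal projection onto the span of a finite net of the image of the ball. -/
lemma exists_finite_range_norm_sub_lt {K : V →L[ℝ] V} (hK : IsCompactOperator K) :
    ∃ F : V →L[ℝ] V, FiniteDimensional ℝ F.toLinearMap.range ∧ ‖K - F‖ < 1 := by
  have htb : TotallyBounded (K '' Metric.closedBall 0 1) :=
    (hK.isCompact_closure_image_closedBall (f := K.toLinearMap) 1).totallyBounded.subset
      subset_closure
  obtain ⟨t, ht, hcov⟩ := Metric.totallyBounded_iff.1 htb (1 / 2) (by norm_num)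
  set U : Submodule ℝ V := Submodule.span ℝ t with hU
  have : FiniteDimensional ℝ U := FiniteDimensional.span_of_finite ℝ ht
  refine ⟨U.starProjection ∘L K, ?_, ?_⟩
  · refine Submodule.finiteDimensional_of_le (S₂ := U) ?_
    rintro _ ⟨v, rfl⟩
    exact Submodule.starProjection_apply_mem U (K v)
  · refine lt_of_le_of_lt (ContinuousLinearMap.opNorm_le_of_unit_norm (C := 1 / 2) (by norm_num) ?_)
      (by norm_num)
    intro x hx
    have hx' : K x ∈ K '' Metric.closedBall 0 1 := ⟨x, by simp [hx], rfl⟩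
    obtain ⟨y, hy, hxy⟩ := mem_iUnion₂.1 (hcov hx')
    have h1 : ‖K x - U.starProjection (K x)‖ ≤ ‖K x - y‖ := by
      rw [U.starProjection_minimal]
      exact ciInf_le ⟨0, by rintro _ ⟨w, rfl⟩; exact norm_nonneg _⟩
        (⟨y, Submodule.subset_span hy⟩ : U)
    rw [Metric.mem_ball, dist_eq_norm] at hxy
    exact h1.trans hxy.le

/-- Riesz theory on a Hilbert space: for compact `K` and an isomorphism `e₀`, the operator
`T = e₀ (1 + K)` has closed range, and its kernel and the orthogonal complement of its range have
the same finite dimension. -/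
lemma fredholm_of_eq_one_add_compact [CompleteSpace V] {K T : V →L[ℝ] V} (hK : IsCompactOperator K)
    (e₀ : V ≃L[ℝ] V) (hT : ∀ v, T v = e₀ (v + K v)) :
    FiniteDimensional ℝ (LinearMap.ker T.toLinearMap) ∧
      IsClosed (T.toLinearMap.range : Set V) ∧
      FiniteDimensional ℝ (T.toLinearMap.rangeᗮ : Submodule ℝ V) ∧
      Module.finrank ℝ (LinearMap.ker T.toLinearMap) =
        Module.finrank ℝ (T.toLinearMap.rangeᗮ : Submodule ℝ V) := by
  obtain ⟨F, hF, hKF⟩ := exists_finite_range_norm_sub_lt hK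
  -- `1 + K = A (1 + A⁻¹ F)` with `A = 1 + (K - F)` invertible
  let A : (V →L[ℝ] V)ˣ := Units.oneSub (-(K - F)) (by rwa [norm_neg])
  let e : V ≃L[ℝ] V := (ContinuousLinearEquiv.ofUnit A).trans e₀
  set F' : V →L[ℝ] V := ((ContinuousLinearEquiv.ofUnit A).symm : V →L[ℝ] V) ∘L F with hF'
  have hfac : ∀ v, T v = e ((1 + F') v) := by
    intro v
    have h1 : ∀ w, e w = e₀ (w + (K w - F w)) := fun w => by
      change e₀ (((1 : V →L[ℝ] V) - (-(K - F))) w) = _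
      congr 1
      simp only [sub_apply, neg_apply, one_apply_eq_self]
      abel
    have h2 : e (F' v) = e₀ (F v) :=
      congrArg e₀ ((ContinuousLinearEquiv.ofUnit A).apply_symm_apply _)
    rw [add_apply, map_add, one_apply_eq_self, h2, h1, hT, ← map_add]
    congr 1
    abel
  have : FiniteDimensional ℝ F'.toLinearMap.range := by
    have : F'.toLinearMap.range = F.toLinearMap.range.map
        (ContinuousLinearEquiv.ofUnit A).symm.toLinearEquiv.toLinearMap := by
      rw [← LinearMap.range_comp]; rfl
    rw [this]
    infer_instance
  obtain ⟨k1, k2, k3⟩ := finrank_ker_one_add_of_finite_range F'.toLinearMap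
  have hker : LinearMap.ker T.toLinearMap = LinearMap.ker (1 + F'.toLinearMap) := by
    ext v
    have : T v = 0 ↔ (1 + F') v = 0 := by rw [hfac, e.map_eq_zero_iff]
    exact this
  have hrange : T.toLinearMap.range =
      (LinearMap.range (1 + F'.toLinearMap)).map e.toLinearEquiv.toLinearMap := by
    rw [← LinearMap.range_comp]
    congr 1
    ext v
    exact hfac v
  have eq : (V ⧸ LinearMap.range (1 + F'.toLinearMap)) ≃ₗ[ℝ] (V ⧸ T.toLinearMap.range) :=
    Submodule.Quotient.equiv _ _ e.toLinearEquiv hrange.symm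
  have : FiniteDimensional ℝ (V ⧸ T.toLinearMap.range) := eq.finiteDimensional
  have hcl : IsClosed (T.toLinearMap.range : Set V) := by
    -- the range of `1 + F'` contains the closed finite-codimensional subspace `ker F'`
    have h1 : LinearMap.ker F'.toLinearMap ≤ LinearMap.range (1 + F'.toLinearMap) := by
      intro v hv
      refine ⟨v, ?_⟩
      rw [LinearMap.add_apply, LinearMap.mem_ker.1 hv, add_zero]; rfl
    have : FiniteDimensional ℝ (V ⧸ LinearMap.ker F'.toLinearMap) :=
      (F'.toLinearMap.quotKerEquivRange).symm.finiteDimensional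
    have h2 : IsClosed (LinearMap.range (1 + F'.toLinearMap) : Set V) :=
      Submodule.isClosed_mono_of_finiteDimensional_quotient F'.isClosed_ker h1
    rw [hrange]
    exact (e.toHomeomorph.isClosed_image).2 h2
  have : (T.toLinearMap.range).HasOrthogonalProjection := by
    have := hcl.completeSpace_coe
    infer_instance
  let q := Submodule.quotientEquivOfIsCompl _ _
    (Submodule.isCompl_orthogonal (K := T.toLinearMap.range))
  refine ⟨hker ▸ k1, hcl, q.finiteDimensional, ?_⟩
  rw [← q.finrank_eq, ← eq.finrank_eq, ← k3, hker]

/-- The eigenvalues of a compact operator can only accumulate at zero. For distinct eigenvalues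
`l k` with eigenvectors `f k`, the Gram-Schmidt orthonormalisation `x k` of `f` satisfies
`⟪K (x k), x k⟫ = l k` and `⟪K (x j), x k⟫ = 0` for `j < k`, so the images `K (x k)` would be
uniformly separated. -/
lemma finite_hasEigenvalue_le_abs {K : V →L[ℝ] V} (hK : IsCompactOperator K) {c : ℝ}
    (hc : 0 < c) :
    {l : ℝ | c ≤ |l| ∧ Module.End.HasEigenvalue (K.toLinearMap : Module.End ℝ V) l}.Finite := by
  by_contra hinf
  let l := Set.Infinite.natEmbedding _ hinf
  have hl : ∀ k, c ≤ |(l k : ℝ)| := fun k => (l k).2.1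
  choose f hf using fun k => (l k).2.2.exists_hasEigenvector
  have hli : LinearIndependent ℝ f :=
    Module.End.eigenvectors_linearIndependent' _ (fun k => (l k : ℝ))
      (Subtype.val_injective.comp l.injective) f hf
  set x : ℕ → V := InnerProductSpace.gramSchmidtNormed ℝ f with hx
  have hon : Orthonormal ℝ x := InnerProductSpace.gramSchmidtNormed_orthonormal hli
  have hIic : ∀ k, Submodule.span ℝ (x '' Iic k) = Submodule.span ℝ (f '' Iic k) := fun k => by
    rw [hx, InnerProductSpace.span_gramSchmidtNormed, InnerProductSpace.span_gramSchmidt_Iic]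
  have hIio : ∀ k, Submodule.span ℝ (x '' Iio k) = Submodule.span ℝ (f '' Iio k) := fun k => by
    rw [hx, InnerProductSpace.span_gramSchmidtNormed, InnerProductSpace.span_gramSchmidt_Iio]
  have hmem : ∀ k, x k ∈ Submodule.span ℝ (f '' Iic k) := fun k => by
    rw [← hIic]
    exact Submodule.subset_span ⟨k, mem_Iic.2 le_rfl, rfl⟩
  have hKf : ∀ k, K (f k) = (l k : ℝ) • f k := fun k => (hf k).apply_eq_smul
  have hperp : ∀ k, ∀ v ∈ Submodule.span ℝ (f '' Iio k), inner ℝ v (x k) = 0 := by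
    intro k v hv
    rw [← hIio] at hv
    induction hv using Submodule.span_induction with
    | mem v hv =>
      obtain ⟨j, hj, rfl⟩ := hv
      exact hon.2 (ne_of_lt hj)
    | zero => exact inner_zero_left _
    | add v w _ _ hv hw => rw [inner_add_left, hv, hw, add_zero]
    | smul a v _ hv => rw [real_inner_smul_left, hv, mul_zero]
  have hshift : ∀ k, ∀ v ∈ Submodule.span ℝ (f '' Iic k),
      K v - (l k : ℝ) • v ∈ Submodule.span ℝ (f '' Iio k) := by
    intro k v hv
    induction hv using Submodule.span_induction with
    | mem v hv =>
      obtain ⟨j, hj, rfl⟩ := hv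
      rcases (mem_Iic.1 hj).eq_or_lt with rfl | hlt
      · rw [hKf, sub_self]
        exact Submodule.zero_mem _
      · rw [hKf, ← sub_smul]
        exact Submodule.smul_mem _ _ (Submodule.subset_span ⟨j, hlt, rfl⟩)
    | zero => simp
    | add v w _ _ hv hw =>
      have : K (v + w) - (l k : ℝ) • (v + w) =
          (K v - (l k : ℝ) • v) + (K w - (l k : ℝ) • w) := by
        rw [map_add, smul_add]; abel
      rw [this]
      exact Submodule.add_mem _ hv hw
    | smul a v _ hv =>
      have : K (a • v) - (l k : ℝ) • (a • v) = a • (K v - (l k : ℝ) • v) := by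
        rw [map_smul, smul_sub, smul_comm]
      rw [this]
      exact Submodule.smul_mem _ _ hv
  have hdiag : ∀ k, inner ℝ (K (x k)) (x k) = (l k : ℝ) := by
    intro k
    have h := hperp k _ (hshift k _ (hmem k))
    rw [inner_sub_left, real_inner_smul_left, real_inner_self_eq_norm_sq, hon.1 k] at h
    linarith
  have hoff : ∀ j k, j < k → inner ℝ (K (x j)) (x k) = 0 := by
    intro j k hjk
    have h1 : Submodule.span ℝ (f '' Iio j) ≤ Submodule.span ℝ (f '' Iio k) :=
      Submodule.span_mono (image_mono (Iio_subset_Iio hjk.le))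
    have h2 : Submodule.span ℝ (f '' Iic j) ≤ Submodule.span ℝ (f '' Iio k) :=
      Submodule.span_mono (image_mono fun i hi => lt_of_le_of_lt hi hjk)
    have h3 := Submodule.add_mem _ (h1 (hshift j _ (hmem j)))
      (Submodule.smul_mem _ (l j : ℝ) (h2 (hmem j)))
    rw [sub_add_cancel] at h3
    exact hperp k _ h3
  have hsep : ∀ j k, j < k → c ≤ ‖K (x k) - K (x j)‖ := by
    intro j k hjk
    have h := abs_real_inner_le_norm (K (x k) - K (x j)) (x k)
    rw [inner_sub_left, hdiag, hoff j k hjk, sub_zero, hon.1 k, mul_one] at h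
    exact (hl k).trans h
  obtain ⟨C, hC, hC'⟩ := hK.image_closedBall_subset_compact (f := K.toLinearMap) 1
  obtain ⟨y, -, ψ, hψ, hψy⟩ :=
    hC.tendsto_subseq (x := fun k => K (x k)) fun k => hC' ⟨x k, by simp [hon.1 k], rfl⟩
  obtain ⟨N, hN⟩ := Metric.cauchySeq_iff'.1 hψy.cauchySeq c hc
  have h1 := hN (N + 1) (by omega)
  rw [dist_eq_norm] at h1
  exact absurd (hsep _ _ (hψ (Nat.lt_succ_self N))) (not_le.2 h1)

/-- The Fredholm alternative for the pencil `L + σ J` of bounded bilinear forms on a Hilbert space,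
where `J` is symmetric, nonnegative and compact and `L + σ₀ J` is coercive; `L'` is the transpose
of `L`. Writing `L + σ₀ J = e` by the Lax-Milgram theorem, `L + σ J = e (1 + (σ - σ₀) e⁻¹ J)`. -/
theorem fredholm_alternative_pencil [CompleteSpace V] (L L' J : V →L[ℝ] StrongDual ℝ V)
    (hL' : ∀ u v, L' u v = L v u) (hJ : ∀ u v, J u v = J v u) (hJ0 : ∀ u, 0 ≤ J u u)
    (hJc : IsCompactOperator J) (σ₀ : ℝ)
    (hcoer : ∃ c : ℝ, 0 < c ∧ ∀ u, c * ‖u‖ ^ 2 ≤ (L + σ₀ • J) u u) :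
    ∃ S : Set ℝ,
      S.Countable ∧ (∀ σ : ℝ, ¬ AccPt σ (𝓟 S)) ∧ S ⊆ Iio σ₀ ∧
      (∀ σ, σ ∈ S ↔ ∃ u : V, u ≠ 0 ∧ (L + σ • J) u = 0) ∧
      (∀ σ, σ ∉ S → Function.Bijective (L + σ • J)) ∧
      (∀ σ ∈ S,
        FiniteDimensional ℝ (LinearMap.ker (L + σ • J).toLinearMap) ∧
        FiniteDimensional ℝ (LinearMap.ker (L' + σ • J).toLinearMap) ∧
        0 < Module.finrank ℝ (LinearMap.ker (L + σ • J).toLinearMap) ∧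
        Module.finrank ℝ (LinearMap.ker (L + σ • J).toLinearMap) =
          Module.finrank ℝ (LinearMap.ker (L' + σ • J).toLinearMap)) ∧
      (∀ σ, σ ∉ S → ∀ T, ∃! u : V, (L + σ • J) u = T) ∧
      (∀ σ ∈ S, ∀ T, (¬ ∃ u : V, (L + σ • J) u = T) ∨ {u : V | (L + σ • J) u = T}.Infinite) ∧
      (∀ (σ : ℝ) (T : StrongDual ℝ V),
        (∃ u : V, (L + σ • J) u = T) ↔ ∀ w : V, (L' + σ • J) w = 0 → T w = 0) := by
  obtain ⟨c, hc, hcoer⟩ := hcoer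
  have hB : IsCoercive (L + σ₀ • J : V →L[ℝ] V →L[ℝ] ℝ) :=
    ⟨c, hc, fun u => by rw [mul_assoc, ← sq]; exact hcoer u⟩
  let e : V ≃L[ℝ] V := hB.continuousLinearEquivOfBilin
  have he : ∀ u w, inner ℝ (e u) w = L u w + σ₀ * J u w := fun u w =>
    hB.continuousLinearEquivOfBilin_apply u w
  let J' : V →L[ℝ] V := InnerProductSpace.continuousLinearMapOfBilin J
  have hJ' : ∀ u w, inner ℝ (J' u) w = J u w := fun u w =>
    InnerProductSpace.continuousLinearMapOfBilin_apply J u w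
  have hJ'c : IsCompactOperator J' := by
    have h := hJc.continuous_comp (g := (InnerProductSpace.toDual ℝ V).symm)
      (LinearIsometryEquiv.continuous _)
    exact h
  let K₀ : V →L[ℝ] V := (e.symm : V →L[ℝ] V) ∘L J'
  have hK₀ : IsCompactOperator K₀ := hJ'c.clm_comp (e.symm : V →L[ℝ] V)
  -- the operator on `V` that represents the form `L + σ J`
  let P : ℝ → V →L[ℝ] V := fun σ => (e : V →L[ℝ] V) + (σ - σ₀) • J'
  have hP : ∀ σ u w, inner ℝ (P σ u) w = (L + σ • J) u w := by
    intro σ u w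
    change inner ℝ (e u + (σ - σ₀) • J' u) w = L u w + σ * J u w
    rw [inner_add_left, real_inner_smul_left, he, hJ']
    ring
  have hPe : ∀ σ u, P σ u = e (u + ((σ - σ₀) • K₀) u) := by
    intro σ u
    rw [map_add]
    change e u + (σ - σ₀) • J' u = e u + e ((σ - σ₀) • e.symm (J' u))
    rw [map_smul, e.apply_symm_apply]
  have hred := fun σ => fredholm_of_eq_one_add_compact (T := P σ) (K := (σ - σ₀) • K₀)
    (hK₀.smul (σ - σ₀)) e (hPe σ)
  have hP0 : ∀ σ u, P σ u = 0 ↔ (L + σ • J) u = 0 := by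
    intro σ u
    constructor
    · intro h
      ext w
      rw [← hP, h, inner_zero_left]; rfl
    · intro h
      refine ext_inner_right ℝ fun w => ?_
      rw [hP, h, inner_zero_left]; rfl
  have hker : ∀ σ, LinearMap.ker (P σ).toLinearMap = LinearMap.ker (L + σ • J).toLinearMap :=
    fun σ => Submodule.ext fun u => hP0 σ u
  have hadj : ∀ (σ : ℝ) u w, (L' + σ • J) w u = (L + σ • J) u w := by
    intro σ u w
    change L' w u + σ * J w u = L u w + σ * J u w
    rw [hL', hJ w u]
  -- the orthogonal complement of the range is the kernel of the transposed operator
  have hker' : ∀ σ : ℝ, (P σ).toLinearMap.rangeᗮ = LinearMap.ker (L' + σ • J).toLinearMap := by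
    intro σ
    ext w
    rw [Submodule.mem_orthogonal, LinearMap.mem_ker]
    constructor
    · intro h
      ext u
      have := h (P σ u) ⟨u, rfl⟩
      rw [hP, ← hadj] at this
      exact this
    · rintro h _ ⟨u, rfl⟩
      change inner ℝ (P σ u) w = 0
      rw [hP, ← hadj]
      exact DFunLike.congr_fun h u
  have hsolv : ∀ (σ : ℝ) (T : StrongDual ℝ V),
      (∃ u : V, (L + σ • J) u = T) ↔ ∀ w : V, (L' + σ • J) w = 0 → T w = 0 := by
    intro σ T
    constructor
    · rintro ⟨u, rfl⟩ w hw
      rw [← hadj, hw]; rfl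
    · intro h
      have := (hred σ).2.1.completeSpace_coe
      have hT : (InnerProductSpace.toDual ℝ V).symm T ∈ (P σ).toLinearMap.range := by
        rw [← Submodule.orthogonal_orthogonal (P σ).toLinearMap.range, Submodule.mem_orthogonal]
        intro w hw
        rw [hker'] at hw
        rw [real_inner_comm, InnerProductSpace.toDual_symm_apply]
        exact h w hw
      obtain ⟨u, hu⟩ := hT
      refine ⟨u, ?_⟩
      ext w
      rw [← hP, ← InnerProductSpace.toDual_symm_apply, ← hu]; rfl
  set S : Set ℝ := {σ | ∃ u : V, u ≠ 0 ∧ (L + σ • J) u = 0} with hS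
  -- for `σ ≥ σ₀` the form `L + σ J` is coercive
  have hSlt : S ⊆ Iio σ₀ := by
    rintro σ ⟨u, hu, h⟩
    by_contra hσ
    have hσ' : σ₀ ≤ σ := not_lt.1 hσ
    have h1 : L u u + σ * J u u = 0 := DFunLike.congr_fun h u
    have h2 : c * ‖u‖ ^ 2 ≤ L u u + σ₀ * J u u := hcoer u
    have h3 : 0 < c * ‖u‖ ^ 2 := by have := norm_pos_iff.2 hu; positivity
    nlinarith [mul_le_mul_of_nonneg_right hσ' (hJ0 u)]
  -- `σ ∈ S` makes `-(σ - σ₀)⁻¹` an eigenvalue of the compact operator `K₀ = e⁻¹ J'`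
  have hSfin : ∀ N : ℝ, 0 < N → (Ioo (σ₀ - N) (σ₀ + N) ∩ S).Finite := by
    intro N hN
    refine Set.Finite.of_finite_image (f := fun σ => -(σ - σ₀)⁻¹)
      ((finite_hasEigenvalue_le_abs hK₀ (inv_pos.2 hN)).subset ?_) ?_
    · rintro _ ⟨σ, ⟨hσ, hσS⟩, rfl⟩
      have hne : σ - σ₀ ≠ 0 := (sub_neg.2 (hSlt hσS)).ne
      refine ⟨?_, ?_⟩
      · rw [abs_neg, abs_inv]
        refine inv_anti₀ (abs_pos.2 hne) (abs_le.2 ⟨?_, ?_⟩) <;> linarith [hσ.1, hσ.2]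
      · obtain ⟨u, hu, h⟩ := hσS
        refine Module.End.hasEigenvalue_of_hasEigenvector (x := u)
          ⟨Module.End.mem_eigenspace_iff.2 ?_, hu⟩
        rw [← hP0, hPe, e.map_eq_zero_iff] at h
        change u + (σ - σ₀) • K₀ u = 0 at h
        change K₀ u = -(σ - σ₀)⁻¹ • u
        conv_rhs => rw [eq_neg_of_add_eq_zero_left h]
        rw [smul_neg, neg_smul, neg_neg, smul_smul,
          inv_mul_cancel₀ hne, one_smul]
    · intro σ _ τ _ h
      have h' := inv_injective (neg_injective h)
      linarith
  have huniq : ∀ σ : ℝ, σ ∉ S → LinearMap.ker (L + σ • J).toLinearMap = ⊥ := by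
    intro σ hσ
    rw [LinearMap.ker_eq_bot']
    intro u hu
    by_contra hne
    exact hσ ⟨u, hne, hu⟩
  have hbij : ∀ σ : ℝ, σ ∉ S → Function.Bijective (L + σ • J) := by
    intro σ hσ
    refine ⟨LinearMap.ker_eq_bot.1 (huniq σ hσ), fun T => (hsolv σ T).2 fun w hw => ?_⟩
    obtain ⟨-, -, hfd, hdim⟩ := hred σ
    rw [hker, huniq σ hσ, finrank_bot] at hdim
    have hbot := Submodule.finrank_eq_zero.1 hdim.symm
    rw [hker'] at hbot
    rw [(LinearMap.ker_eq_bot'.1 hbot) w hw, map_zero]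
  refine ⟨S, ?_, ?_, hSlt, fun σ => Iff.rfl, hbij, ?_, ?_, ?_, hsolv⟩
  · have hU : S = ⋃ N : ℕ, Ioo (σ₀ - ((N : ℝ) + 1)) (σ₀ + ((N : ℝ) + 1)) ∩ S := by
      rw [← iUnion_inter, eq_comm, inter_eq_right]
      intro σ _
      obtain ⟨N, hN⟩ := exists_nat_gt |σ - σ₀|
      have := abs_lt.1 hN
      exact mem_iUnion.2 ⟨N, by constructor <;> linarith [this.1, this.2]⟩
    rw [hU]
    exact countable_iUnion fun N => (hSfin _ (by positivity)).countable
  · intro σ hσ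
    have hnhds : Ioo (σ₀ - (|σ - σ₀| + 1)) (σ₀ + (|σ - σ₀| + 1)) ∈ 𝓝 σ := by
      refine Ioo_mem_nhds ?_ ?_ <;> linarith [neg_abs_le (σ - σ₀), le_abs_self (σ - σ₀)]
    exact Set.Infinite.of_accPt (hσ.nhds_inter hnhds) (hSfin _ (by positivity))
  · intro σ hσ
    obtain ⟨h1, -, h3, h4⟩ := hred σ
    rw [hker] at h1 h4
    rw [hker'] at h3 h4
    refine ⟨h1, h3, ?_, h4⟩
    obtain ⟨u, hu, h⟩ := hσ
    refine Module.finrank_pos_iff_exists_ne_zero.2 ⟨⟨u, h⟩, fun h0 => hu (congrArg Subtype.val h0)⟩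
  · intro σ hσ T
    exact (Function.bijective_iff_existsUnique _).1 (hbij σ hσ) T
  · intro σ hσ T
    by_cases hT : ∃ u : V, (L + σ • J) u = T
    · right
      obtain ⟨u, hu⟩ := hT
      obtain ⟨w, hw, hw0⟩ := hσ
      refine Set.infinite_of_injective_forall_mem (f := fun t : ℝ => u + t • w) ?_ ?_
      · intro s t hst
        exact smul_left_injective ℝ hw (add_left_cancel hst)
      · intro t
        rw [mem_ofPred_eq, map_add, map_smul, hw0, smul_zero, add_zero, hu]
    · exact Or.inl hT

end Fredholm

/-! ### Translations of test functions and Poincaré's inequality -/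

section Sobolev

variable {n : ℕ} {Ω : Opens (E n)}

lemma continuous_gradient (φ : 𝓓(Ω, ℝ)) : Continuous (gradient φ) :=
  (InnerProductSpace.toDual ℝ (E n)).symm.continuous.comp (φ.contDiff.continuous_fderiv (by simp))

lemma norm_gradient (φ : 𝓓(Ω, ℝ)) (x : E n) : ‖gradient φ x‖ = ‖fderiv ℝ φ x‖ :=
  (InnerProductSpace.toDual ℝ (E n)).symm.norm_map _

/-- Translating a test function by `z` moves it by at most `‖z‖ ∫ |∇φ|` in `L¹`. -/
lemma lintegral_enorm_translate_sub_le (φ : 𝓓(Ω, ℝ)) (z : E n) :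
    ∫⁻ x, ‖φ (x + z) - φ x‖ₑ ≤ ‖z‖ₑ * ∫⁻ x, ‖gradient φ x‖ₑ := by
  have hfd : Continuous (fderiv ℝ φ) := φ.contDiff.continuous_fderiv (by simp)
  have hcont : Continuous fun p : E n × ℝ => fderiv ℝ φ (p.1 + p.2 • z) z :=
    (hfd.comp (continuous_fst.add (continuous_snd.smul continuous_const))).clm_apply
      continuous_const
  have hpt : ∀ x, ‖φ (x + z) - φ x‖ₑ ≤ ∫⁻ t in Ioc (0 : ℝ) 1, ‖fderiv ℝ φ (x + t • z) z‖ₑ := by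
    intro x
    have hderiv : ∀ t ∈ uIcc (0 : ℝ) 1,
        HasDerivAt (fun t : ℝ => φ (x + t • z)) (fderiv ℝ φ (x + t • z) z) t := by
      intro t _
      have h1 : HasFDerivAt φ (fderiv ℝ φ (x + t • z)) (x + t • z) :=
        (φ.contDiff.differentiable (by simp) _).hasFDerivAt
      have h2 : HasDerivAt (fun t : ℝ => x + t • z) z t := by
        simpa using ((hasDerivAt_id t).smul_const z).const_add x
      exact h1.comp_hasDerivAt t h2
    have hint : IntervalIntegrable (fun t : ℝ => fderiv ℝ φ (x + t • z) z) volume 0 1 :=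
      (hcont.comp (Continuous.prodMk_right x)).intervalIntegrable _ _
    have h := intervalIntegral.integral_eq_sub_of_hasDerivAt hderiv hint
    simp only [one_smul, zero_smul, add_zero] at h
    rw [← h, intervalIntegral.integral_of_le zero_le_one]
    exact enorm_integral_le_lintegral_enorm _
  calc ∫⁻ x, ‖φ (x + z) - φ x‖ₑ
      ≤ ∫⁻ x, ∫⁻ t in Ioc (0 : ℝ) 1, ‖fderiv ℝ φ (x + t • z) z‖ₑ := lintegral_mono hpt
    _ = ∫⁻ t in Ioc (0 : ℝ) 1, ∫⁻ x, ‖fderiv ℝ φ (x + t • z) z‖ₑ :=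
        lintegral_lintegral_swap hcont.enorm.measurable.aemeasurable
    _ ≤ ∫⁻ _ in Ioc (0 : ℝ) 1, ‖z‖ₑ * ∫⁻ x, ‖gradient φ x‖ₑ := by
        refine lintegral_mono fun t => ?_
        rw [lintegral_add_right_eq_self (fun x => ‖fderiv ℝ φ x z‖ₑ) (t • z),
          ← lintegral_const_mul _ (continuous_gradient φ).enorm.measurable]
        refine lintegral_mono fun x => ?_
        have h1 : ‖fderiv ℝ φ x‖ₑ = ‖gradient φ x‖ₑ := by
          rw [← ofReal_norm, ← ofReal_norm, norm_gradient]
        rw [← h1, mul_comm]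
        exact ContinuousLinearMap.le_opENorm _ _
    _ = ‖z‖ₑ * ∫⁻ x, ‖gradient φ x‖ₑ := by simp

lemma eq_zero_of_notMem (φ : 𝓓(Ω, ℝ)) {x : E n} (hx : x ∉ Ω) : φ x = 0 :=
  image_eq_zero_of_notMem_tsupport fun h => hx (φ.tsupport_subset h)

lemma gradient_eq_zero_of_notMem (φ : 𝓓(Ω, ℝ)) {x : E n} (hx : x ∉ Ω) : gradient φ x = 0 := by
  have h : fderiv ℝ φ x = 0 :=
    image_eq_zero_of_notMem_tsupport fun h => hx (φ.tsupport_subset (tsupport_fderiv_subset ℝ h))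
  rw [gradient, h, map_zero]

lemma lintegral_enorm_gradient_lt_top (φ : 𝓓(Ω, ℝ)) : ∫⁻ x, ‖gradient φ x‖ₑ < ∞ := by
  have h : HasCompactSupport (gradient φ) :=
    (φ.hasCompactSupport.fderiv ℝ).comp_left (g := (InnerProductSpace.toDual ℝ (E n)).symm)
      (map_zero _)
  exact ((continuous_gradient φ).integrable_of_hasCompactSupport h).2

/-- Poincaré's inequality in `L¹`: translate by a vector longer than the diameter of `Ω`. -/
lemma exists_poincare (hn : 0 < n) (hΩ : Bornology.IsBounded (Ω : Set (E n))) :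
    ∃ D : ℝ, 0 ≤ D ∧ ∀ φ : 𝓓(Ω, ℝ),
      ∫⁻ x, ‖φ x‖ₑ ≤ ENNReal.ofReal D * ∫⁻ x, ‖gradient φ x‖ₑ := by
  obtain ⟨r, hr⟩ := hΩ.subset_ball (0 : E n)
  obtain ⟨e, he⟩ : ∃ e : E n, ‖e‖ = 2 * |r| := by
    refine ⟨EuclideanSpace.single ⟨0, hn⟩ (2 * |r|), ?_⟩
    rw [EuclideanSpace.single, PiLp.norm_single, Real.norm_of_nonneg (by positivity)]
  refine ⟨‖e‖, norm_nonneg _, fun φ => le_trans (lintegral_mono fun x => ?_)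
    ((lintegral_enorm_translate_sub_le φ e).trans_eq (by rw [ofReal_norm]))⟩
  by_cases hx : x ∈ Ω
  · have hxe : x + e ∉ Ω := by
      intro h
      have h1 := mem_ball_zero_iff.1 (hr hx)
      have h2 := mem_ball_zero_iff.1 (hr h)
      have h3 : ‖e‖ ≤ ‖x + e‖ + ‖x‖ := by
        simpa using norm_sub_le (x + e) x
      linarith [le_abs_self r]
    rw [eq_zero_of_notMem φ hxe, zero_sub, enorm_neg]
  · rw [eq_zero_of_notMem φ hx, enorm_zero]
    exact zero_le

/-! ### Averages over small cubes and Rellich's theorem in `L¹` -/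

/-- The half-open cube of side `h` with lower corner `h m`. -/
def cube (n : ℕ) (h : ℝ) (m : Fin n → ℤ) : Set (E n) := {x | ∀ i, ⌊x i / h⌋ = m i}

lemma measurableSet_cube (h : ℝ) (m : Fin n → ℤ) : MeasurableSet (cube n h m) := by
  have : cube n h m = ⋂ i, (fun x : E n => ⌊x i / h⌋) ⁻¹' {m i} := by
    ext x; simp [cube]
  rw [this]
  refine MeasurableSet.iInter fun i => ?_
  refine measurableSet_preimage (Int.measurable_floor.comp ?_) (measurableSet_singleton _)
  fun_prop

lemma volume_cube {h : ℝ} (hh : 0 < h) (m : Fin n → ℤ) :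
    volume (cube n h m) = ENNReal.ofReal (h ^ n) := by
  have : cube n h m = WithLp.ofLp ⁻¹'
      (univ.pi fun i => Ico ((m i : ℝ) * h) (((m i : ℝ) + 1) * h)) := by
    ext x
    simp only [cube, mem_ofPred, mem_preimage, mem_univ_pi, mem_Ico, Int.floor_eq_iff,
      le_div_iff₀ hh, div_lt_iff₀ hh]
  rw [this, (PiLp.volume_preserving_ofLp (Fin n)).measure_preimage
    (MeasurableSet.univ_pi fun i => measurableSet_Ico).nullMeasurableSet, Real.volume_pi_Ico]
  have h1 : ∀ i, ((m i : ℝ) + 1) * h - (m i : ℝ) * h = h := fun i => by ring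
  simp only [h1, Finset.prod_const, Finset.card_univ, Fintype.card_fin]
  rw [ENNReal.ofReal_pow hh.le]

lemma norm_sub_le_of_mem_cube {h : ℝ} (hh : 0 < h) {m : Fin n → ℤ} {x y : E n}
    (hx : x ∈ cube n h m) (hy : y ∈ cube n h m) : ‖y - x‖ ≤ n * h := by
  have hi : ∀ i, ‖(y - x) i‖ ≤ h := by
    intro i
    have h1 : |y i / h - x i / h| < 1 := Int.abs_sub_lt_one_of_floor_eq_floor (by rw [hx i, hy i])
    rw [← sub_div, abs_div, abs_of_pos hh, div_lt_one hh] at h1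
    exact h1.le
  calc ‖y - x‖ = ‖∑ i, EuclideanSpace.single i ((y - x) i)‖ := by
        congr 1
        ext j
        simp [Finset.sum_apply, Pi.single_apply]
    _ ≤ ∑ i, ‖EuclideanSpace.single i ((y - x) i)‖ := norm_sum_le _ _
    _ ≤ ∑ _i : Fin n, h := by
        refine Finset.sum_le_sum fun i _ => ?_
        rw [EuclideanSpace.single, PiLp.norm_single]
        exact hi i
    _ = n * h := by simp

lemma exists_finset_cover_cube (hΩ : Bornology.IsBounded (Ω : Set (E n))) {h : ℝ} (hh : 0 < h) :
    ∃ M : Finset (Fin n → ℤ), ∀ x ∈ Ω, ∀ m, x ∈ cube n h m → m ∈ M := by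
  obtain ⟨r, hr⟩ := hΩ.subset_ball (0 : E n)
  refine ⟨Finset.Icc (fun _ => ⌊-r / h⌋) (fun _ => ⌊r / h⌋), fun x hx m hm => ?_⟩
  have hxr := mem_ball_zero_iff.1 (hr hx)
  have hxi : ∀ i, |x i| ≤ r := fun i => (PiLp.norm_apply_le x i).trans hxr.le
  rw [Finset.mem_Icc]
  constructor
  · intro i
    rw [← hm i]
    exact Int.floor_mono (div_le_div_of_nonneg_right (abs_le.1 (hxi i)).1 hh.le)
  · intro i
    rw [← hm i]
    exact Int.floor_mono (div_le_div_of_nonneg_right (abs_le.1 (hxi i)).2 hh.le)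

/-- The functional `g ↦ ∫_s g` on `L¹`. -/
def setIntegralL1 (s : Set (E n)) : Lp ℝ 1 (volume : Measure (E n)) →L[ℝ] ℝ :=
  (L1.integralCLM (μ := volume.restrict s)) ∘L (LpToLpRestrictCLM (E n) ℝ ℝ volume 1 s)

lemma setIntegralL1_apply (s : Set (E n)) (g : Lp ℝ 1 (volume : Measure (E n))) :
    setIntegralL1 s g = ∫ x in s, g x := by
  rw [setIntegralL1, ContinuousLinearMap.comp_apply, ← L1.integral_eq, L1.integral_eq_integral]
  exact integral_congr_ae (LpToLpRestrictCLM_coeFn ℝ s g)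

/-- The finite-rank operator on `L¹` that replaces a function by its means over the cubes of side
`h` with index in `M`, and by zero elsewhere. -/
def cubeMean (n : ℕ) {h : ℝ} (hh : 0 < h) (M : Finset (Fin n → ℤ)) :
    Lp ℝ 1 (volume : Measure (E n)) →L[ℝ] Lp ℝ 1 (volume : Measure (E n)) :=
  ∑ m ∈ M, ((h ^ n)⁻¹ • setIntegralL1 (cube n h m)).smulRight
    (indicatorConstLp 1 (measurableSet_cube h m)
      (by rw [volume_cube hh]; exact ENNReal.ofReal_ne_top) (1 : ℝ))

lemma isCompactOperator_cubeMean {h : ℝ} (hh : 0 < h) (M : Finset (Fin n → ℤ)) :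
    IsCompactOperator (cubeMean n hh M) := by
  unfold cubeMean
  induction M using Finset.cons_induction with
  | empty => exact isCompactOperator_zero
  | cons m M hm ih =>
    rw [Finset.sum_cons]
    refine IsCompactOperator.add ?_ ih
    have h1 : IsCompactOperator ((h ^ n)⁻¹ • setIntegralL1 (cube n h m)) :=
      ⟨Metric.closedBall 0 1, isCompact_closedBall 0 1,
        (ContinuousLinearMap.continuous _).continuousAt.preimage_mem_nhds
          (by rw [map_zero]; exact Metric.closedBall_mem_nhds 0 one_pos)⟩
    exact h1.clm_comp (ContinuousLinearMap.toSpanSingleton ℝ _)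

lemma cubeMean_ae_eq {h : ℝ} (hh : 0 < h) (M : Finset (Fin n → ℤ))
    (g : Lp ℝ 1 (volume : Measure (E n))) :
    ∀ᵐ x, cubeMean n hh M g x =
      ∑ m ∈ M, (h ^ n)⁻¹ * (∫ y in cube n h m, g y) * (cube n h m).indicator (fun _ => 1) x := by
  unfold cubeMean
  induction M using Finset.cons_induction with
  | empty =>
    simp only [Finset.sum_empty]
    exact Lp.coeFn_zero ℝ 1 (volume : Measure (E n))
  | cons m M hm ih =>
    simp only [Finset.sum_cons]
    have hne : volume (cube n h m) ≠ ∞ := by rw [volume_cube hh]; exact ENNReal.ofReal_ne_top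
    rw [add_apply]
    filter_upwards [ih, Lp.coeFn_add ((((h ^ n)⁻¹ • setIntegralL1 (cube n h m)).smulRight
      (indicatorConstLp 1 (measurableSet_cube h m) hne (1 : ℝ))) g) _,
      Lp.coeFn_smul (((h ^ n)⁻¹ • setIntegralL1 (cube n h m)) g)
        (indicatorConstLp 1 (measurableSet_cube h m) hne (1 : ℝ)),
      indicatorConstLp_coeFn (p := 1) (hs := measurableSet_cube h m) (hμs := hne) (c := (1 : ℝ))]
      with x h1 h2 h3 h4
    rw [h2, Pi.add_apply, h1]
    congr 1
    rw [ContinuousLinearMap.smulRight_apply, h3, Pi.smul_apply, h4, smul_eq_mul, ← setIntegralL1_apply]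
    rfl

/-- Replacing a test function by its means over the cubes of side `h` moves it by at most
`C h ∫ |∇φ|` in `L¹`: on a cube, `|φ(x) - mean|` is at most the mean of `|φ(x) - φ(y)|`, and `y - x`
has length at most `n h`, so the bound for translations applies. -/
lemma lintegral_enorm_sub_cubeMean_le {h : ℝ} (hh : 0 < h) {M : Finset (Fin n → ℤ)}
    (hM : ∀ x ∈ Ω, ∀ m, x ∈ cube n h m → m ∈ M) (φ : 𝓓(Ω, ℝ))
    {g : Lp ℝ 1 (volume : Measure (E n))} (hg : g =ᵐ[volume] φ) :
    ∫⁻ x, ‖(g - cubeMean n hh M g : Lp ℝ 1 (volume : Measure (E n))) x‖ₑ ≤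
      ENNReal.ofReal (n ^ n * (volume (Metric.ball (0 : E n) 1)).toReal * (n * h)) *
        ∫⁻ x, ‖gradient φ x‖ₑ := by
  have hφi : Integrable φ := φ.continuous.integrable_of_hasCompactSupport φ.hasCompactSupport
  set B := Metric.closedBall (0 : E n) (n * h) with hB
  have hvol : ∀ m, volume.real (cube n h m) = h ^ n := fun m => by
    rw [Measure.real, volume_cube hh, ENNReal.toReal_ofReal (by positivity)]
  have hhn : h ^ n ≠ 0 := by positivity
  have hpt : ∀ᵐ x, ‖(g - cubeMean n hh M g : Lp ℝ 1 (volume : Measure (E n))) x‖ₑ ≤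
      ENNReal.ofReal (h ^ n)⁻¹ * ∫⁻ z in B, ‖φ (x + z) - φ x‖ₑ := by
    filter_upwards [hg, cubeMean_ae_eq hh M g, Lp.coeFn_sub g (cubeMean n hh M g)] with x h1 h2 h3
    rw [h3, Pi.sub_apply, h1, h2]
    have hgm : ∀ m, ∫ y in cube n h m, g y = ∫ y in cube n h m, φ y := fun m =>
      setIntegral_congr_ae (measurableSet_cube h m) (hg.mono fun y hy _ => hy)
    simp only [hgm]
    set m : Fin n → ℤ := fun i => ⌊x i / h⌋ with hm
    have hxm : x ∈ cube n h m := fun i => rfl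
    have hne : ∀ m' ∈ M, m' ≠ m → (h ^ n)⁻¹ * (∫ y in cube n h m', φ y) *
        (cube n h m').indicator (fun _ => (1 : ℝ)) x = 0 := by
      intro m' _ hm'
      rw [indicator_of_notMem, mul_zero]
      exact fun hx => hm' (funext fun i => (hx i).symm)
    by_cases hmM : m ∈ M
    · rw [Finset.sum_eq_single_of_mem m hmM hne, indicator_of_mem hxm, mul_one]
      have hfin : IsFiniteMeasure (volume.restrict (cube n h m)) :=
        ⟨by rw [Measure.restrict_apply_univ, volume_cube hh]; exact ENNReal.ofReal_lt_top⟩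
      have e1 : φ x - (h ^ n)⁻¹ * ∫ y in cube n h m, φ y =
          (h ^ n)⁻¹ * ∫ y in cube n h m, (φ x - φ y) := by
        rw [integral_sub (integrable_const _) hφi.integrableOn, setIntegral_const, hvol, mul_sub,
          smul_eq_mul, inv_mul_cancel_left₀ hhn]
      rw [e1, enorm_mul, ← ofReal_norm, Real.norm_of_nonneg (by positivity)]
      gcongr
      calc ‖∫ y in cube n h m, (φ x - φ y)‖ₑ
          ≤ ∫⁻ y in cube n h m, ‖φ x - φ y‖ₑ := enorm_integral_le_lintegral_enorm _
        _ ≤ ∫⁻ y, B.indicator (fun z => ‖φ (x + z) - φ x‖ₑ) (y - x) := by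
            rw [← lintegral_indicator (measurableSet_cube h m)]
            refine lintegral_mono fun y => ?_
            by_cases hy : y ∈ cube n h m
            · have hyB : y - x ∈ B := mem_closedBall_zero_iff.2 (norm_sub_le_of_mem_cube hh hxm hy)
              rw [indicator_of_mem hy, indicator_of_mem hyB, add_sub_cancel, ← enorm_neg, neg_sub]
            · rw [indicator_of_notMem hy]
              exact zero_le
        _ = ∫⁻ z, B.indicator (fun z => ‖φ (x + z) - φ x‖ₑ) z :=
            lintegral_sub_right_eq_self (B.indicator fun z => ‖φ (x + z) - φ x‖ₑ) x
        _ = ∫⁻ z in B, ‖φ (x + z) - φ x‖ₑ :=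
            lintegral_indicator Metric.isClosed_closedBall.measurableSet _
    · have hxΩ : x ∉ Ω := fun hx => hmM (hM x hx m hxm)
      rw [Finset.sum_eq_zero fun m' hm' => hne m' hm' (fun h => hmM (h ▸ hm')),
        eq_zero_of_notMem φ hxΩ, sub_zero, enorm_zero]
      exact zero_le
  have hmeas : Measurable (Function.uncurry fun x z : E n => ‖φ (x + z) - φ x‖ₑ) :=
    ((φ.continuous.comp (continuous_fst.add continuous_snd)).sub
      (φ.continuous.comp continuous_fst)).enorm.measurable
  calc ∫⁻ x, ‖(g - cubeMean n hh M g : Lp ℝ 1 (volume : Measure (E n))) x‖ₑ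
      ≤ ∫⁻ x, ENNReal.ofReal (h ^ n)⁻¹ * ∫⁻ z in B, ‖φ (x + z) - φ x‖ₑ := lintegral_mono_ae hpt
    _ = ENNReal.ofReal (h ^ n)⁻¹ * ∫⁻ z in B, ∫⁻ x, ‖φ (x + z) - φ x‖ₑ := by
        rw [lintegral_const_mul' _ _ ENNReal.ofReal_ne_top,
          lintegral_lintegral_swap hmeas.aemeasurable]
    _ ≤ ENNReal.ofReal (h ^ n)⁻¹ * ∫⁻ _ in B, ENNReal.ofReal (n * h) * ∫⁻ x, ‖gradient φ x‖ₑ := by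
        refine mul_le_mul' le_rfl ?_
        refine setLIntegral_mono measurable_const fun z hz => ?_
        refine (lintegral_enorm_translate_sub_le φ z).trans ?_
        gcongr
        rw [← ofReal_norm]
        exact ENNReal.ofReal_le_ofReal (mem_closedBall_zero_iff.1 hz)
    _ = _ := by
        have hballtop : volume (Metric.ball (0 : E n) 1) ≠ ∞ := measure_ball_lt_top.ne
        rw [setLIntegral_const, hB, Measure.addHaar_closedBall _ _ (by positivity),
          finrank_euclideanSpace, Fintype.card_fin]
        nth_rewrite 1 [← ENNReal.ofReal_toReal hballtop]
        set G := ∫⁻ x, ‖gradient φ x‖ₑ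
        rw [mul_comm (ENNReal.ofReal (n * h) * G), ← mul_assoc, ← mul_assoc,
          ← ENNReal.ofReal_mul (by positivity), ← ENNReal.ofReal_mul (by positivity),
          ← ENNReal.ofReal_mul (by positivity)]
        congr 2
        rw [mul_pow]
        field_simp

/-- Test functions are approximated in `L¹` by finite-rank operators, uniformly in terms of the
`L¹` norm of their gradients. -/
lemma exists_compact_approx (hΩ : Bornology.IsBounded (Ω : Set (E n))) {ε : ℝ} (hε : 0 < ε) :
    ∃ T : Lp ℝ 1 (volume : Measure (E n)) →L[ℝ] Lp ℝ 1 (volume : Measure (E n)),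
      IsCompactOperator T ∧ ∀ (φ : 𝓓(Ω, ℝ)) (g : Lp ℝ 1 (volume : Measure (E n))),
        g =ᵐ[volume] φ → ‖g - T g‖ ≤ ε * (∫⁻ x, ‖gradient φ x‖ₑ).toReal := by
  set c : ℝ := n ^ n * (volume (Metric.ball (0 : E n) 1)).toReal * n with hc
  have hc0 : 0 ≤ c := by positivity
  have hh : 0 < ε / (c + 1) := by positivity
  obtain ⟨M, hM⟩ := exists_finset_cover_cube hΩ hh
  refine ⟨cubeMean n hh M, isCompactOperator_cubeMean hh M, fun φ g hg => ?_⟩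
  have h1 := lintegral_enorm_sub_cubeMean_le hh hM φ hg
  rw [L1.norm_def]
  refine (ENNReal.toReal_mono (ENNReal.mul_ne_top ENNReal.ofReal_ne_top
    (lintegral_enorm_gradient_lt_top φ).ne) h1).trans ?_
  rw [ENNReal.toReal_mul, ENNReal.toReal_ofReal (by positivity)]
  gcongr
  calc (n : ℝ) ^ n * (volume (Metric.ball (0 : E n) 1)).toReal * (n * (ε / (c + 1)))
      = ε * (c / (c + 1)) := by rw [hc]; ring
    _ ≤ ε * 1 := by
        gcongr
        rw [div_le_one (by positivity)]
        linarith
    _ = ε := mul_one ε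

end Sobolev

/-! ### Fractional gradients of test functions -/

section FracGrad

variable {n : ℕ} {Ω : Opens (E n)}

lemma gradConst_nonneg {s : ℝ} (h0 : 0 < s) (h1 : s < 1) : 0 ≤ gradConst n s := by
  have h2 : 0 < Real.Gamma ((n + s + 1) / 2) := Real.Gamma_pos_of_pos (by positivity)
  have h3 : 0 < Real.Gamma ((1 - s) / 2) := Real.Gamma_pos_of_pos (by linarith)
  have := Real.pi_pos
  unfold gradConst
  positivity

lemma continuousOn_gradConst : ContinuousOn (gradConst n) (Ioo 0 1) := by
  have hG : ContinuousOn Real.Gamma (Ioi 0) := Real.differentiableOn_Gamma_Ioi.continuousOn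
  unfold gradConst
  refine ContinuousOn.div (ContinuousOn.mul (ContinuousOn.mul ?_ continuousOn_const) ?_) ?_ ?_
  · exact (Real.continuous_const_rpow (by norm_num)).continuousOn
  · refine hG.comp (by fun_prop) fun s hs => ?_
    have := hs.1
    exact mem_Ioi.2 (by positivity)
  · exact hG.comp (by fun_prop) fun s hs => mem_Ioi.2 (by linarith [hs.2])
  · exact fun s hs => (Real.Gamma_pos_of_pos (by linarith [hs.2])).ne'

/-- The normalising constant vanishes at least linearly as `s → 1`, because
`Γ((1-s)/2) = Γ((3-s)/2) / ((1-s)/2)`. -/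
lemma exists_gradConst_le (n : ℕ) :
    ∃ C : ℝ, 0 ≤ C ∧ ∀ s ∈ Ioo (0 : ℝ) 1, gradConst n s ≤ C * (1 - s) := by
  obtain ⟨t, ht, hmin⟩ := Real.exists_isMinOn_Gamma_Ioi
  have hγ : 0 < Real.Gamma t := Real.Gamma_pos_of_pos (by linarith [ht.1])
  have hcont : ContinuousOn (fun s : ℝ => Real.Gamma ((n + s + 1) / 2)) (Icc 0 1) := by
    refine Real.differentiableOn_Gamma_Ioi.continuousOn.comp (by fun_prop) fun s hs => ?_
    have := hs.1
    exact mem_Ioi.2 (by positivity)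
  obtain ⟨D, hD⟩ := isCompact_Icc.exists_bound_of_continuousOn hcont
  have hD0 : 0 ≤ D := (norm_nonneg _).trans (hD 0 ⟨le_rfl, zero_le_one⟩)
  have hpi := Real.pi_pos
  refine ⟨2 * Real.pi ^ (-(n : ℝ) / 2) * D / (2 * Real.Gamma t), by positivity, fun s hs => ?_⟩
  have hs1 : 0 < 1 - s := by linarith [hs.2]
  have h1 : Real.Gamma t ≤ (1 - s) / 2 * Real.Gamma ((1 - s) / 2) := by
    rw [← Real.Gamma_add_one (by positivity)]
    exact hmin (mem_Ioi.2 (by positivity))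
  have h2 : Real.Gamma ((n + s + 1) / 2) ≤ D := (le_abs_self _).trans (hD s ⟨hs.1.le, hs.2.le⟩)
  have h3 : (2 : ℝ) ^ s ≤ 2 := by
    calc (2 : ℝ) ^ s ≤ 2 ^ (1 : ℝ) := Real.rpow_le_rpow_of_exponent_le (by norm_num) hs.2.le
      _ = 2 := Real.rpow_one 2
  have h4 : 0 < Real.Gamma ((1 - s) / 2) := Real.Gamma_pos_of_pos (by positivity)
  have h5 : 0 < Real.Gamma ((n + s + 1) / 2) :=
    Real.Gamma_pos_of_pos (by have := hs.1; positivity)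
  unfold gradConst
  rw [div_le_iff₀ h4]
  calc (2 : ℝ) ^ s * Real.pi ^ (-(n : ℝ) / 2) * Real.Gamma ((n + s + 1) / 2)
      ≤ 2 * Real.pi ^ (-(n : ℝ) / 2) * D := by gcongr
    _ = 2 * Real.pi ^ (-(n : ℝ) / 2) * D / (2 * Real.Gamma t) * (2 * Real.Gamma t) := by
        field_simp
    _ ≤ 2 * Real.pi ^ (-(n : ℝ) / 2) * D / (2 * Real.Gamma t) *
          ((1 - s) * Real.Gamma ((1 - s) / 2)) :=
        mul_le_mul_of_nonneg_left (by linarith) (by positivity)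
    _ = _ := by ring

/-- The singularity `|z|^{1-n-s}` at the origin, in polar coordinates. -/
lemma integral_ball_rpow (hn : 0 < n) {s : ℝ} (hs : s < 1) :
    Integrable ((Metric.ball (0 : E n) 1).indicator fun z => ‖z‖ ^ (-((n : ℝ) + s - 1))) ∧
    ∫ z, (Metric.ball (0 : E n) 1).indicator (fun z => ‖z‖ ^ (-((n : ℝ) + s - 1))) z =
      n * volume.real (Metric.ball (0 : E n) 1) * (1 - s)⁻¹ := by
  have hdim : Module.finrank ℝ (E n) = n := by simp
  have : Nontrivial (E n) := Module.nontrivial_of_finrank_pos (R := ℝ) (by omega)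
  refine ⟨(integrable_indicator_iff Metric.isOpen_ball.measurableSet).2 ?_, ?_⟩
  · refine integrableOn_ball_of_norm_le_rpow (C := 1) (α := n + s - 1) (by omega)
      (by rw [hdim]; linarith) (ae_of_all _ fun z => ?_)
      (measurable_norm.pow_const _).aestronglyMeasurable
    rw [Real.norm_of_nonneg (by positivity), one_mul]
  · have h1 : ∀ z : E n, (Metric.ball (0 : E n) 1).indicator
        (fun z => ‖z‖ ^ (-((n : ℝ) + s - 1))) z =
        (Iio (1 : ℝ)).indicator (fun y => y ^ (-((n : ℝ) + s - 1))) ‖z‖ := by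
      intro z
      simp only [indicator, mem_ball_zero_iff, mem_Iio]
    simp only [h1]
    rw [integral_fun_norm_addHaar volume
      ((Iio (1 : ℝ)).indicator fun y => y ^ (-((n : ℝ) + s - 1))), hdim, nsmul_eq_mul,
      smul_eq_mul, mul_assoc]
    congr 2
    have h2 : ∀ y ∈ Ioi (0 : ℝ), y ^ (n - 1) •
        (Iio (1 : ℝ)).indicator (fun y => y ^ (-((n : ℝ) + s - 1))) y =
        (Iio (1 : ℝ)).indicator (fun y => y ^ (-s)) y := by
      intro y hy
      by_cases hy1 : y < 1
      · rw [indicator_of_mem (mem_Iio.2 hy1), indicator_of_mem (mem_Iio.2 hy1), smul_eq_mul,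
          ← Real.rpow_natCast, ← Real.rpow_add hy, Nat.cast_sub hn]
        congr 1
        push_cast
        ring
      · rw [indicator_of_notMem (by simpa using hy1), indicator_of_notMem (by simpa using hy1),
          smul_zero]
    rw [setIntegral_congr_fun measurableSet_Ioi h2, setIntegral_indicator measurableSet_Iio,
      Ioi_inter_Iio, ← integral_Ioc_eq_integral_Ioo, ← intervalIntegral.integral_of_le zero_le_one,
      integral_rpow (Or.inl (by linarith)), Real.one_rpow, Real.zero_rpow (by linarith)]
    rw [sub_zero, one_div]
    congr 1
    ring

lemma norm_gradKernel (s : ℝ) (u : E n → ℝ) (x : E n) {z : E n} (hz : z ≠ 0) :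
    ‖gradKernel s u x z‖ = |u (x + z) - u x| * ‖z‖ ^ (-((n : ℝ) + s)) := by
  have hz' : 0 < ‖z‖ := norm_pos_iff.2 hz
  unfold gradKernel
  rw [norm_smul, norm_div, Real.norm_eq_abs, Real.norm_of_nonneg (by positivity : (0 : ℝ) ≤
    ‖z‖ ^ ((n : ℝ) + s + 1)), Real.rpow_add hz', Real.rpow_one, Real.rpow_neg hz'.le]
  field_simp

/-- The fractional gradients of a test function are bounded uniformly in `x` and in the order
`s ∈ [s₀, 1]`: the singular part of the integral is `O((1-s)⁻¹)`, which the constant `c_{s,n}`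
compensates. -/
lemma exists_norm_fracGrad_le (hn : 0 < n) {s₀ : ℝ} (hs₀ : 0 < s₀) (φ : 𝓓(Ω, ℝ)) :
    ∃ C : ℝ, 0 ≤ C ∧ ∀ s ∈ Icc s₀ 1, ∀ x, ‖fracGrad s φ x‖ ≤ C := by
  have hdim : Module.finrank ℝ (E n) = n := by simp
  obtain ⟨C, hC0, hC⟩ := exists_gradConst_le n
  obtain ⟨l, hl⟩ := ContDiff.lipschitzWith_of_hasCompactSupport
    φ.hasCompactSupport φ.contDiff (by simp)
  obtain ⟨M, hM⟩ := φ.continuous.bounded_above_of_compact_support φ.hasCompactSupport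
  have hM0 : 0 ≤ M := (norm_nonneg _).trans (hM 0)
  set F : E n → ℝ := fun z => 2 * M * 2 ^ ((n : ℝ) + s₀) * (1 + ‖z‖) ^ (-((n : ℝ) + s₀)) with hF
  have hFi : Integrable F := (integrable_one_add_norm (by rw [hdim]; linarith)).const_mul _
  have hF0 : 0 ≤ ∫ z, F z := integral_nonneg fun z => by
    simp only [hF, Pi.zero_apply]; positivity
  set V : ℝ := n * volume.real (Metric.ball (0 : E n) 1) with hV
  have hV0 : 0 ≤ V := by positivity
  refine ⟨max l (C * (l * V + ∫ z, F z)), le_max_of_le_left l.2, fun s hs x => ?_⟩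
  unfold fracGrad
  split_ifs with h1
  · refine le_max_of_le_left ?_
    rw [norm_gradient]
    exact norm_fderiv_le_of_lipschitz ℝ hl
  · refine le_max_of_le_right ?_
    have hs1 : s < 1 := lt_of_le_of_ne hs.2 h1
    have hs0 : 0 < s := hs₀.trans_le hs.1
    obtain ⟨hBi, hBv⟩ := integral_ball_rpow hn hs1
    set B := (Metric.ball (0 : E n) 1).indicator fun z => ‖z‖ ^ (-((n : ℝ) + s - 1)) with hB
    have hB0 : ∀ z, 0 ≤ B z := fun z => indicator_nonneg (fun z _ => by positivity) z
    have hFz : ∀ z, 0 ≤ F z := fun z => by simp only [hF]; positivity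
    have hpt : ∀ z, ‖gradKernel s φ x z‖ ≤ l * B z + F z := by
      intro z
      by_cases hz : z = 0
      · rw [hz, gradKernel, smul_zero, norm_zero, ← hz]
        have := hB0 z
        have := hFz z
        positivity
      have hz' : 0 < ‖z‖ := norm_pos_iff.2 hz
      rw [norm_gradKernel s φ x hz]
      by_cases hz1 : ‖z‖ < 1
      · have h2 : |φ (x + z) - φ x| ≤ l * ‖z‖ := by
          have := hl.dist_le_mul (x + z) x
          simpa [Real.dist_eq, dist_eq_norm] using this
        have h3 : B z = ‖z‖ ^ (-((n : ℝ) + s - 1)) :=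
          indicator_of_mem (mem_ball_zero_iff.2 hz1) _
        rw [h3]
        refine le_add_of_le_of_nonneg ?_ (hFz z)
        calc |φ (x + z) - φ x| * ‖z‖ ^ (-((n : ℝ) + s))
            ≤ l * ‖z‖ * ‖z‖ ^ (-((n : ℝ) + s)) := by gcongr
          _ = l * ‖z‖ ^ (-((n : ℝ) + s - 1)) := by
            rw [show -((n : ℝ) + s - 1) = 1 + -((n : ℝ) + s) by ring, Real.rpow_add hz',
              Real.rpow_one]
            ring
      · have hz2 : 1 ≤ ‖z‖ := not_lt.1 hz1
        refine le_add_of_nonneg_of_le (mul_nonneg l.2 (hB0 z)) ?_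
        have h2 : |φ (x + z) - φ x| ≤ 2 * M := by
          have h := (abs_sub (φ (x + z)) (φ x)).trans (add_le_add (hM (x + z)) (hM x))
          linarith
        have h3 : ‖z‖ ^ (-((n : ℝ) + s)) ≤ ‖z‖ ^ (-((n : ℝ) + s₀)) :=
          Real.rpow_le_rpow_of_exponent_le hz2 (by linarith [hs.1])
        have h4 : ‖z‖ ^ (-((n : ℝ) + s₀)) ≤
            2 ^ ((n : ℝ) + s₀) * (1 + ‖z‖) ^ (-((n : ℝ) + s₀)) := by
          rw [Real.rpow_neg hz'.le, Real.rpow_neg (by positivity), ← div_eq_mul_inv,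
            ← Real.div_rpow (by positivity) (by positivity), inv_eq_one_div,
            div_le_iff₀ (by positivity), ← Real.mul_rpow (by positivity) (by positivity)]
          refine Real.one_le_rpow ?_ (by positivity)
          rw [div_mul_eq_mul_div, le_div_iff₀ (by positivity)]
          linarith
        calc |φ (x + z) - φ x| * ‖z‖ ^ (-((n : ℝ) + s))
            ≤ 2 * M * (2 ^ ((n : ℝ) + s₀) * (1 + ‖z‖) ^ (-((n : ℝ) + s₀))) := by
              gcongr
              exact h3.trans h4
          _ = F z := by simp only [hF]; ring
    have hint := norm_integral_le_of_norm_le ((hBi.const_mul (l : ℝ)).add hFi) (ae_of_all _ hpt)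
    have hval : ∫ z, ((fun z => (l : ℝ) * B z) + F) z = l * (V * (1 - s)⁻¹) + ∫ z, F z := by
      rw [integral_add' (hBi.const_mul (l : ℝ)) hFi, integral_const_mul, hBv]
    rw [hval] at hint
    have h1s : 0 < 1 - s := by linarith
    rw [norm_smul, Real.norm_of_nonneg (gradConst_nonneg hs0 hs1)]
    calc gradConst n s * ‖∫ z, gradKernel s φ x z‖
        ≤ C * (1 - s) * (l * (V * (1 - s)⁻¹) + ∫ z, F z) := by
          gcongr
          exact hC s ⟨hs0, hs1⟩
      _ = C * (l * V + (1 - s) * ∫ z, F z) := by field_simp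
      _ ≤ C * (l * V + 1 * ∫ z, F z) := by
          gcongr
          linarith
      _ = C * (l * V + ∫ z, F z) := by rw [one_mul]

/-- The fractional gradients of a test function decay at least like `|x|⁻ⁿ`, uniformly in the
order `s ∈ [s₀, 1]`. -/
lemma exists_norm_fracGrad_le_decay (hn : 0 < n) {s₀ : ℝ} (hs₀ : 0 < s₀) (φ : 𝓓(Ω, ℝ)) :
    ∃ C : ℝ, 0 ≤ C ∧ ∀ s ∈ Icc s₀ 1, ∀ x, ‖fracGrad s φ x‖ ≤ C * (1 + ‖x‖) ^ (-(n : ℝ)) := by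
  obtain ⟨C₁, hC₁0, hC₁⟩ := exists_norm_fracGrad_le hn hs₀ φ
  obtain ⟨C, hC0, hC⟩ := exists_gradConst_le n
  have hφi : Integrable φ := φ.continuous.integrable_of_hasCompactSupport φ.hasCompactSupport
  obtain ⟨r', hr'⟩ := φ.hasCompactSupport.isCompact.isBounded.subset_ball (0 : E n)
  set r := max r' 1 with hr
  have hr1 : 1 ≤ r := le_max_right _ _
  have hsupp : ∀ x : E n, r ≤ ‖x‖ → φ x = 0 := fun x hx =>
    image_eq_zero_of_notMem_tsupport fun h =>
      absurd (mem_ball_zero_iff.1 (hr' h)) (not_lt.2 ((le_max_left _ _).trans hx))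
  set I := ∫ x, |φ x| with hI
  have hI0 : 0 ≤ I := integral_nonneg fun x => abs_nonneg _
  refine ⟨max (C₁ * (1 + 2 * r) ^ (n : ℝ)) (C * (I * 4 ^ (n : ℝ))), by positivity,
    fun s hs x => ?_⟩
  by_cases hx : ‖x‖ ≤ 2 * r
  · refine le_trans ?_ (mul_le_mul_of_nonneg_right (le_max_left _ _) (by positivity))
    refine (hC₁ s hs x).trans ?_
    rw [mul_assoc]
    refine le_mul_of_one_le_right hC₁0 ?_
    rw [Real.rpow_neg (by positivity), ← div_eq_mul_inv,
      ← Real.div_rpow (by positivity) (by positivity)]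
    refine Real.one_le_rpow ?_ (by positivity)
    rw [le_div_iff₀ (by positivity)]
    linarith
  · have hx' : 2 * r < ‖x‖ := not_le.1 hx
    refine le_trans ?_ (mul_le_mul_of_nonneg_right (le_max_right _ _) (by positivity))
    unfold fracGrad
    split_ifs with h1
    · have : fderiv ℝ φ x = 0 := by
        refine image_eq_zero_of_notMem_tsupport fun h => ?_
        have := mem_ball_zero_iff.1 (hr' (tsupport_fderiv_subset ℝ h))
        have := le_max_left r' 1
        linarith
      rw [norm_gradient, this, norm_zero]
      positivity
    · have hs1 : s < 1 := lt_of_le_of_ne hs.2 h1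
      have hs0 : 0 < s := hs₀.trans_le hs.1
      have hpt : ∀ z, ‖gradKernel s φ x z‖ ≤ |φ (x + z)| * (‖x‖ / 2) ^ (-(n : ℝ)) := by
        intro z
        by_cases hz : z = 0
        · rw [hz, gradKernel, smul_zero, norm_zero]
          positivity
        rw [norm_gradKernel s φ x hz, hsupp x (by linarith), sub_zero]
        by_cases hxz : r ≤ ‖x + z‖
        · rw [hsupp _ hxz, abs_zero, zero_mul, zero_mul]
        · have h2 : ‖x‖ / 2 ≤ ‖z‖ := by
            have h3 : ‖x‖ ≤ ‖x + z‖ + ‖z‖ := by simpa using norm_sub_le (x + z) z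
            linarith [not_le.1 hxz]
          refine mul_le_mul_of_nonneg_left ?_ (abs_nonneg _)
          calc ‖z‖ ^ (-((n : ℝ) + s)) ≤ (‖x‖ / 2) ^ (-((n : ℝ) + s)) :=
                Real.rpow_le_rpow_of_nonpos (by linarith) h2 (by
                  have : (0 : ℝ) ≤ n := by positivity
                  linarith)
            _ ≤ (‖x‖ / 2) ^ (-(n : ℝ)) :=
                Real.rpow_le_rpow_of_exponent_le (by linarith) (by linarith)
      have hint := norm_integral_le_of_norm_le
        ((hφi.abs.comp_add_left x).mul_const ((‖x‖ / 2) ^ (-(n : ℝ)))) (ae_of_all _ hpt)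
      have hval : ∫ z, |φ (x + z)| = I := integral_add_left_eq_self (fun z => |φ z|) x
      have h4 : (‖x‖ / 2) ^ (-(n : ℝ)) ≤ 4 ^ (n : ℝ) * (1 + ‖x‖) ^ (-(n : ℝ)) := by
        have hx0 : 0 < ‖x‖ := by linarith
        rw [Real.rpow_neg (by positivity), Real.rpow_neg (by positivity), ← div_eq_mul_inv,
          ← Real.div_rpow (by positivity) (by positivity), ← Real.inv_rpow (by positivity)]
        refine Real.rpow_le_rpow (by positivity) ?_ (by positivity)
        rw [inv_div, div_le_div_iff₀ (by positivity) (by positivity)]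
        linarith
      rw [norm_smul, Real.norm_of_nonneg (gradConst_nonneg hs0 hs1)]
      have h5 : gradConst n s ≤ C := (hC s ⟨hs0, hs1⟩).trans
        (mul_le_of_le_one_right hC0 (by linarith))
      have h6 : ‖∫ z, gradKernel s φ x z‖ ≤ I * (4 ^ (n : ℝ) * (1 + ‖x‖) ^ (-(n : ℝ))) := by
        refine hint.trans ?_
        rw [integral_mul_const, hval]
        gcongr
      calc gradConst n s * ‖∫ z, gradKernel s φ x z‖
          ≤ C * (I * (4 ^ (n : ℝ) * (1 + ‖x‖) ^ (-(n : ℝ)))) := by gcongr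
        _ = C * (I * 4 ^ (n : ℝ)) * (1 + ‖x‖) ^ (-(n : ℝ)) := by ring

/-- The field `(s, x) ↦ D^s φ(x)` of a test function is jointly measurable. -/
lemma aestronglyMeasurable_fracGrad (μ : Measure ℝ) [IsFiniteMeasure μ] (φ : 𝓓(Ω, ℝ)) :
    AEStronglyMeasurable (fun p : ℝ × E n => fracGrad p.1 φ p.2) (mixedMeasure n μ) := by
  classical
  have hc : Measurable ((Ioo (0 : ℝ) 1).piecewise (gradConst n) 0) :=
    continuousOn_gradConst.measurable_piecewise continuousOn_const measurableSet_Ioo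
  have hk : StronglyMeasurable fun q : (ℝ × E n) × E n => gradKernel q.1.1 φ q.1.2 q.2 := by
    unfold gradKernel
    have h1 : Measurable fun q : (ℝ × E n) × E n => φ (q.1.2 + q.2) :=
      φ.continuous.measurable.comp (by fun_prop)
    have h2 : Measurable fun q : (ℝ × E n) × E n => φ q.1.2 :=
      φ.continuous.measurable.comp (by fun_prop)
    have h3 : Measurable fun q : (ℝ × E n) × E n => ‖q.2‖ ^ ((n : ℝ) + q.1.1 + 1) := by fun_prop
    exact (((h1.sub h2).div h3).smul measurable_snd).stronglyMeasurable
  have hI := hk.integral_prod_right' (ν := (volume : Measure (E n)))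
  have hm : Measurable fun p : ℝ × E n => if p.1 = 1 then gradient φ p.2 else
      (Ioo (0 : ℝ) 1).piecewise (gradConst n) 0 p.1 • ∫ z, gradKernel p.1 φ p.2 z := by
    refine Measurable.ite (measurableSet_preimage measurable_fst (measurableSet_singleton 1)) ?_ ?_
    · exact (continuous_gradient φ).measurable.comp measurable_snd
    · exact (hc.comp measurable_fst).smul hI.measurable
  refine ⟨_, hm.stronglyMeasurable, (ae_mem_Ioc n μ).mono fun p hp => ?_⟩
  unfold fracGrad
  beta_reduce
  split_ifs with h1
  · rfl
  · have hp1 : p.1 ∈ Ioo (0 : ℝ) 1 := ⟨hp.1, lt_of_le_of_ne hp.2 h1⟩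
    rw [piecewise_eq_of_mem _ _ _ hp1]

/-- Test functions have finite energy: `Λ` is integrable near the origin and grows at most like
`|x|^p` with `p < n`, while `|D^s φ|²` decays like `|x|^{-2n}`. -/
lemma energy_fracGrad_lt_top (hn : 0 < n) {μ : Measure ℝ} [IsFiniteMeasure μ] {s₀ : ℝ}
    (hs₀ : 0 < s₀) (hμ : μ (Icc s₀ 1)ᶜ = 0) (A : CoeffMatrix n μ) {Lam : E n → ℝ}
    (hLam0 : ∀ x, 0 ≤ Lam x)
    (hell : ∀ s ∈ Ioc (0 : ℝ) 1, ∀ x ξ, matForm (A.mat s x) ξ ξ ≤ Lam x * ‖ξ‖ ^ 2)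
    {R C p : ℝ} (hR : 0 < R) (hC : 0 < C) (hp : p < n) (hLi : IntegrableOn Lam (Metric.ball 0 R))
    (hLd : ∀ x, x ∉ Metric.ball (0 : E n) R → Lam x ≤ C * ‖x‖ ^ p) (φ : 𝓓(Ω, ℝ)) :
    energy A (fun q => fracGrad q.1 φ q.2) < ∞ := by
  have hdim : Module.finrank ℝ (E n) = n := by simp
  obtain ⟨D, hD0, hD⟩ := exists_norm_fracGrad_le_decay hn hs₀ φ
  have hn' : (0 : ℝ) < n := by exact_mod_cast hn
  set p' := max p 0 with hp'
  have hp'n : p' < n := max_lt hp hn'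
  set k := max 1 (R ^ p) with hk
  have hk0 : 0 ≤ k := le_max_of_le_left zero_le_one
  have hgrow : ∀ x : E n, R ≤ ‖x‖ → ‖x‖ ^ p ≤ k * (1 + ‖x‖) ^ p' := by
    intro x hx
    have hx0 : 0 < ‖x‖ := hR.trans_le hx
    rcases le_total 0 p with h | h
    · rw [hp', max_eq_left h]
      calc ‖x‖ ^ p ≤ 1 * (1 + ‖x‖) ^ p := by
            rw [one_mul]
            exact Real.rpow_le_rpow hx0.le (by linarith) h
        _ ≤ k * (1 + ‖x‖) ^ p := by gcongr; exact le_max_left _ _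
    · rw [hp', max_eq_right h, Real.rpow_zero, mul_one]
      exact (Real.rpow_le_rpow_of_nonpos hR hx h).trans (le_max_right _ _)
  set G : E n → ℝ := fun x => (Metric.ball (0 : E n) R).indicator (fun x => D ^ 2 * Lam x) x +
    C * k * D ^ 2 * (1 + ‖x‖) ^ (-(2 * (n : ℝ) - p')) with hG
  have hGi : Integrable G := by
    refine Integrable.add ?_ ?_
    · exact (integrable_indicator_iff Metric.isOpen_ball.measurableSet).2 (hLi.const_mul _)
    · exact (integrable_one_add_norm (by rw [hdim]; linarith)).const_mul _
  have hpt : ∀ s ∈ Icc s₀ 1, ∀ x,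
      matForm (A.mat s x) (fracGrad s φ x) (fracGrad s φ x) ≤ G x := by
    intro s hs x
    refine (hell s ⟨hs₀.trans_le hs.1, hs.2⟩ x _).trans ?_
    have h1 : ‖fracGrad s φ x‖ ^ 2 ≤ (D * (1 + ‖x‖) ^ (-(n : ℝ))) ^ 2 :=
      pow_le_pow_left₀ (norm_nonneg _) (hD s hs x) 2
    by_cases hx : x ∈ Metric.ball (0 : E n) R
    · simp only [hG, indicator_of_mem hx]
      refine le_add_of_le_of_nonneg ?_ (by positivity)
      rw [mul_comm]
      refine mul_le_mul_of_nonneg_right (h1.trans ?_) (hLam0 x)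
      refine pow_le_pow_left₀ (by positivity) (mul_le_of_le_one_right hD0 ?_) 2
      exact Real.rpow_le_one_of_one_le_of_nonpos (by linarith [norm_nonneg x]) (by linarith)
    · simp only [hG, indicator_of_notMem hx, zero_add]
      have hxR : R ≤ ‖x‖ := by simpa using hx
      have h2 : Lam x ≤ C * (k * (1 + ‖x‖) ^ p') :=
        (hLd x hx).trans (mul_le_mul_of_nonneg_left (hgrow x hxR) hC.le)
      calc Lam x * ‖fracGrad s φ x‖ ^ 2
          ≤ C * (k * (1 + ‖x‖) ^ p') * (D * (1 + ‖x‖) ^ (-(n : ℝ))) ^ 2 := by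
            gcongr
        _ = C * k * D ^ 2 * (1 + ‖x‖) ^ (-(2 * (n : ℝ) - p')) := by
            rw [show -(2 * (n : ℝ) - p') = p' + (-(n : ℝ) + -(n : ℝ)) by ring,
              Real.rpow_add (by positivity), Real.rpow_add (by positivity)]
            ring
  have hae : ∀ᵐ q ∂(mixedMeasure n μ), q.1 ∈ Icc s₀ 1 :=
    Measure.quasiMeasurePreserving_fst.ae (ae_restrict_of_ae (mem_ae_iff.2 hμ))
  refine lt_of_le_of_lt (lintegral_mono_ae (hae.mono fun q hq =>
    ENNReal.ofReal_le_ofReal (hpt q.1 hq q.2))) ?_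
  have hGs : Integrable (fun q : ℝ × E n => G q.2) (mixedMeasure n μ) := hGi.comp_snd _
  refine lt_of_le_of_lt (lintegral_mono fun q => ?_) hGs.2
  rw [← ofReal_norm]
  exact ENNReal.ofReal_le_ofReal (le_abs_self _)

end FracGrad

/-! ### The embedding of `H⁰(A, Ω)` into `L¹` -/

section EnergySpace

variable {n : ℕ} {μ : Measure ℝ} {A : CoeffMatrix n μ} {Ω : Opens (E n)}

lemma integrable_matForm_self (A : CoeffMatrix n μ) {F : ℝ × E n → E n}
    (hF : AEMeasurable F (mixedMeasure n μ)) (hF' : energy A F < ∞) :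
    Integrable (fun p => matForm (A.mat p.1 p.2) (F p) (F p)) (mixedMeasure n μ) := by
  simpa only [matForm_symPart_self] using integrable_matForm_symPart A hF hF hF' hF'

lemma energy_aeeqFun_sub (A : CoeffMatrix n μ) (F G : (ℝ × E n) →ₘ[mixedMeasure n μ] E n) :
    energy A (F - G : (ℝ × E n) →ₘ[mixedMeasure n μ] E n) = energy A (⇑F - ⇑G) :=
  energy_congr A (AEEqFun.coeFn_sub F G)

lemma energy_neg (A : CoeffMatrix n μ) (F : ℝ × E n → E n) : energy A (-F) = energy A F := by
  have h := energy_smul A (-1) F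
  rwa [neg_one_smul, neg_one_sq, ENNReal.ofReal_one, one_mul] at h

namespace H0

/-- The element of `L¹(ℝⁿ)` underlying an element of `H⁰(A, Ω)`. -/
def fn (u : H0 A Ω) : Lp ℝ 1 (volume : Measure (E n)) := (u : energySubmodule A Ω).1.1

lemma coeFn_fn (u : H0 A Ω) : ⇑u.fn = u.val := rfl

/-- The field of an element of `H⁰(A, Ω)` as a class of measurable fields. -/
def field (u : H0 A Ω) : (ℝ × E n) →ₘ[mixedMeasure n μ] E n := (u : energySubmodule A Ω).1.2

lemma coeFn_field (u : H0 A Ω) : ⇑u.field = u.grad := rfl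

lemma ext {u v : H0 A Ω} (h₁ : u.fn = v.fn) (h₂ : u.field = v.field) : u = v :=
  Subtype.ext (Prod.ext h₁ h₂)

lemma aemeasurable_grad (u : H0 A Ω) : AEMeasurable u.grad (mixedMeasure n μ) :=
  u.field.aemeasurable

lemma energy_grad_lt_top (u : H0 A Ω) : energy A u.grad < ∞ := (u : energySubmodule A Ω).2.1

lemma grad_add (u v : H0 A Ω) : (u + v).grad =ᵐ[mixedMeasure n μ] u.grad + v.grad :=
  AEEqFun.coeFn_add u.field v.field

lemma grad_smul (c : ℝ) (u : H0 A Ω) : (c • u).grad =ᵐ[mixedMeasure n μ] c • u.grad :=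
  AEEqFun.coeFn_smul c u.field

lemma val_add (u v : H0 A Ω) : (u + v).val =ᵐ[volume] u.val + v.val :=
  Lp.coeFn_add u.fn v.fn

lemma val_smul (c : ℝ) (u : H0 A Ω) : (c • u).val =ᵐ[volume] c • u.val :=
  Lp.coeFn_smul c u.fn

lemma norm_sq_eq (u : H0 A Ω) :
    ‖u‖ ^ 2 = ∫ p, matForm (A.mat p.1 p.2) (u.grad p) (u.grad p) ∂(mixedMeasure n μ) := by
  rw [← real_inner_self_eq_norm_sq u]
  refine integral_congr_ae (ae_of_all _ fun p => ?_)
  exact matForm_symPart_self _ _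

lemma energy_grad (u : H0 A Ω) : energy A u.grad = ENNReal.ofReal (‖u‖ ^ 2) := by
  rw [norm_sq_eq, ofReal_integral_eq_lintegral_ofReal
    (integrable_matForm_self A u.aemeasurable_grad u.energy_grad_lt_top)
    ((ae_mem_Ioc n μ).mono fun p hp => matForm_self_nonneg A hp _ _)]
  rfl

lemma energy_field_sub (u v : H0 A Ω) :
    energy A (u.field - v.field : (ℝ × E n) →ₘ[mixedMeasure n μ] E n) =
      ENNReal.ofReal (‖u - v‖ ^ 2) :=
  energy_grad (u - v)

lemma tendsto_of_tendsto_energy {u : ℕ → H0 A Ω} {v : H0 A Ω}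
    (h : Tendsto (fun k => energy A ((u k).field - v.field : (ℝ × E n) →ₘ[mixedMeasure n μ] E n))
      atTop (𝓝 0)) : Tendsto u atTop (𝓝 v) := by
  simp only [energy_field_sub] at h
  rw [tendsto_iff_norm_sub_tendsto_zero]
  have h1 := (ENNReal.tendsto_toReal ENNReal.zero_ne_top).comp h
  have h2 : Tendsto (fun k => ‖u k - v‖ ^ 2) atTop (𝓝 0) := by
    refine (tendsto_congr fun k => ?_).1 h1
    exact ENNReal.toReal_ofReal (by positivity)
  have h3 := (Real.continuous_sqrt.tendsto 0).comp h2
  rw [Real.sqrt_zero] at h3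
  refine (tendsto_congr fun k => ?_).1 h3
  exact Real.sqrt_sq (norm_nonneg _)

/-- Every test function with finite energy is an element of `H⁰(A, Ω)`. -/
lemma exists_isTest [IsFiniteMeasure μ] (φ : 𝓓(Ω, ℝ))
    (hφ : energy A (fun q => fracGrad q.1 φ q.2) < ∞) : ∃ u : H0 A Ω, u.IsTest φ := by
  have hi : Integrable φ := φ.continuous.integrable_of_hasCompactSupport φ.hasCompactSupport
  have hm := aestronglyMeasurable_fracGrad μ φ
  let q : FieldPair n μ := (hi.toL1 φ, AEEqFun.mk _ hm)
  have hq : IsGradPair φ q := ⟨hi.coeFn_toL1, AEEqFun.coeFn_mk _ hm⟩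
  refine ⟨⟨q, ?_, fun _ => φ, fun _ => q, fun _ => hq, tendsto_const_nhds, ?_⟩, hq⟩
  · rw [energy_congr A hq.2]
    exact hφ
  · simp only [sub_self, energy_congr A AEEqFun.coeFn_zero]
    simp [energy, matForm]

/-- Test functions are dense, with simultaneous convergence in `L¹`. -/
lemma exists_tendsto_isTest (hT : ∀ φ : 𝓓(Ω, ℝ), ∃ u : H0 A Ω, u.IsTest φ) (u : H0 A Ω) :
    ∃ (φ : ℕ → 𝓓(Ω, ℝ)) (w : ℕ → H0 A Ω), (∀ k, (w k).IsTest (φ k)) ∧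
      Tendsto w atTop (𝓝 u) ∧ Tendsto (fun k => (w k).fn) atTop (𝓝 u.fn) := by
  obtain ⟨-, φ, q, hq, h1, h2⟩ := (u : energySubmodule A Ω).2
  choose w hw using fun k => hT (φ k)
  have hwq : ∀ k, (w k : energySubmodule A Ω).1 = q k := by
    intro k
    refine Prod.ext (Lp.ext ?_) (AEEqFun.ext ?_)
    · exact (hw k).1.trans (hq k).1.symm
    · exact (hw k).2.trans (hq k).2.symm
  refine ⟨φ, w, hw, tendsto_of_tendsto_energy ?_, ?_⟩
  · refine (tendsto_congr fun k => ?_).2 h2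
    rw [← hwq k]
    rfl
  · refine (tendsto_congr fun k => ?_).2 h1
    rw [← hwq k]
    rfl

/-- The map `u ↦ u` from `H⁰(A, Ω)` to `L¹`. -/
def fnLinear (A : CoeffMatrix n μ) (Ω : Opens (E n)) :
    H0 A Ω →ₗ[ℝ] Lp ℝ 1 (volume : Measure (E n)) :=
  LinearMap.fst ℝ _ _ ∘ₗ (energySubmodule A Ω).subtype

/-- An inequality `∫ |T φ| ≤ C ‖φ‖` on test functions extends to `H⁰(A, Ω)`. -/
lemma norm_fn_le_of_isTest (hT : ∀ φ : 𝓓(Ω, ℝ), ∃ u : H0 A Ω, u.IsTest φ) {C : ℝ}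
    (T : Lp ℝ 1 (volume : Measure (E n)) →L[ℝ] Lp ℝ 1 (volume : Measure (E n)))
    (hC : ∀ (φ : 𝓓(Ω, ℝ)) (w : H0 A Ω), w.IsTest φ → ‖T w.fn‖ ≤ C * ‖w‖) (u : H0 A Ω) :
    ‖T u.fn‖ ≤ C * ‖u‖ := by
  obtain ⟨φ, w, hw, h1, h2⟩ := exists_tendsto_isTest hT u
  exact le_of_tendsto_of_tendsto ((T.continuous.tendsto _).comp h2).norm
    (h1.norm.const_mul C) (Eventually.of_forall fun k => hC (φ k) (w k) (hw k))

/-- The `L¹` norm of the gradient of a test function is controlled by its energy: the measure `μ`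
charges the order `s = 1`, and the weight is compensated by Hölder's inequality with
`λ⁻¹ ∈ L¹(Ω)`. -/
lemma exists_lintegral_gradient_le [IsFiniteMeasure μ] (hμ1 : 0 < μ {1}) {lam : E n → ℝ}
    (hell : ∀ s ∈ Ioc (0 : ℝ) 1, ∀ x ξ, lam x * ‖ξ‖ ^ 2 ≤ matForm (A.mat s x) ξ ξ)
    (hlam_pos : ∀ᵐ x ∂(volume.restrict (Ω : Set (E n))), 0 < lam x)
    (hlam : IntegrableOn (fun x => (lam x)⁻¹) (Ω : Set (E n))) :
    ∃ C : ℝ, 0 ≤ C ∧ ∀ (φ : 𝓓(Ω, ℝ)) (w : H0 A Ω), w.IsTest φ →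
      (∫⁻ x, ‖gradient φ x‖ₑ).toReal ≤ C * ‖w‖ := by
  have hlm : AEMeasurable lam (volume.restrict (Ω : Set (E n))) :=
    hlam.aestronglyMeasurable.aemeasurable.inv.congr (ae_of_all _ fun x => inv_inv _)
  set I : ℝ≥0∞ := ∫⁻ x in (Ω : Set (E n)), ENNReal.ofReal (lam x)⁻¹ with hI
  have hItop : I < ∞ := by
    refine lt_of_le_of_lt (lintegral_mono fun x => ?_) hlam.2
    rw [← ofReal_norm]
    exact ENNReal.ofReal_le_ofReal (le_abs_self _)
  refine ⟨Real.sqrt I.toReal * Real.sqrt ((μ {1}).toReal)⁻¹, by positivity, fun φ w hw => ?_⟩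
  set Z : ℝ≥0∞ := ∫⁻ x in (Ω : Set (E n)), ENNReal.ofReal (lam x * ‖gradient φ x‖ ^ 2) with hZ
  have hgm : AEMeasurable (gradient φ) (volume.restrict (Ω : Set (E n))) :=
    (continuous_gradient φ).measurable.aemeasurable
  -- the part of the energy at order one
  have hZle : Z * μ {1} ≤ ENNReal.ofReal (‖w‖ ^ 2) := by
    rw [← w.energy_grad, energy, lintegral_prod _
      (aemeasurable_matForm A w.aemeasurable_grad w.aemeasurable_grad).ennreal_ofReal]
    have hae : ∀ᵐ s ∂(μ.restrict (Ioc 0 1)), ∀ᵐ x, w.grad (s, x) = fracGrad s φ x :=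
      Measure.ae_ae_of_ae_prod hw.2
    have h1 : ∫⁻ s in Ioc 0 1, ∫⁻ x, ENNReal.ofReal (matForm (A.mat (s, x).1 (s, x).2)
        (w.grad (s, x)) (w.grad (s, x))) ∂volume ∂μ =
        ∫⁻ s in Ioc 0 1, ∫⁻ x, ENNReal.ofReal (matForm (A.mat s x)
        (fracGrad s φ x) (fracGrad s φ x)) ∂volume ∂μ := by
      refine lintegral_congr_ae (hae.mono fun s hs => ?_)
      refine lintegral_congr_ae (hs.mono fun x hx => ?_)
      simp only [hx]
    rw [h1]
    have h2 : (μ.restrict (Ioc 0 1)) {1} = μ {1} := by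
      rw [Measure.restrict_apply (measurableSet_singleton _), inter_eq_left.2]
      rintro _ rfl
      exact ⟨zero_lt_one, le_rfl⟩
    refine le_trans ?_ (setLIntegral_le_lintegral {1} _)
    rw [lintegral_singleton, h2]
    gcongr
    refine (setLIntegral_le_lintegral _ _).trans (lintegral_mono fun x => ?_)
    refine ENNReal.ofReal_le_ofReal ?_
    rw [fracGrad, if_pos rfl]
    exact hell 1 ⟨zero_lt_one, le_rfl⟩ x _
  have hHol : ∫⁻ x, ‖gradient φ x‖ₑ ≤ I ^ (1 / 2 : ℝ) * Z ^ (1 / 2 : ℝ) := by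
    have h0 : ∫⁻ x, ‖gradient φ x‖ₑ = ∫⁻ x in (Ω : Set (E n)), ‖gradient φ x‖ₑ := by
      refine (setLIntegral_eq_of_support_subset fun x hx => ?_).symm
      by_contra hxΩ
      exact hx (by beta_reduce; rw [gradient_eq_zero_of_notMem φ hxΩ, enorm_zero])
    have h1 : ∫⁻ x in (Ω : Set (E n)), ‖gradient φ x‖ₑ = ∫⁻ x in (Ω : Set (E n)),
        ((fun x => ENNReal.ofReal (Real.sqrt (lam x)⁻¹)) *
          fun x => ENNReal.ofReal (Real.sqrt (lam x * ‖gradient φ x‖ ^ 2))) x := by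
      refine lintegral_congr_ae (hlam_pos.mono fun x hx => ?_)
      simp only [Pi.mul_apply]
      rw [← ENNReal.ofReal_mul (by positivity), ← Real.sqrt_mul (by positivity), ← mul_assoc,
        inv_mul_cancel₀ hx.ne', one_mul, Real.sqrt_sq (norm_nonneg _), ofReal_norm]
    rw [h0, h1]
    refine (ENNReal.lintegral_mul_le_Lp_mul_Lq _ Real.HolderConjugate.two_two ?_ ?_).trans_eq ?_
    · exact (Real.continuous_sqrt.measurable.comp_aemeasurable hlm.inv).ennreal_ofReal
    · exact (Real.continuous_sqrt.measurable.comp_aemeasurable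
        (hlm.mul (hgm.norm.pow_const 2))).ennreal_ofReal
    · have hsq : ∀ t : ℝ, 0 ≤ t → ENNReal.ofReal (Real.sqrt t) ^ (2 : ℝ) = ENNReal.ofReal t :=
        fun t ht => by
          rw [ENNReal.ofReal_rpow_of_nonneg (Real.sqrt_nonneg _) (by norm_num), Real.rpow_two,
            Real.sq_sqrt ht]
      congr 2
      · exact lintegral_congr_ae (hlam_pos.mono fun x hx => hsq _ (by positivity))
      · exact lintegral_congr_ae (hlam_pos.mono fun x hx => hsq _ (by positivity))
  have hμtop : μ {1} ≠ ∞ := measure_ne_top μ _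
  have hm0 : 0 < (μ {1}).toReal := ENNReal.toReal_pos hμ1.ne' hμtop
  have hZtop : Z ≠ ∞ := by
    intro h
    rw [h, ENNReal.top_mul hμ1.ne'] at hZle
    exact absurd hZle (not_le.2 ENNReal.ofReal_lt_top)
  have hZr : Z.toReal ≤ ((μ {1}).toReal)⁻¹ * ‖w‖ ^ 2 := by
    have h := ENNReal.toReal_mono ENNReal.ofReal_ne_top hZle
    rw [ENNReal.toReal_mul, ENNReal.toReal_ofReal (by positivity)] at h
    rw [inv_mul_eq_div, le_div_iff₀ hm0]
    exact h
  have h := ENNReal.toReal_mono (ENNReal.mul_ne_top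
    (ENNReal.rpow_ne_top_of_nonneg (by norm_num) hItop.ne)
    (ENNReal.rpow_ne_top_of_nonneg (by norm_num) hZtop)) hHol
  rw [ENNReal.toReal_mul, ← ENNReal.toReal_rpow, ← ENNReal.toReal_rpow, ← Real.sqrt_eq_rpow,
    ← Real.sqrt_eq_rpow] at h
  refine h.trans ?_
  rw [mul_assoc]
  gcongr
  refine (Real.sqrt_le_sqrt hZr).trans_eq ?_
  rw [Real.sqrt_mul (by positivity), Real.sqrt_sq (norm_nonneg _)]

/-- Elements of `H⁰(A, Ω)` vanish outside `Ω`. -/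
lemma val_eq_zero_ae_compl (hT : ∀ φ : 𝓓(Ω, ℝ), ∃ u : H0 A Ω, u.IsTest φ) (u : H0 A Ω) :
    ∀ᵐ x, x ∉ Ω → u.val x = 0 := by
  obtain ⟨φ, w, hw, -, h2⟩ := exists_tendsto_isTest hT u
  let R := LpToLpRestrictCLM (E n) ℝ ℝ volume 1 ((Ω : Set (E n))ᶜ)
  have hmeas : MeasurableSet ((Ω : Set (E n))ᶜ) := Ω.isOpen.measurableSet.compl
  have hw0 : ∀ k, R (w k).fn = 0 := by
    intro k
    refine Lp.ext ?_
    filter_upwards [LpToLpRestrictCLM_coeFn ℝ ((Ω : Set (E n))ᶜ) (w k).fn,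
      Lp.coeFn_zero ℝ 1 (volume.restrict ((Ω : Set (E n))ᶜ)), ae_restrict_of_ae (hw k).1,
      ae_restrict_mem hmeas] with x h1 h2 h3 h4
    rw [h1, h2]
    exact h3.trans (eq_zero_of_notMem (φ k) h4)
  have hu0 : R u.fn = 0 := by
    have h3 := (R.continuous.tendsto _).comp h2
    refine tendsto_nhds_unique h3 ((tendsto_congr fun k => ?_).2 tendsto_const_nhds)
    exact hw0 k
  have h4 : ∀ᵐ x ∂(volume.restrict ((Ω : Set (E n))ᶜ)), u.val x = 0 := by
    filter_upwards [LpToLpRestrictCLM_coeFn ℝ ((Ω : Set (E n))ᶜ) u.fn,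
      Lp.coeFn_zero ℝ 1 (volume.restrict ((Ω : Set (E n))ᶜ))] with x h1 h2
    rw [← coeFn_fn, ← h1]
    change R u.fn x = 0
    rw [hu0, h2, Pi.zero_apply]
  exact (ae_restrict_iff' hmeas).1 h4

/-- The embedding of `H⁰(A, Ω)` into `L¹` is compact if the energy controls the `L¹` norm of
gradients: it is a norm limit of its compositions with averages over small cubes. -/
lemma isCompactOperator_of_gradient_le (hΩ : Bornology.IsBounded (Ω : Set (E n)))
    (hT : ∀ φ : 𝓓(Ω, ℝ), ∃ u : H0 A Ω, u.IsTest φ) {C : ℝ} (hC0 : 0 ≤ C)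
    (hC : ∀ (φ : 𝓓(Ω, ℝ)) (w : H0 A Ω), w.IsTest φ →
      (∫⁻ x, ‖gradient φ x‖ₑ).toReal ≤ C * ‖w‖)
    (ι : H0 A Ω →L[ℝ] Lp ℝ 1 (volume : Measure (E n))) (hι : ∀ u, ι u = u.fn) :
    IsCompactOperator ι := by
  choose T hTc hTa using fun k : ℕ => exists_compact_approx hΩ (ε := 1 / ((k : ℝ) + 1))
    Nat.one_div_pos_of_nat
  refine isCompactOperator_of_tendsto (F := fun k => T k ∘L ι) (l := atTop) ?_
    (Eventually.of_forall fun k => (hTc k).comp_clm ι)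
  rw [tendsto_iff_norm_sub_tendsto_zero]
  have hlim : Tendsto (fun k : ℕ => C * (1 / ((k : ℝ) + 1))) atTop (𝓝 0) := by
    simpa using tendsto_one_div_add_atTop_nhds_zero_nat.const_mul C
  refine squeeze_zero (fun _ => norm_nonneg _) (fun k => ?_) hlim
  refine ContinuousLinearMap.opNorm_le_bound _ (by positivity) fun u => ?_
  have h := norm_fn_le_of_isTest hT (C := C * (1 / ((k : ℝ) + 1)))
    (ContinuousLinearMap.id ℝ _ - T k) (fun φ w hw => ?_) u
  · refine le_of_eq_of_le ?_ h
    rw [← norm_neg]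
    congr 1
    simp [hι]
  · have h1 := hTa k φ w.fn hw.1
    refine h1.trans ?_
    rw [mul_comm C, mul_assoc]
    exact mul_le_mul_of_nonneg_left (hC φ w hw) (by positivity)

end H0

end EnergySpace

/-! ### Completeness and compactly bounded weights -/

section Completeness

variable {n : ℕ} {μ : Measure ℝ} {A : CoeffMatrix n μ} {Ω : Opens (E n)}

lemma matForm_smul_smul (M : Matrix (Fin n) (Fin n) ℝ) (c : ℝ) (ξ : E n) :
    matForm M (c • ξ) (c • ξ) = c ^ 2 * matForm M ξ ξ := by
  rw [← matForm_symPart_self, matForm_smul_left, matForm_symPart_comm, matForm_smul_left,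
    matForm_symPart_self]
  ring

lemma continuous_matForm_self (M : Matrix (Fin n) (Fin n) ℝ) :
    Continuous fun ξ : E n => matForm M ξ ξ := by
  unfold matForm
  fun_prop

/-- A positive definite form is bounded below by a multiple of the Euclidean norm. -/
lemma exists_mul_norm_sq_le_matForm {M : Matrix (Fin n) (Fin n) ℝ}
    (hM : ∀ ξ : E n, ξ ≠ 0 → 0 < matForm M ξ ξ) :
    ∃ c : ℝ, 0 < c ∧ ∀ ξ : E n, c * ‖ξ‖ ^ 2 ≤ matForm M ξ ξ := by
  rcases (Metric.sphere (0 : E n) 1).eq_empty_or_nonempty with h | h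
  · refine ⟨1, one_pos, fun ξ => ?_⟩
    have hξ : ξ = 0 := by
      by_contra hne
      have : ‖ξ‖⁻¹ • ξ ∈ Metric.sphere (0 : E n) 1 := by
        rw [mem_sphere_zero_iff_norm, norm_smul, norm_inv, norm_norm,
          inv_mul_cancel₀ (norm_ne_zero_iff.2 hne)]
      rw [h] at this
      exact this
    simp [hξ, matForm]
  · obtain ⟨η, hη, hmin⟩ := (isCompact_sphere (0 : E n) 1).exists_isMinOn h
      (continuous_matForm_self M).continuousOn
    have hη0 : η ≠ 0 := by
      rintro rfl
      simp at hη
    refine ⟨matForm M η η, hM η hη0, fun ξ => ?_⟩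
    by_cases hξ : ξ = 0
    · simp [hξ, matForm]
    · have hnorm : ‖ξ‖ ≠ 0 := norm_ne_zero_iff.2 hξ
      have h1 : matForm M η η ≤ matForm M (‖ξ‖⁻¹ • ξ) (‖ξ‖⁻¹ • ξ) := by
        refine hmin ?_
        rw [mem_sphere_zero_iff_norm, norm_smul, norm_inv, norm_norm, inv_mul_cancel₀ hnorm]
      rw [matForm_smul_smul, inv_pow, inv_mul_eq_div, le_div_iff₀ (by positivity)] at h1
      exact h1

/-- A rapidly Cauchy sequence of fields converges in energy. The summability of the energies of the
increments makes the fields Cauchy at almost every point, in the norm given by the matrix at that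
point; Fatou's lemma bounds the energy of the difference to the pointwise limit. -/
lemma exists_energy_limit (A : CoeffMatrix n μ) {g : ℕ → ℝ × E n → E n}
    (hg : ∀ k, AEMeasurable (g k) (mixedMeasure n μ))
    (h : ∀ k m, k ≤ m → energy A (g k - g m) ≤ ENNReal.ofReal ((1 / 16) ^ k)) :
    ∃ G : ℝ × E n → E n, Measurable G ∧
      ∀ k, energy A (g k - G) ≤ ENNReal.ofReal ((1 / 16) ^ k) := by
  set q : ℕ → ℝ × E n → ℝ≥0∞ := fun k p =>
    ENNReal.ofReal (matForm (A.mat p.1 p.2) ((g k - g (k + 1)) p) ((g k - g (k + 1)) p)) with hq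
  have hqm : ∀ k, AEMeasurable (q k) (mixedMeasure n μ) := fun k =>
    (aemeasurable_matForm A ((hg k).sub (hg (k + 1))) ((hg k).sub (hg (k + 1)))).ennreal_ofReal
  have hsum : ∫⁻ p, ∑' k, ENNReal.ofReal (4 ^ k) * q k p ∂(mixedMeasure n μ) ≠ ∞ := by
    rw [lintegral_tsum fun k => (hqm k).const_mul _]
    have h1 : ∀ k, ∫⁻ p, ENNReal.ofReal (4 ^ k) * q k p ∂(mixedMeasure n μ) ≤
        ENNReal.ofReal ((1 / 4) ^ k) := by
      intro k
      rw [lintegral_const_mul' _ _ ENNReal.ofReal_ne_top]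
      refine (mul_le_mul' le_rfl (h k (k + 1) (Nat.le_succ k))).trans_eq ?_
      rw [← ENNReal.ofReal_mul (by positivity), ← mul_pow]
      norm_num
    refine ne_top_of_le_ne_top ?_ (ENNReal.tsum_le_tsum h1)
    rw [← ENNReal.ofReal_tsum_of_nonneg (fun k => by positivity)
      (summable_geometric_of_lt_one (by norm_num) (by norm_num))]
    exact ENNReal.ofReal_ne_top
  have hfin := ae_lt_top' (AEMeasurable.tsum fun k => (hqm k).const_mul _) hsum
  have hconv : ∀ᵐ p ∂(mixedMeasure n μ), ∃ l, Tendsto (fun k => g k p) atTop (𝓝 l) := by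
    filter_upwards [hfin, ae_mem_Ioc n μ] with p hp hp1
    set S := (∑' k, ENNReal.ofReal (4 ^ k) * q k p).toReal with hS
    obtain ⟨c, hc, hcM⟩ := exists_mul_norm_sq_le_matForm (A.posDef_mat p.1 hp1 p.2)
    have hstep : ∀ k, dist (g k p) (g (k + 1) p) ≤ Real.sqrt (S / c) * (1 / 2) ^ k := by
      intro k
      have h1 : ENNReal.ofReal (4 ^ k) * q k p ≤ ∑' k, ENNReal.ofReal (4 ^ k) * q k p :=
        ENNReal.le_tsum k
      have h2 := ENNReal.toReal_mono hp.ne h1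
      have h3 := matForm_self_nonneg A hp1 p.2 ((g k - g (k + 1)) p)
      rw [hq, ENNReal.toReal_mul, ENNReal.toReal_ofReal (by positivity),
        ENNReal.toReal_ofReal h3] at h2
      have h4 := hcM ((g k - g (k + 1)) p)
      have h5 : ‖(g k - g (k + 1)) p‖ ^ 2 ≤ S / c * ((1 / 2) ^ k) ^ 2 := by
        have h6 : ((1 / 2 : ℝ) ^ k) ^ 2 = (4 ^ k)⁻¹ := by
          rw [← pow_mul, mul_comm, pow_mul, ← inv_pow]
          norm_num
        rw [h6, div_mul_eq_mul_div, ← div_eq_mul_inv, div_div, le_div_iff₀ (by positivity)]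
        calc ‖(g k - g (k + 1)) p‖ ^ 2 * (4 ^ k * c)
            = 4 ^ k * (c * ‖(g k - g (k + 1)) p‖ ^ 2) := by ring
          _ ≤ 4 ^ k * matForm (A.mat p.1 p.2) ((g k - g (k + 1)) p) ((g k - g (k + 1)) p) := by
              gcongr
          _ ≤ S := h2
      rw [dist_eq_norm]
      have hSc : 0 ≤ S / c := div_nonneg ENNReal.toReal_nonneg hc.le
      have h7 := Real.sqrt_le_sqrt h5
      rw [Real.sqrt_sq (norm_nonneg _), Real.sqrt_mul hSc, Real.sqrt_sq (by positivity)] at h7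
      exact h7
    exact cauchySeq_tendsto_of_complete (cauchySeq_of_le_geometric _ _ (by norm_num) hstep)
  obtain ⟨G, hGm, hG⟩ := measurable_limit_of_tendsto_metrizable_ae hg hconv
  refine ⟨G, hGm, fun k => ?_⟩
  have hlim : ∀ᵐ p ∂(mixedMeasure n μ),
      ENNReal.ofReal (matForm (A.mat p.1 p.2) ((g k - G) p) ((g k - G) p)) =
      liminf (fun j => ENNReal.ofReal
        (matForm (A.mat p.1 p.2) ((g k - g j) p) ((g k - g j) p))) atTop := by
    filter_upwards [hG] with p hp
    refine (Tendsto.liminf_eq ?_).symm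
    refine (ENNReal.continuous_ofReal.tendsto _).comp ?_
    exact ((continuous_matForm_self (A.mat p.1 p.2)).tendsto _).comp (tendsto_const_nhds.sub hp)
  unfold energy
  rw [lintegral_congr_ae hlim]
  refine (lintegral_liminf_le' fun j => (aemeasurable_matForm A ((hg k).sub (hg j))
    ((hg k).sub (hg j))).ennreal_ofReal).trans ?_
  refine liminf_le_of_frequently_le' (Eventually.frequently ?_)
  filter_upwards [eventually_ge_atTop k] with j hj
  exact h k j hj

namespace H0

/-- `H⁰(A, Ω)` is complete as soon as its norm controls the `L¹` norm: a Cauchy sequence has a limit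
both in `L¹` and in energy. -/
lemma completeSpace [IsFiniteMeasure μ] (ι : H0 A Ω →L[ℝ] Lp ℝ 1 (volume : Measure (E n)))
    (hι : ∀ u, ι u = u.fn) (hT : ∀ φ : 𝓓(Ω, ℝ), ∃ u : H0 A Ω, u.IsTest φ) :
    CompleteSpace (H0 A Ω) := by
  refine Metric.complete_of_convergent_controlled_sequences (fun k => (1 / 4 : ℝ) ^ k)
    (fun k => by positivity) fun u hu => ?_
  have hsq : ∀ k m, k ≤ m → ‖u k - u m‖ ^ 2 ≤ (1 / 16 : ℝ) ^ k := by
    intro k m hkm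
    have h1 := (hu k k m le_rfl hkm).le
    rw [dist_eq_norm] at h1
    calc ‖u k - u m‖ ^ 2 ≤ ((1 / 4 : ℝ) ^ k) ^ 2 := by gcongr
      _ = (1 / 16 : ℝ) ^ k := by rw [← pow_mul, mul_comm, pow_mul]; norm_num
  have hcau : CauchySeq u := by
    refine cauchySeq_of_le_tendsto_0' (fun k => (1 / 4 : ℝ) ^ k)
      (fun k m hkm => (hu k k m le_rfl hkm).le) ?_
    exact tendsto_pow_atTop_nhds_zero_of_lt_one (by norm_num) (by norm_num)
  obtain ⟨f, hf⟩ := cauchySeq_tendsto_of_complete (ι.uniformContinuous.comp_cauchySeq hcau)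
  have hf' : Tendsto (fun k => (u k).fn) atTop (𝓝 f) := by
    refine (tendsto_congr fun k => ?_).1 hf
    exact hι (u k)
  obtain ⟨G, hGm, hG⟩ := exists_energy_limit A (g := fun k => (u k).grad)
    (fun k => (u k).aemeasurable_grad) (fun k m hkm => by
      have h1 := energy_field_sub (u k) (u m)
      rw [energy_aeeqFun_sub] at h1
      exact h1.trans_le (ENNReal.ofReal_le_ofReal (hsq k m hkm)))
  set F : (ℝ × E n) →ₘ[mixedMeasure n μ] E n := AEEqFun.mk G hGm.aestronglyMeasurable with hF
  have hFG : ⇑F =ᵐ[mixedMeasure n μ] G := AEEqFun.coeFn_mk _ _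
  have hen : ∀ k, energy A ((u k).grad - ⇑F) ≤ ENNReal.ofReal ((1 / 16) ^ k) := fun k => by
    rw [energy_congr A ((EventuallyEq.refl _ _).sub hFG)]
    exact hG k
  have hlim16 : Tendsto (fun k : ℕ => ENNReal.ofReal ((1 / 16) ^ k)) atTop (𝓝 0) := by
    rw [← ENNReal.ofReal_zero]
    exact (ENNReal.continuous_ofReal.tendsto 0).comp
      (tendsto_pow_atTop_nhds_zero_of_lt_one (by norm_num) (by norm_num))
  -- test functions close to the members of the sequence show that the limit lies in `H⁰(A, Ω)`
  have happrox : ∀ k, ∃ (φ : 𝓓(Ω, ℝ)) (w : H0 A Ω), w.IsTest φ ∧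
      ‖w.fn - (u k).fn‖ ≤ (1 / 4 : ℝ) ^ k ∧
      energy A (w.grad - (u k).grad) ≤ ENNReal.ofReal ((1 / 16) ^ k) := by
    intro k
    obtain ⟨φ, w, hw, h1, h2⟩ := exists_tendsto_isTest hT (u k)
    have h3 := Metric.tendsto_nhds.1 h1 ((1 / 4 : ℝ) ^ k) (by positivity)
    have h4 := Metric.tendsto_nhds.1 h2 ((1 / 4 : ℝ) ^ k) (by positivity)
    obtain ⟨j, hj1, hj2⟩ := (h3.and h4).exists
    rw [dist_eq_norm] at hj1 hj2
    refine ⟨φ j, w j, hw j, hj2.le, ?_⟩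
    have h5 := energy_field_sub (w j) (u k)
    rw [energy_aeeqFun_sub] at h5
    refine h5.trans_le (ENNReal.ofReal_le_ofReal ?_)
    calc ‖w j - u k‖ ^ 2 ≤ ((1 / 4 : ℝ) ^ k) ^ 2 := by gcongr
      _ = (1 / 16 : ℝ) ^ k := by rw [← pow_mul, mul_comm, pow_mul]; norm_num
  choose φ w hw hw1 hw2 using happrox
  have hFfin : energy A F < ∞ := by
    have h1 : ⇑F = (u 0).grad + -((u 0).grad - ⇑F) := by abel
    rw [h1]
    refine (energy_add_le A (u 0).aemeasurable_grad
      ((u 0).aemeasurable_grad.sub F.aemeasurable).neg).trans_lt ?_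
    rw [energy_neg]
    exact ENNReal.add_lt_top.2 ⟨ENNReal.mul_lt_top (by simp) (u 0).energy_grad_lt_top,
      ENNReal.mul_lt_top (by simp) ((hen 0).trans_lt ENNReal.ofReal_lt_top)⟩
  have hwF : Tendsto (fun k => energy A ((w k).field - F : (ℝ × E n) →ₘ[mixedMeasure n μ] E n))
      atTop (𝓝 0) := by
    have hlim : Tendsto (fun k : ℕ => 2 * ENNReal.ofReal ((1 / 16) ^ k) +
        2 * ENNReal.ofReal ((1 / 16) ^ k)) atTop (𝓝 0) := by
      have ha := ENNReal.Tendsto.const_mul (a := 2) hlim16 (Or.inr (by simp))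
      simpa using ha.add ha
    refine tendsto_of_tendsto_of_tendsto_of_le_of_le tendsto_const_nhds hlim
      (fun _ => zero_le) fun k => ?_
    rw [energy_aeeqFun_sub]
    have h1 : ⇑(w k).field - ⇑F = ((w k).grad - (u k).grad) + ((u k).grad - ⇑F) := by
      rw [coeFn_field]; abel
    rw [h1]
    refine (energy_add_le A ((w k).aemeasurable_grad.sub (u k).aemeasurable_grad)
      ((u k).aemeasurable_grad.sub F.aemeasurable)).trans ?_
    gcongr
    · exact hw2 k
    · exact hen k
  have hwf : Tendsto (fun k => (w k).fn) atTop (𝓝 f) := by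
    have h1 : Tendsto (fun k => (w k).fn - (u k).fn) atTop (𝓝 0) :=
      squeeze_zero_norm hw1
        (tendsto_pow_atTop_nhds_zero_of_lt_one (by norm_num) (by norm_num))
    simpa using h1.add hf'
  let v : H0 A Ω := ⟨(f, F), hFfin, φ, fun k => ((w k).fn, (w k).field), hw, hwf, hwF⟩
  refine ⟨v, tendsto_of_tendsto_energy ?_⟩
  refine tendsto_of_tendsto_of_tendsto_of_le_of_le tendsto_const_nhds hlim16
    (fun _ => zero_le) fun k => ?_
  rw [energy_aeeqFun_sub]
  exact hen k

/-- The inequality of compact boundedness extends from test functions to `H⁰(A, Ω)`: Fatou's lemma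
applies along an almost everywhere convergent sequence of test functions. -/
lemma lintegral_mul_sq_le (hT : ∀ φ : 𝓓(Ω, ℝ), ∃ u : H0 A Ω, u.IsTest φ) {f : E n → ℝ}
    (hfm : AEMeasurable f (volume.restrict Ω)) {ε K : ℝ} (hε : 0 ≤ ε) (hK : 0 ≤ K)
    (h : ∀ φ : 𝓓(Ω, ℝ), ∫⁻ x in (Ω : Set (E n)), ENNReal.ofReal (f x * φ x ^ 2) ≤
      ENNReal.ofReal ε * energy A (fun p => fracGrad p.1 φ p.2) +
        ENNReal.ofReal K * (∫⁻ x in (Ω : Set (E n)), ENNReal.ofReal |φ x|) ^ 2) (u : H0 A Ω) :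
    ∫⁻ x in (Ω : Set (E n)), ENNReal.ofReal (f x * u.val x ^ 2) ≤
      ENNReal.ofReal (ε * ‖u‖ ^ 2 + K * ‖u.fn‖ ^ 2) := by
  obtain ⟨φ, w, hw, h1, h2⟩ := exists_tendsto_isTest hT u
  obtain ⟨ns, hns, hae⟩ := (tendstoInMeasure_of_tendsto_Lp h2).exists_seq_tendsto_ae
  have hbound : ∀ k, ∫⁻ x in (Ω : Set (E n)), ENNReal.ofReal (f x * (w k).val x ^ 2) ≤
      ENNReal.ofReal (ε * ‖w k‖ ^ 2 + K * ‖(w k).fn‖ ^ 2) := by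
    intro k
    have e1 : ∫⁻ x in (Ω : Set (E n)), ENNReal.ofReal (f x * (w k).val x ^ 2) =
        ∫⁻ x in (Ω : Set (E n)), ENNReal.ofReal (f x * φ k x ^ 2) := by
      refine lintegral_congr_ae (ae_restrict_of_ae ((hw k).1.mono fun x hx => ?_))
      have hx' : (w k).val x = φ k x := hx
      simp only [hx']
    have e2 : energy A (fun p => fracGrad p.1 (φ k) p.2) = ENNReal.ofReal (‖w k‖ ^ 2) := by
      rw [← energy_grad]
      exact (energy_congr A (hw k).2).symm
    have e3 : ∫⁻ x in (Ω : Set (E n)), ENNReal.ofReal |φ k x| ≤ ENNReal.ofReal ‖(w k).fn‖ := by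
      rw [L1.norm_def, ENNReal.ofReal_toReal]
      · refine (setLIntegral_le_lintegral _ _).trans_eq (lintegral_congr_ae ((hw k).1.mono
          fun x hx => ?_))
        have hx' : (w k).fn x = φ k x := hx
        simp only [hx', ← Real.norm_eq_abs, ofReal_norm]
      · exact (L1.integrable_coeFn (w k).fn).2.ne
    rw [e1]
    refine (h (φ k)).trans ?_
    rw [e2, ENNReal.ofReal_add (by positivity) (by positivity), ENNReal.ofReal_mul hε,
      ENNReal.ofReal_mul hK, ENNReal.ofReal_pow (norm_nonneg _) 2 (p := ‖(w k).fn‖)]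
    gcongr
  have hlim : ∀ᵐ x ∂(volume.restrict (Ω : Set (E n))), ENNReal.ofReal (f x * u.val x ^ 2) =
      liminf (fun k => ENNReal.ofReal (f x * (w (ns k)).val x ^ 2)) atTop := by
    refine ae_restrict_of_ae (hae.mono fun x hx => (Tendsto.liminf_eq ?_).symm)
    exact (ENNReal.continuous_ofReal.tendsto _).comp ((hx.pow 2).const_mul (f x))
  rw [lintegral_congr_ae hlim]
  have hmeas : ∀ k, AEMeasurable (fun x => ENNReal.ofReal (f x * (w (ns k)).val x ^ 2))
      (volume.restrict (Ω : Set (E n))) := fun k =>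
    (hfm.mul ((Lp.stronglyMeasurable (w (ns k)).fn).measurable.aemeasurable.pow_const
      2)).ennreal_ofReal
  refine (lintegral_liminf_le' hmeas).trans ?_
  refine (liminf_le_liminf (Eventually.of_forall fun k => hbound (ns k))).trans_eq ?_
  refine Tendsto.liminf_eq ((ENNReal.continuous_ofReal.tendsto _).comp ?_)
  exact (((h1.comp hns.tendsto_atTop).norm.pow 2).const_mul ε).add
    (((h2.comp hns.tendsto_atTop).norm.pow 2).const_mul K)

end H0

end Completeness

/-! ### Bilinear forms on `H⁰(A, Ω)` -/

section Abstract

/-- An operator that is bounded, up to an arbitrarily small multiple of the norm, by a compact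
operator is compact (Ehrling's inequality implies compactness). -/
lemma isCompactOperator_of_norm_le {V X W : Type*} [SeminormedAddCommGroup V] [NormedSpace ℝ V]
    [NormedAddCommGroup X] [NormedSpace ℝ X] [NormedAddCommGroup W] [NormedSpace ℝ W]
    [CompleteSpace W] {T : V →L[ℝ] W} {ι : V →L[ℝ] X} (hι : IsCompactOperator ι)
    (h : ∀ δ : ℝ, 0 < δ → ∃ K : ℝ, 0 ≤ K ∧ ∀ u, ‖T u‖ ≤ δ * ‖u‖ + K * ‖ι u‖) :
    IsCompactOperator T := by
  refine (isCompactOperator_iff_isCompact_closure_image_closedBall T.toLinearMap one_pos).2 ?_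
  refine TotallyBounded.isCompact_of_isClosed ?_ isClosed_closure
  refine TotallyBounded.closure (Metric.totallyBounded_iff.2 fun r hr => ?_)
  obtain ⟨K, hK, hT⟩ := h (r / 4) (by positivity)
  have htb : TotallyBounded (ι '' Metric.closedBall 0 1) :=
    (hι.isCompact_closure_image_closedBall (f := ι.toLinearMap) 1).totallyBounded.subset
      subset_closure
  have hη : 0 < r / (4 * (K + 1)) := by positivity
  obtain ⟨t, htsub, htfin, htcov⟩ := exists_subset_image_finite_and.1
    (Metric.finite_approx_of_totallyBounded htb _ hη)
  refine ⟨T '' t, htfin.image _, ?_⟩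
  rintro _ ⟨u, hu, rfl⟩
  obtain ⟨y, ⟨w, hw, rfl⟩, hy⟩ : ∃ y ∈ ι '' t, ι u ∈ Metric.ball y (r / (4 * (K + 1))) := by
    simpa only [mem_iUnion₂, exists_prop] using htcov ⟨u, hu, rfl⟩
  refine mem_iUnion₂.2 ⟨T w, ⟨w, hw, rfl⟩, ?_⟩
  rw [Metric.mem_ball, dist_eq_norm, ← map_sub] at hy
  change dist (T u) (T w) < r
  rw [dist_eq_norm, ← map_sub]
  have h1 : ‖u - w‖ ≤ 2 := by
    have h2 := norm_sub_le u w
    have h3 := mem_closedBall_zero_iff.1 hu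
    have h4 := mem_closedBall_zero_iff.1 (htsub hw)
    linarith
  calc ‖T (u - w)‖ ≤ r / 4 * ‖u - w‖ + K * ‖ι (u - w)‖ := hT _
    _ ≤ r / 4 * 2 + K * (r / (4 * (K + 1))) := by gcongr
    _ = r / 2 + r / 4 * (K / (K + 1)) := by field_simp; ring
    _ ≤ r / 2 + r / 4 * 1 := by
        gcongr
        rw [div_le_one (by positivity)]
        linarith
    _ < r := by linarith

/-- A bilinear form with `|B(u,v)| ≤ C (‖u‖² + ‖v‖²)` is bounded, by homogeneity. -/
lemma abs_bilin_le_of_le_sq_add_sq {V : Type*} [SeminormedAddCommGroup V] [NormedSpace ℝ V]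
    (hs : ∀ v : V, ‖v‖ = 0 → v = 0) (B : V →ₗ[ℝ] V →ₗ[ℝ] ℝ) {C : ℝ}
    (hB : ∀ u v, |B u v| ≤ C * (‖u‖ ^ 2 + ‖v‖ ^ 2)) (u v : V) :
    ‖B u v‖ ≤ 2 * C * ‖u‖ * ‖v‖ := by
  by_cases hu : ‖u‖ = 0
  · rw [hs u hu]; simp
  by_cases hv : ‖v‖ = 0
  · rw [hs v hv]; simp
  have h := hB (‖u‖⁻¹ • u) (‖v‖⁻¹ • v)
  have h1 : ∀ w : V, ‖w‖ ≠ 0 → ‖(‖w‖⁻¹ • w)‖ = 1 := fun w hw => by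
    rw [norm_smul, norm_inv, norm_norm, inv_mul_cancel₀ hw]
  rw [h1 u hu, h1 v hv, map_smul, map_smul, LinearMap.smul_apply, smul_eq_mul, smul_eq_mul,
    ← mul_assoc, abs_mul, abs_mul, abs_inv, abs_inv, abs_norm, abs_norm, ← mul_inv,
    inv_mul_le_iff₀ (by positivity)] at h
  rw [Real.norm_eq_abs]
  linarith

end Abstract

section Forms

variable {n : ℕ} {μ : Measure ℝ} {A : CoeffMatrix n μ} {Ω : Opens (E n)}

lemma matForm_eq_sum_mulVec (M : Matrix (Fin n) (Fin n) ℝ) (ξ ψ : E n) :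
    matForm M ξ ψ = ∑ i, ξ i * (M.mulVec ψ) i := by
  simp only [matForm, Matrix.mulVec, dotProduct, Finset.mul_sum]
  exact Finset.sum_congr rfl fun i _ => Finset.sum_congr rfl fun j _ => by ring

lemma matForm_transpose (M : Matrix (Fin n) (Fin n) ℝ) (ξ ψ : E n) :
    matForm M.transpose ξ ψ = matForm M ψ ξ := by
  unfold matForm
  rw [Finset.sum_comm]
  refine Finset.sum_congr rfl fun i _ => Finset.sum_congr rfl fun j _ => ?_
  rw [Matrix.transpose_apply]
  ring

/-- If `|ξᵀ M ψ|² ≤ K (ξᵀ M ξ)(ψᵀ M ψ)` for a positive definite `M`, then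
`|α · ξ|² ≤ K (αᵀ M⁻¹ α)(ξᵀ M ξ)`: take `ψ = M⁻¹ α`. -/
lemma sq_sum_mul_le {M N : Matrix (Fin n) (Fin n) ℝ} (hM : ∀ ξ : E n, ξ ≠ 0 → 0 < matForm M ξ ξ)
    {K : ℝ} (hK0 : 0 ≤ K) (hK : ∀ ξ ψ, matForm M ξ ψ ^ 2 ≤ K * matForm M ξ ξ * matForm M ψ ψ)
    (hN : ∀ i j, |M⁻¹ i j| ≤ N i j) {α α' : Fin n → ℝ} (hα : ∀ i, |α i| ≤ α' i) (ξ : E n) :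
    (∑ i, α i * ξ i) ^ 2 ≤ K * (∑ i, ∑ j, N i j * (α' i * α' j)) * matForm M ξ ξ := by
  have hξ0 : 0 ≤ matForm M ξ ξ := by
    by_cases h : ξ = 0
    · simp [h, matForm]
    · exact (hM ξ h).le
  have hdet : IsUnit M.det := by
    rw [isUnit_iff_ne_zero]
    intro h0
    obtain ⟨v, hv, hMv⟩ := Matrix.exists_mulVec_eq_zero_iff.2 h0
    have hv' : (WithLp.toLp 2 v : E n) ≠ 0 := fun h => hv (by
      have := congrArg WithLp.ofLp h
      simpa using this)
    have h1 := hM _ hv'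
    rw [matForm_eq_sum_mulVec] at h1
    simp [hMv] at h1
  set ψ : E n := WithLp.toLp 2 (M⁻¹.mulVec α) with hψ
  have hMψ : M.mulVec ψ = α := by
    change M.mulVec (M⁻¹.mulVec α) = α
    rw [Matrix.mulVec_mulVec, Matrix.mul_nonsing_inv M hdet, Matrix.one_mulVec]
  have h1 : matForm M ξ ψ = ∑ i, α i * ξ i := by
    rw [matForm_eq_sum_mulVec, hMψ]
    exact Finset.sum_congr rfl fun i _ => mul_comm _ _
  have h2 : matForm M ψ ψ ≤ ∑ i, ∑ j, N i j * (α' i * α' j) := by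
    rw [matForm_eq_sum_mulVec, hMψ]
    refine Finset.sum_le_sum fun i _ => ?_
    change (∑ j, M⁻¹ i j * α j) * α i ≤ _
    rw [Finset.sum_mul]
    refine Finset.sum_le_sum fun j _ => ?_
    have hN0 : 0 ≤ N i j := (abs_nonneg _).trans (hN i j)
    have hα0 : ∀ k, 0 ≤ α' k := fun k => (abs_nonneg _).trans (hα k)
    calc M⁻¹ i j * α j * α i ≤ |M⁻¹ i j * α j * α i| := le_abs_self _
      _ = |M⁻¹ i j| * (|α i| * |α j|) := by rw [abs_mul, abs_mul]; ring
      _ ≤ N i j * (α' i * α' j) :=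
        mul_le_mul (hN i j) (mul_le_mul (hα i) (hα j) (abs_nonneg _) (hα0 i))
          (by positivity) hN0
  calc (∑ i, α i * ξ i) ^ 2 = matForm M ξ ψ ^ 2 := by rw [h1]
    _ ≤ K * matForm M ξ ξ * matForm M ψ ψ := hK ξ ψ
    _ ≤ K * matForm M ξ ξ * ∑ i, ∑ j, N i j * (α' i * α' j) := by gcongr
    _ = _ := by ring

/-- The arithmetic-geometric mean inequality in the form `|z| ≤ (δ q + δ⁻¹ r) / 2` if
`z² ≤ r q`. -/
lemma abs_le_of_sq_le_mul {z q r δ : ℝ} (hδ : 0 < δ) (hq : 0 ≤ q) (hr : 0 ≤ r)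
    (h : z ^ 2 ≤ r * q) : |z| ≤ (δ * q + δ⁻¹ * r) / 2 := by
  refine abs_le_of_sq_le_sq (h.trans ?_) (by positivity)
  have h1 : r * q = (δ * q) * (δ⁻¹ * r) := by field_simp
  rw [h1]
  nlinarith [sq_nonneg (δ * q - δ⁻¹ * r)]

namespace H0

lemma integrable_form (u : H0 A Ω) :
    Integrable (fun p => matForm (A.mat p.1 p.2) (u.grad p) (u.grad p)) (mixedMeasure n μ) :=
  integrable_matForm_self A u.aemeasurable_grad u.energy_grad_lt_top

/-- The principal part of the bilinear form converges absolutely. -/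
lemma integrable_matForm_grad {K : ℝ} (hK0 : 0 ≤ K)
    (hK : ∀ s ∈ Ioc (0 : ℝ) 1, ∀ x ξ ψ, matForm (A.mat s x) ξ ψ ^ 2 ≤
      K * matForm (A.mat s x) ξ ξ * matForm (A.mat s x) ψ ψ) (u v : H0 A Ω) :
    Integrable (fun p => matForm (A.mat p.1 p.2) (u.grad p) (v.grad p)) (mixedMeasure n μ) ∧
    |∫ p, matForm (A.mat p.1 p.2) (u.grad p) (v.grad p) ∂(mixedMeasure n μ)| ≤
      (K * ‖u‖ ^ 2 + ‖v‖ ^ 2) / 2 := by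
  have hbd : ∀ᵐ p ∂(mixedMeasure n μ), ‖matForm (A.mat p.1 p.2) (u.grad p) (v.grad p)‖ ≤
      (K * matForm (A.mat p.1 p.2) (u.grad p) (u.grad p) +
        matForm (A.mat p.1 p.2) (v.grad p) (v.grad p)) / 2 := by
    refine (ae_mem_Ioc n μ).mono fun p hp => ?_
    have h1 := matForm_self_nonneg A hp p.2 (u.grad p)
    have h2 := matForm_self_nonneg A hp p.2 (v.grad p)
    have h := abs_le_of_sq_le_mul one_pos h2 (mul_nonneg hK0 h1) (hK p.1 hp p.2 _ _)
    rw [inv_one, one_mul, one_mul] at h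
    rw [Real.norm_eq_abs]
    linarith
  have hi := ((u.integrable_form.const_mul K).add v.integrable_form).div_const 2
  refine ⟨hi.mono' (aemeasurable_matForm A u.aemeasurable_grad
    v.aemeasurable_grad).aestronglyMeasurable hbd, ?_⟩
  refine (norm_integral_le_of_norm_le hi hbd).trans_eq ?_
  simp only [Pi.add_apply]
  rw [integral_div, integral_add (u.integrable_form.const_mul K) v.integrable_form,
    integral_const_mul, ← norm_sq_eq, ← norm_sq_eq]

/-- The lower order terms `α · D^s v u` converge absolutely if `|α · ξ|² ≤ K f (ξᵀ A ξ)` and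
`f u²` is integrable. -/
lemma integrable_lowerOrder [IsFiniteMeasure μ] (hT : ∀ φ : 𝓓(Ω, ℝ), ∃ u : H0 A Ω, u.IsTest φ)
    {K : ℝ} (hK0 : 0 ≤ K) {f : E n → ℝ} (hf0 : ∀ x, 0 ≤ f x) {α : ℝ → E n → Fin n → ℝ}
    (hα : ∀ i, AEMeasurable (fun p : ℝ × E n => α p.1 p.2 i) (mixedMeasure n μ))
    (hαf : ∀ s ∈ Ioc (0 : ℝ) 1, ∀ x (ξ : E n),
      (∑ i, α s x i * ξ i) ^ 2 ≤ K * f x * matForm (A.mat s x) ξ ξ) (u v : H0 A Ω)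
    (hu : IntegrableOn (fun x => f x * u.val x ^ 2) (Ω : Set (E n))) :
    Integrable (fun p => (∑ i, α p.1 p.2 i * v.grad p i) * u.val p.2) (mixedMeasure n μ) ∧
    ∀ δ : ℝ, 0 < δ →
      |∫ p, (∑ i, α p.1 p.2 i * v.grad p i) * u.val p.2 ∂(mixedMeasure n μ)| ≤
        (δ * ‖v‖ ^ 2 + δ⁻¹ * (K * (μ.real (Ioc 0 1) *
          ∫ x in (Ω : Set (E n)), f x * u.val x ^ 2))) / 2 := by
  set g : E n → ℝ := (Ω : Set (E n)).indicator fun x => f x * u.val x ^ 2 with hg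
  have hΩm : MeasurableSet (Ω : Set (E n)) := Ω.isOpen.measurableSet
  have hgi : Integrable g := (integrable_indicator_iff hΩm).2 hu
  have hgp : Integrable (fun p : ℝ × E n => g p.2) (mixedMeasure n μ) := hgi.comp_snd _
  have hgint : ∫ p, g p.2 ∂(mixedMeasure n μ) =
      μ.real (Ioc 0 1) * ∫ x in (Ω : Set (E n)), f x * u.val x ^ 2 := by
    rw [integral_fun_snd g, integral_indicator hΩm, smul_eq_mul, measureReal_restrict_apply_univ]
  have h0 : ∀ᵐ p ∂(mixedMeasure n μ), p.2 ∉ Ω → u.val p.2 = 0 :=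
    Measure.quasiMeasurePreserving_snd.ae (u.val_eq_zero_ae_compl hT)
  have hbd : ∀ δ : ℝ, 0 < δ → ∀ᵐ p ∂(mixedMeasure n μ),
      ‖(∑ i, α p.1 p.2 i * v.grad p i) * u.val p.2‖ ≤
      (δ * matForm (A.mat p.1 p.2) (v.grad p) (v.grad p) + δ⁻¹ * (K * g p.2)) / 2 := by
    intro δ hδ
    filter_upwards [ae_mem_Ioc n μ, h0] with p hp hp0
    have h1 := matForm_self_nonneg A hp p.2 (v.grad p)
    rw [Real.norm_eq_abs]
    by_cases hx : p.2 ∈ Ω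
    · have hgx : g p.2 = f p.2 * u.val p.2 ^ 2 := indicator_of_mem hx _
      have hg0 : 0 ≤ g p.2 := by
        rw [hgx]
        exact mul_nonneg (hf0 _) (sq_nonneg _)
      refine abs_le_of_sq_le_mul hδ h1 (mul_nonneg hK0 hg0) ?_
      rw [mul_pow, hgx]
      calc (∑ i, α p.1 p.2 i * v.grad p i) ^ 2 * u.val p.2 ^ 2
          ≤ K * f p.2 * matForm (A.mat p.1 p.2) (v.grad p) (v.grad p) * u.val p.2 ^ 2 :=
            mul_le_mul_of_nonneg_right (hαf p.1 hp p.2 _) (sq_nonneg _)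
        _ = _ := by ring
    · have hgx : g p.2 = 0 := indicator_of_notMem hx _
      rw [hp0 hx, mul_zero, abs_zero, hgx, mul_zero, mul_zero, add_zero]
      positivity
  have hi : ∀ δ : ℝ, Integrable (fun p => (δ * matForm (A.mat p.1 p.2) (v.grad p) (v.grad p) +
      δ⁻¹ * (K * g p.2)) / 2) (mixedMeasure n μ) := fun δ =>
    ((v.integrable_form.const_mul δ).add ((hgp.const_mul K).const_mul δ⁻¹)).div_const 2
  have hm : AEStronglyMeasurable (fun p => (∑ i, α p.1 p.2 i * v.grad p i) * u.val p.2)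
      (mixedMeasure n μ) := by
    have hc : ∀ i : Fin n, Measurable fun ξ : E n => ξ i := fun i => by fun_prop
    refine (AEMeasurable.mul (Finset.aemeasurable_fun_sum _ fun i _ => (hα i).mul
      ((hc i).comp_aemeasurable v.aemeasurable_grad)) ?_).aestronglyMeasurable
    exact ((Lp.stronglyMeasurable u.fn).measurable.comp measurable_snd).aemeasurable
  refine ⟨(hi 1).mono' hm (hbd 1 one_pos), fun δ hδ => ?_⟩
  refine (norm_integral_le_of_norm_le (hi δ) (hbd δ hδ)).trans_eq ?_
  rw [integral_div, integral_add (v.integrable_form.const_mul δ)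
    ((hgp.const_mul K).const_mul δ⁻¹), integral_const_mul, integral_const_mul, integral_const_mul,
    ← norm_sq_eq, hgint]

/-- The zeroth order term converges absolutely if its coefficient is dominated by a weight `f` for
which `f u²` and `f v²` are integrable. -/
lemma integrableOn_zerothOrder {f g : E n → ℝ}
    (hg : AEMeasurable g (volume.restrict (Ω : Set (E n)))) (hgf : ∀ x, |g x| ≤ f x)
    (u v : H0 A Ω) (hu : IntegrableOn (fun x => f x * u.val x ^ 2) (Ω : Set (E n)))
    (hv : IntegrableOn (fun x => f x * v.val x ^ 2) (Ω : Set (E n))) :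
    IntegrableOn (fun x => g x * u.val x * v.val x) (Ω : Set (E n)) ∧
    |∫ x in (Ω : Set (E n)), g x * u.val x * v.val x| ≤
      ((∫ x in (Ω : Set (E n)), f x * u.val x ^ 2) +
        ∫ x in (Ω : Set (E n)), f x * v.val x ^ 2) / 2 := by
  have hbd : ∀ x, ‖g x * u.val x * v.val x‖ ≤
      (f x * u.val x ^ 2 + f x * v.val x ^ 2) / 2 := by
    intro x
    rw [Real.norm_eq_abs, mul_assoc, abs_mul]
    have h1 : |u.val x * v.val x| ≤ (u.val x ^ 2 + v.val x ^ 2) / 2 := by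
      rw [abs_le]
      constructor <;> nlinarith [sq_nonneg (u.val x - v.val x), sq_nonneg (u.val x + v.val x)]
    calc |g x| * |u.val x * v.val x| ≤ f x * ((u.val x ^ 2 + v.val x ^ 2) / 2) :=
          mul_le_mul (hgf x) h1 (abs_nonneg _) ((abs_nonneg _).trans (hgf x))
      _ = _ := by ring
  have hi : IntegrableOn (fun x => (f x * u.val x ^ 2 + f x * v.val x ^ 2) / 2)
      (Ω : Set (E n)) := (hu.add hv).div_const 2
  have hm : AEStronglyMeasurable (fun x => g x * u.val x * v.val x)
      (volume.restrict (Ω : Set (E n))) :=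
    ((hg.mul (Lp.stronglyMeasurable u.fn).measurable.aemeasurable).mul
      (Lp.stronglyMeasurable v.fn).measurable.aemeasurable).aestronglyMeasurable
  refine ⟨hi.mono' hm (ae_of_all _ hbd), ?_⟩
  refine (norm_integral_le_of_norm_le hi (ae_of_all _ hbd)).trans_eq ?_
  rw [integral_div, integral_add hu hv]

lemma formDensity_eq (m : ℝ → E n → Matrix (Fin n) (Fin n) ℝ) (a b : ℝ → E n → Fin n → ℝ)
    (u v : H0 A Ω) (p : ℝ × E n) :
    formDensity m a b u v p = matForm (m p.1 p.2) (v.grad p) (u.grad p) +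
      ((∑ i, a p.1 p.2 i * v.grad p i) * u.val p.2 +
        (∑ i, b p.1 p.2 i * u.grad p i) * v.val p.2) := by
  unfold formDensity matForm
  rw [Finset.sum_add_distrib, Finset.sum_mul, Finset.sum_mul]
  congr 1
  · exact Finset.sum_congr rfl fun i _ => Finset.sum_congr rfl fun j _ => by ring
  · congr 1
    · exact Finset.sum_congr rfl fun i _ => by ring
    · exact Finset.sum_congr rfl fun i _ => by ring

lemma formDensity_swap (m : ℝ → E n → Matrix (Fin n) (Fin n) ℝ) (a b : ℝ → E n → Fin n → ℝ)
    (u v : H0 A Ω) (p : ℝ × E n) :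
    formDensity (fun s x => (m s x).transpose) b a u v p = formDensity m a b v u p := by
  rw [formDensity_eq, formDensity_eq, matForm_transpose]
  ring

lemma formDensity_add_left (m : ℝ → E n → Matrix (Fin n) (Fin n) ℝ) (a b : ℝ → E n → Fin n → ℝ)
    (u u' v : H0 A Ω) : formDensity m a b (u + u') v =ᵐ[mixedMeasure n μ]
      formDensity m a b u v + formDensity m a b u' v := by
  filter_upwards [grad_add u u', Measure.quasiMeasurePreserving_snd.ae (val_add u u')]
    with p hp hp'
  simp only [Pi.add_apply, formDensity_eq, hp, hp', ← matForm_transpose _ _ (v.grad p),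
    matForm_add_left, PiLp.add_apply, mul_add, Finset.sum_add_distrib]
  ring

lemma formDensity_smul_left (m : ℝ → E n → Matrix (Fin n) (Fin n) ℝ) (a b : ℝ → E n → Fin n → ℝ)
    (c : ℝ) (u v : H0 A Ω) : formDensity m a b (c • u) v =ᵐ[mixedMeasure n μ]
      fun p => c * formDensity m a b u v p := by
  filter_upwards [grad_smul c u, Measure.quasiMeasurePreserving_snd.ae (val_smul c u)]
    with p hp hp'
  simp only [Pi.smul_apply, formDensity_eq, hp, hp', ← matForm_transpose _ _ (v.grad p),
    matForm_smul_left, PiLp.smul_apply, smul_eq_mul, mul_left_comm _ c, ← Finset.mul_sum]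
  ring

lemma formDensity_add_right (m : ℝ → E n → Matrix (Fin n) (Fin n) ℝ) (a b : ℝ → E n → Fin n → ℝ)
    (u v v' : H0 A Ω) : formDensity m a b u (v + v') =ᵐ[mixedMeasure n μ]
      formDensity m a b u v + formDensity m a b u v' := by
  filter_upwards [formDensity_add_left (fun s x => (m s x).transpose) b a v v' u] with p hp
  simpa only [Pi.add_apply, formDensity_swap] using hp

lemma formDensity_smul_right (m : ℝ → E n → Matrix (Fin n) (Fin n) ℝ)
    (a b : ℝ → E n → Fin n → ℝ) (c : ℝ) (u v : H0 A Ω) :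
    formDensity m a b u (c • v) =ᵐ[mixedMeasure n μ] fun p => c * formDensity m a b u v p := by
  filter_upwards [formDensity_smul_left (fun s x => (m s x).transpose) b a c v u] with p hp
  simpa only [formDensity_swap] using hp

/-- A bilinear form given by absolutely convergent integrals and bounded by
`C (‖u‖² + ‖v‖²)` is represented by a bounded operator into the dual. -/
lemma exists_isWeakForm (hs : ∀ u : H0 A Ω, ‖u‖ = 0 → u = 0)
    {m : ℝ → E n → Matrix (Fin n) (Fin n) ℝ} {a b : ℝ → E n → Fin n → ℝ} {a₀ : E n → ℝ}
    (h₁ : ∀ u v : H0 A Ω, Integrable (formDensity m a b u v) (mixedMeasure n μ))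
    (h₂ : ∀ u v : H0 A Ω, IntegrableOn (fun x => a₀ x * u.val x * v.val x) Ω) {C : ℝ}
    (hC : ∀ u v : H0 A Ω, |(∫ p, formDensity m a b u v p ∂(mixedMeasure n μ)) +
      ∫ x in (Ω : Set (E n)), a₀ x * u.val x * v.val x| ≤ C * (‖u‖ ^ 2 + ‖v‖ ^ 2)) :
    ∃ L : H0 A Ω →L[ℝ] StrongDual ℝ (H0 A Ω), IsWeakForm m a b a₀ L := by
  let B : H0 A Ω →ₗ[ℝ] H0 A Ω →ₗ[ℝ] ℝ := LinearMap.mk₂ ℝ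
    (fun u v => (∫ p, formDensity m a b u v p ∂(mixedMeasure n μ)) +
      ∫ x in (Ω : Set (E n)), a₀ x * u.val x * v.val x) (by
      intro u u' v
      have e2 : (fun x => a₀ x * (u + u').val x * v.val x) =ᵐ[volume.restrict (Ω : Set (E n))]
          fun x => a₀ x * u.val x * v.val x + a₀ x * u'.val x * v.val x := by
        filter_upwards [ae_restrict_of_ae (val_add u u')] with x hx
        rw [hx, Pi.add_apply]
        ring
      rw [integral_congr_ae (formDensity_add_left m a b u u' v), integral_congr_ae e2, integral_add' (h₁ u v) (h₁ u' v),
        integral_add (h₂ u v) (h₂ u' v)]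
      ring) (by
      intro c u v
      have e2 : (fun x => a₀ x * (c • u).val x * v.val x) =ᵐ[volume.restrict (Ω : Set (E n))]
          fun x => c * (a₀ x * u.val x * v.val x) := by
        filter_upwards [ae_restrict_of_ae (val_smul c u)] with x hx
        rw [hx, Pi.smul_apply, smul_eq_mul]
        ring
      rw [integral_congr_ae (formDensity_smul_left m a b c u v), integral_congr_ae e2, integral_const_mul, integral_const_mul,
        smul_eq_mul]
      ring) (by
      intro u v v'
      have e2 : (fun x => a₀ x * u.val x * (v + v').val x) =ᵐ[volume.restrict (Ω : Set (E n))]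
          fun x => a₀ x * u.val x * v.val x + a₀ x * u.val x * v'.val x := by
        filter_upwards [ae_restrict_of_ae (val_add v v')] with x hx
        rw [hx, Pi.add_apply]
        ring
      rw [integral_congr_ae (formDensity_add_right m a b u v v'), integral_congr_ae e2, integral_add' (h₁ u v) (h₁ u v'),
        integral_add (h₂ u v) (h₂ u v')]
      ring) (by
      intro c u v
      have e2 : (fun x => a₀ x * u.val x * (c • v).val x) =ᵐ[volume.restrict (Ω : Set (E n))]
          fun x => c * (a₀ x * u.val x * v.val x) := by
        filter_upwards [ae_restrict_of_ae (val_smul c v)] with x hx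
        rw [hx, Pi.smul_apply, smul_eq_mul]
        ring
      rw [integral_congr_ae (formDensity_smul_right m a b c u v), integral_congr_ae e2, integral_const_mul, integral_const_mul,
        smul_eq_mul]
      ring)
  exact ⟨B.mkContinuous₂ (2 * C) (abs_bilin_le_of_le_sq_add_sq hs B hC),
    fun u v => ⟨h₁ u v, h₂ u v, rfl⟩⟩

end H0

end Forms

/-! ### Coercivity and compactness of the weight form -/

/-- A symmetric nonnegative form whose quadratic form is bounded by an arbitrarily small multiple
of `‖u‖²` plus a multiple of `‖ι u‖²`, with `ι` compact, is a compact operator into the dual. -/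
lemma isCompactOperator_of_apply_self_le {V X : Type*} [NormedAddCommGroup V] [NormedSpace ℝ V]
    [NormedAddCommGroup X] [NormedSpace ℝ X] {J : V →L[ℝ] StrongDual ℝ V} {ι : V →L[ℝ] X}
    (hι : IsCompactOperator ι) (hsymm : ∀ u v, J u v = J v u) (hpos : ∀ u, 0 ≤ J u u)
    (h : ∀ ε : ℝ, 0 < ε → ∃ K : ℝ, 0 ≤ K ∧ ∀ u, J u u ≤ ε * ‖u‖ ^ 2 + K * ‖ι u‖ ^ 2) :
    IsCompactOperator J := by
  -- the Cauchy-Schwarz inequality for the nonnegative form `J`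
  have hcs : ∀ u v, J u v ^ 2 ≤ J u u * J v v := by
    intro u v
    let B : LinearMap.BilinForm ℝ V := ContinuousLinearMap.coeLM ℝ ∘ₗ J.toLinearMap
    have := LinearMap.BilinForm.apply_mul_apply_le_of_forall_zero_le B hpos u v
    change J u v * J v u ≤ J u u * J v v at this
    rwa [hsymm v u, ← sq] at this
  have hJ : ∀ v, J v v ≤ (‖J‖ + 1) * ‖v‖ ^ 2 := by
    intro v
    have h1 := (le_abs_self _).trans (J.le_opNorm₂ v v)
    nlinarith [sq_nonneg ‖v‖]
  refine isCompactOperator_of_norm_le (W := StrongDual ℝ V) hι fun δ hδ => ?_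
  have hM : 0 < ‖J‖ + 1 := by positivity
  obtain ⟨K, hK, hKu⟩ := h (δ ^ 2 / (‖J‖ + 1)) (by positivity)
  refine ⟨√((‖J‖ + 1) * K), Real.sqrt_nonneg _, fun u => ?_⟩
  refine ContinuousLinearMap.opNorm_le_bound _ (by positivity) fun v => ?_
  rw [Real.norm_eq_abs]
  refine abs_le_of_sq_le_sq ((hcs u v).trans ?_) (by positivity)
  have hs : √((‖J‖ + 1) * K) ^ 2 = (‖J‖ + 1) * K := Real.sq_sqrt (by positivity)
  calc J u u * J v v
      ≤ (δ ^ 2 / (‖J‖ + 1) * ‖u‖ ^ 2 + K * ‖ι u‖ ^ 2) * ((‖J‖ + 1) * ‖v‖ ^ 2) :=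
        mul_le_mul (hKu u) (hJ v) (hpos v) (by positivity)
    _ = ((δ * ‖u‖) ^ 2 + (√((‖J‖ + 1) * K) * ‖ι u‖) ^ 2) * ‖v‖ ^ 2 := by
        rw [mul_pow √_, hs]
        field_simp
    _ ≤ (δ * ‖u‖ + √((‖J‖ + 1) * K) * ‖ι u‖) ^ 2 * ‖v‖ ^ 2 := by
        refine mul_le_mul_of_nonneg_right ?_ (sq_nonneg _)
        have : 0 ≤ δ * ‖u‖ * (√((‖J‖ + 1) * K) * ‖ι u‖) := by positivity
        nlinarith
    _ = _ := by ring

variable {n : ℕ} {μ : Measure ℝ} {A : CoeffMatrix n μ} {Ω : Opens (E n)}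

namespace H0

/-- The Poincaré inequality in `H⁰(A, Ω)`. -/
lemma exists_norm_fn_le (hn : 0 < n) (hΩ : Bornology.IsBounded (Ω : Set (E n)))
    (hT : ∀ φ : 𝓓(Ω, ℝ), ∃ u : H0 A Ω, u.IsTest φ) {C : ℝ}
    (hC : ∀ (φ : 𝓓(Ω, ℝ)) (w : H0 A Ω), w.IsTest φ →
      (∫⁻ x, ‖gradient φ x‖ₑ).toReal ≤ C * ‖w‖) :
    ∃ D : ℝ, ∀ u : H0 A Ω, ‖u.fn‖ ≤ D * ‖u‖ := by
  obtain ⟨D, hD0, hD⟩ := exists_poincare hn hΩ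
  refine ⟨D * C, norm_fn_le_of_isTest hT (ContinuousLinearMap.id ℝ _) fun φ w hw => ?_⟩
  have h1 : ‖w.fn‖ = (∫⁻ x, ‖φ x‖ₑ).toReal := by
    rw [Lp.norm_def, eLpNorm_one_eq_lintegral_enorm]
    congr 1
    exact lintegral_congr_ae (hw.1.mono fun x hx => congrArg enorm hx)
  rw [ContinuousLinearMap.id_apply, h1, mul_assoc]
  have h2 : ENNReal.ofReal D * ∫⁻ x, ‖gradient φ x‖ₑ ≠ ∞ :=
    ENNReal.mul_ne_top ENNReal.ofReal_ne_top (lintegral_enorm_gradient_lt_top φ).ne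
  calc (∫⁻ x, ‖φ x‖ₑ).toReal ≤ (ENNReal.ofReal D * ∫⁻ x, ‖gradient φ x‖ₑ).toReal :=
        ENNReal.toReal_mono h2 (hD φ)
    _ = D * (∫⁻ x, ‖gradient φ x‖ₑ).toReal := by
        rw [ENNReal.toReal_mul, ENNReal.toReal_ofReal hD0]
    _ ≤ D * (C * ‖w‖) := mul_le_mul_of_nonneg_left (hC φ w hw) hD0

/-- The seminorm of `H⁰(A, Ω)` is a norm: the function vanishes by Poincaré's inequality, and the
field because the matrix is positive definite. -/
lemma eq_zero_of_norm_eq_zero {D : ℝ} (hD : ∀ u : H0 A Ω, ‖u.fn‖ ≤ D * ‖u‖) (u : H0 A Ω)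
    (hu : ‖u‖ = 0) : u = 0 := by
  have h1 : u.fn = 0 := by
    rw [← norm_le_zero_iff]
    simpa [hu] using hD u
  have h2 : energy A u.grad = 0 := by rw [energy_grad, hu]; simp
  refine ext h1 (AEEqFun.ext ?_)
  have h3 := (lintegral_eq_zero_iff' (aemeasurable_matForm A u.aemeasurable_grad
    u.aemeasurable_grad).ennreal_ofReal).1 h2
  refine EventuallyEq.trans ?_ (AEEqFun.coeFn_zero (β := E n)).symm
  filter_upwards [h3, ae_mem_Ioc n μ] with p hp hs
  by_contra hne
  exact (A.posDef_mat p.1 hs p.2 (u.field p) hne).not_ge (ENNReal.ofReal_eq_zero.1 hp)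

/-- Compact boundedness of `f` carries over from test functions to `H⁰(A, Ω)`. -/
lemma exists_integral_mul_sq_le (hT : ∀ φ : 𝓓(Ω, ℝ), ∃ u : H0 A Ω, u.IsTest φ) {f : E n → ℝ}
    (hf : CompactlyBounded A Ω f) (hf0 : ∀ x, 0 ≤ f x) {ε : ℝ} (hε : 0 < ε) :
    ∃ K : ℝ, 0 ≤ K ∧ ∀ u : H0 A Ω, IntegrableOn (fun x => f x * u.val x ^ 2) (Ω : Set (E n)) ∧
      ∫ x in (Ω : Set (E n)), f x * u.val x ^ 2 ≤ ε * ‖u‖ ^ 2 + K * ‖u.fn‖ ^ 2 := by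
  obtain ⟨K, hK, hKφ⟩ := hf.2.2 ε hε
  refine ⟨K, hK, fun u => ?_⟩
  have h := lintegral_mul_sq_le hT hf.1 hε.le hK hKφ u
  have h0 : 0 ≤ᵐ[volume.restrict (Ω : Set (E n))] fun x => f x * u.val x ^ 2 :=
    ae_of_all _ fun x => mul_nonneg (hf0 x) (sq_nonneg _)
  have hm : AEStronglyMeasurable (fun x => f x * u.val x ^ 2) (volume.restrict (Ω : Set (E n))) :=
    (hf.1.mul ((Lp.stronglyMeasurable u.fn).measurable.pow_const 2).aemeasurable)
      |>.aestronglyMeasurable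
  have hi : IntegrableOn (fun x => f x * u.val x ^ 2) (Ω : Set (E n)) :=
    ⟨hm, (hasFiniteIntegral_iff_ofReal h0).2 (h.trans_lt ENNReal.ofReal_lt_top)⟩
  refine ⟨hi, ?_⟩
  rw [← ENNReal.ofReal_le_ofReal_iff (by positivity), ofReal_integral_eq_lintegral_ofReal hi h0]
  exact h

end H0

/-- The form of `L*` is the transpose of the form of `L`. -/
lemma IsWeakForm.flip {m : ℝ → E n → Matrix (Fin n) (Fin n) ℝ} {a b : ℝ → E n → Fin n → ℝ}
    {a₀ : E n → ℝ} {L : H0 A Ω →L[ℝ] StrongDual ℝ (H0 A Ω)} (hL : IsWeakForm m a b a₀ L) :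
    IsWeakForm (fun s x => (m s x).transpose) b a a₀ L.flip := by
  intro u v
  obtain ⟨h1, h2, h3⟩ := hL v u
  have e1 : formDensity (fun s x => (m s x).transpose) b a u v = formDensity m a b v u :=
    funext fun p => H0.formDensity_swap m a b u v p
  have e2 : (fun x => a₀ x * u.val x * v.val x) = fun x => a₀ x * v.val x * u.val x :=
    funext fun x => mul_right_comm _ _ _
  rw [e1, e2]
  exact ⟨h1, h2, h3⟩

/-- The weight dominates `αᵀ A⁻¹ α` for both first order coefficients, and the zeroth order one. -/
lemma weight_bounds {bm : E n → Matrix (Fin n) (Fin n) ℝ} {am bv : E n → Fin n → ℝ}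
    {a₀ : E n → ℝ} {x : E n} (hbm : ∀ i j, 0 ≤ bm x i j) (ham : ∀ i, 0 ≤ am x i)
    (hbv : ∀ i, 0 ≤ bv x i) :
    ∑ i, ∑ j, bm x i j * (am x i * am x j) ≤ weight bm am bv a₀ x ∧
    ∑ i, ∑ j, bm x i j * (bv x i * bv x j) ≤ weight bm am bv a₀ x ∧
    |a₀ x| ≤ weight bm am bv a₀ x := by
  have h1 : 0 ≤ ∑ i, ∑ j, bm x i j * (am x i * am x j) :=
    Finset.sum_nonneg fun i _ => Finset.sum_nonneg fun j _ =>
      mul_nonneg (hbm i j) (mul_nonneg (ham i) (ham j))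
  have h2 : 0 ≤ ∑ i, ∑ j, bm x i j * (bv x i * bv x j) :=
    Finset.sum_nonneg fun i _ => Finset.sum_nonneg fun j _ =>
      mul_nonneg (hbm i j) (mul_nonneg (hbv i) (hbv j))
  have h3 := abs_nonneg (a₀ x)
  simp only [weight, mul_add, Finset.sum_add_distrib]
  refine ⟨?_, ?_, ?_⟩ <;> linarith

/-- The forms of `L` and `I(f)` exist, and `L + σ₀ I(f)` is coercive for large `σ₀`: the lower order
terms of `L` are absorbed by half of the energy and a multiple of `∫ f u²`. -/
lemma exists_isWeakForm_coercive [IsFiniteMeasure μ]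
    (hT : ∀ φ : 𝓓(Ω, ℝ), ∃ u : H0 A Ω, u.IsTest φ) (hs : ∀ u : H0 A Ω, ‖u‖ = 0 → u = 0)
    {K : ℝ} (hK0 : 0 ≤ K) (hK : ∀ s ∈ Ioc (0 : ℝ) 1, ∀ x ξ ψ, matForm (A.mat s x) ξ ψ ^ 2 ≤
      K * matForm (A.mat s x) ξ ξ * matForm (A.mat s x) ψ ψ)
    {a b : ℝ → E n → Fin n → ℝ} {a₀ f : E n → ℝ}
    (ha : ∀ i, AEMeasurable (fun p : ℝ × E n => a p.1 p.2 i) (mixedMeasure n μ))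
    (hb : ∀ i, AEMeasurable (fun p : ℝ × E n => b p.1 p.2 i) (mixedMeasure n μ))
    (ha₀ : AEMeasurable a₀ (volume.restrict (Ω : Set (E n))))
    (hfm : AEMeasurable f (volume.restrict (Ω : Set (E n)))) (hf0 : ∀ x, 0 ≤ f x)
    (haf : ∀ s ∈ Ioc (0 : ℝ) 1, ∀ x (ξ : E n),
      (∑ i, a s x i * ξ i) ^ 2 ≤ K * f x * matForm (A.mat s x) ξ ξ)
    (hbf : ∀ s ∈ Ioc (0 : ℝ) 1, ∀ x (ξ : E n),
      (∑ i, b s x i * ξ i) ^ 2 ≤ K * f x * matForm (A.mat s x) ξ ξ)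
    (ha₀f : ∀ x, |a₀ x| ≤ f x) {Cf : ℝ}
    (hfi : ∀ u : H0 A Ω, IntegrableOn (fun x => f x * u.val x ^ 2) (Ω : Set (E n)))
    (hfC : ∀ u : H0 A Ω, ∫ x in (Ω : Set (E n)), f x * u.val x ^ 2 ≤ Cf * ‖u‖ ^ 2) :
    ∃ L J : H0 A Ω →L[ℝ] StrongDual ℝ (H0 A Ω), IsWeakForm A.mat a b a₀ L ∧
      (∀ u v, IntegrableOn (fun x => f x * u.val x * v.val x) Ω ∧
        J u v = ∫ x in (Ω : Set (E n)), f x * u.val x * v.val x) ∧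
      ∃ σ₀ c : ℝ, 0 < c ∧ ∀ u, c * ‖u‖ ^ 2 ≤ (L + σ₀ • J) u u := by
  set W : H0 A Ω → ℝ := fun u => ∫ x in (Ω : Set (E n)), f x * u.val x ^ 2 with hW
  set κ : ℝ := K * μ.real (Ioc 0 1) with hκ
  have hκ0 : 0 ≤ κ := mul_nonneg hK0 measureReal_nonneg
  have hMi := fun u v : H0 A Ω => H0.integrable_matForm_grad hK0 hK v u
  have hai := fun u v : H0 A Ω => H0.integrable_lowerOrder hT hK0 hf0 ha haf u v (hfi u)
  have hbi := fun u v : H0 A Ω => H0.integrable_lowerOrder hT hK0 hf0 hb hbf v u (hfi v)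
  have h0i := fun u v : H0 A Ω => H0.integrableOn_zerothOrder ha₀ ha₀f u v (hfi u) (hfi v)
  have hJi := fun u v : H0 A Ω =>
    H0.integrableOn_zerothOrder hfm (fun x => (abs_of_nonneg (hf0 x)).le) u v (hfi u) (hfi v)
  have hd : ∀ u v : H0 A Ω, formDensity A.mat a b u v = fun p =>
      matForm (A.mat p.1 p.2) (v.grad p) (u.grad p) +
      ((∑ i, a p.1 p.2 i * v.grad p i) * u.val p.2 +
        (∑ i, b p.1 p.2 i * u.grad p i) * v.val p.2) :=
    fun u v => funext fun p => H0.formDensity_eq A.mat a b u v p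
  have hdi : ∀ u v : H0 A Ω, Integrable (formDensity A.mat a b u v) (mixedMeasure n μ) := by
    intro u v
    rw [hd]
    exact (hMi u v).1.add ((hai u v).1.add (hbi u v).1)
  have hdint : ∀ u v : H0 A Ω, ∫ p, formDensity A.mat a b u v p ∂(mixedMeasure n μ) =
      (∫ p, matForm (A.mat p.1 p.2) (v.grad p) (u.grad p) ∂(mixedMeasure n μ)) +
      ((∫ p, (∑ i, a p.1 p.2 i * v.grad p i) * u.val p.2 ∂(mixedMeasure n μ)) +
        ∫ p, (∑ i, b p.1 p.2 i * u.grad p i) * v.val p.2 ∂(mixedMeasure n μ)) := by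
    intro u v
    rw [hd, ← integral_add (hai u v).1 (hbi u v).1]
    exact integral_add (hMi u v).1 ((hai u v).1.add (hbi u v).1)
  have hd0 : ∀ u v : H0 A Ω, formDensity (fun _ _ => 0) (fun _ _ => 0) (fun _ _ => 0) u v = 0 :=
    fun u v => funext fun p => by simp [formDensity]
  obtain ⟨L, hL⟩ := H0.exists_isWeakForm (a₀ := a₀) hs hdi (fun u v => (h0i u v).1)
    (C := (K + 1) / 2 + 1 / 2 + κ * Cf / 2 + Cf / 2) (by
      intro u v
      rw [hdint]
      have h1 := (hMi u v).2
      have h2 := (hai u v).2 1 one_pos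
      have h3 := (hbi u v).2 1 one_pos
      have h4 := (h0i u v).2
      have h5 := hfC u
      have h6 := hfC v
      have h7 := mul_le_mul_of_nonneg_left h5 hκ0
      have h8 := mul_le_mul_of_nonneg_left h6 hκ0
      rw [inv_one, one_mul, one_mul, ← mul_assoc, ← hκ] at h2 h3
      have h9 : 0 ≤ K * ‖u‖ ^ 2 := by positivity
      have h10 := sq_nonneg ‖v‖
      rw [abs_le] at *
      constructor <;> linarith)
  obtain ⟨J, hJ⟩ := H0.exists_isWeakForm (m := fun _ _ => 0) (a := fun _ _ => 0)
    (b := fun _ _ => 0) (a₀ := f) hs (fun u v => by rw [hd0]; exact integrable_zero _ _ _)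
    (fun u v => (hJi u v).1) (C := Cf / 2) (by
      intro u v
      rw [hd0, integral_zero', zero_add]
      linarith [(hJi u v).2, hfC u, hfC v])
  have hJ' : ∀ u v, J u v = ∫ x in (Ω : Set (E n)), f x * u.val x * v.val x := by
    intro u v
    rw [(hJ u v).2.2, hd0, integral_zero', zero_add]
  refine ⟨L, J, hL, fun u v => ⟨(hJi u v).1, hJ' u v⟩, 2 * κ + 1, 1 / 2, by norm_num, fun u => ?_⟩
  have hJu : J u u = W u := by
    rw [hJ' u u]
    exact integral_congr_ae (ae_of_all _ fun x => by ring)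
  rw [add_apply, smul_apply, add_apply, smul_apply, smul_eq_mul, hJu, (hL u u).2.2, hdint, ← H0.norm_sq_eq]
  -- with `δ = 1 / 2` each first order term costs a quarter of the energy, and `κ ∫ f u²`
  have h2 := (abs_le.1 ((hai u u).2 (1 / 2) (by norm_num))).1
  have h3 := (abs_le.1 ((hbi u u).2 (1 / 2) (by norm_num))).1
  have h4 := (abs_le.1 (h0i u u).2).1
  rw [← mul_assoc K, ← hκ] at h2 h3
  change -((1 / 2 * ‖u‖ ^ 2 + (1 / 2 : ℝ)⁻¹ * (κ * W u)) / 2) ≤ _ at h2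
  change -((1 / 2 * ‖u‖ ^ 2 + (1 / 2 : ℝ)⁻¹ * (κ * W u)) / 2) ≤ _ at h3
  change -((W u + W u) / 2) ≤ _ at h4
  norm_num at h2 h3
  linarith

end MixedOrder

end

open MixedOrder in
theorem mainTheorem3 {n : ℕ} (hn : 0 < n)
    (Ω : Opens (MixedOrder.E n)) (hΩ : Bornology.IsBounded (Ω : Set (MixedOrder.E n)))
    (μ : Measure ℝ) [IsFiniteMeasure μ]
    (hμ : ∃ s₀ : ℝ, 0 < s₀ ∧ μ (Icc s₀ 1)ᶜ = 0)
    (hμ1 : 0 < μ {1})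
    (A : MixedOrder.CoeffMatrix n μ)
    (lam Lam : MixedOrder.E n → ℝ) (hlam0 : ∀ x, 0 ≤ lam x) (hLam0 : ∀ x, 0 ≤ Lam x)
    (hell : ∀ s ∈ Ioc (0 : ℝ) 1, ∀ x ξ,
      lam x * ‖ξ‖ ^ 2 ≤ MixedOrder.matForm (A.mat s x) ξ ξ ∧
        MixedOrder.matForm (A.mat s x) ξ ξ ≤ Lam x * ‖ξ‖ ^ 2)
    (hLam : ∃ R C p : ℝ, 0 < R ∧ 0 < C ∧ p < n ∧ IntegrableOn Lam (Metric.ball 0 R) ∧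
      ∀ x, x ∉ Metric.ball (0 : MixedOrder.E n) R → Lam x ≤ C * ‖x‖ ^ p)
    (hlam_pos : ∀ᵐ x ∂(volume.restrict (Ω : Set (MixedOrder.E n))), 0 < lam x)
    (hlam : IntegrableOn (fun x => (lam x)⁻¹) (Ω : Set (MixedOrder.E n)))
    (hK : ∃ K : ℝ, 0 < K ∧ ∀ s ∈ Ioc (0 : ℝ) 1, ∀ x ξ ψ,
      MixedOrder.matForm (A.mat s x) ξ ψ ^ 2 ≤
        K * MixedOrder.matForm (A.mat s x) ξ ξ * MixedOrder.matForm (A.mat s x) ψ ψ)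
    (a b : ℝ → MixedOrder.E n → Fin n → ℝ) (a₀ : MixedOrder.E n → ℝ)
    (ha : ∀ i, AEMeasurable (fun p : ℝ × MixedOrder.E n => a p.1 p.2 i)
      (MixedOrder.mixedMeasure n μ))
    (hb : ∀ i, AEMeasurable (fun p : ℝ × MixedOrder.E n => b p.1 p.2 i)
      (MixedOrder.mixedMeasure n μ))
    (ha₀ : AEMeasurable a₀ (volume.restrict (Ω : Set (MixedOrder.E n))))
    (bm : MixedOrder.E n → Matrix (Fin n) (Fin n) ℝ) (am bv : MixedOrder.E n → Fin n → ℝ)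
    (hbm : ∀ s ∈ Ioc (0 : ℝ) 1, ∀ x i j, |(A.mat s x)⁻¹ i j| ≤ bm x i j)
    (ham : ∀ s ∈ Ioc (0 : ℝ) 1, ∀ x i, |a s x i| ≤ am x i)
    (hbv : ∀ s ∈ Ioc (0 : ℝ) 1, ∀ x i, |b s x i| ≤ bv x i)
    (hf : MixedOrder.CompactlyBounded A Ω (MixedOrder.weight bm am bv a₀)) :
    -- `H⁰(A, Ω)` is a Hilbert space containing `𝓓(Ω)`
    ((∀ u : MixedOrder.H0 A Ω, ‖u‖ = 0 → u = 0) ∧ CompleteSpace (MixedOrder.H0 A Ω) ∧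
      ∀ φ : 𝓓(Ω, ℝ), ∃ u : MixedOrder.H0 A Ω, u.IsTest φ) ∧
    -- `L`, `L*` and `I(f)` are well-defined bounded operators from `H⁰(A, Ω)` to its dual
    ∃ L L' J : MixedOrder.H0 A Ω →L[ℝ] StrongDual ℝ (MixedOrder.H0 A Ω),
      MixedOrder.IsWeakForm A.mat a b a₀ L ∧
      MixedOrder.IsWeakForm (fun s x => (A.mat s x).transpose) b a a₀ L' ∧
      (∀ u v, IntegrableOn (fun x => MixedOrder.weight bm am bv a₀ x * u.val x * v.val x) Ω ∧
        J u v = ∫ x in (Ω : Set (MixedOrder.E n)),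
          MixedOrder.weight bm am bv a₀ x * u.val x * v.val x) ∧
      ∃ (σ₀ : ℝ) (S : Set ℝ),
        S.Countable ∧ (∀ σ : ℝ, ¬ AccPt σ (𝓟 S)) ∧ S ⊆ Iio σ₀ ∧
        (∀ σ, σ ∈ S ↔ ∃ u : MixedOrder.H0 A Ω, u ≠ 0 ∧ (L + σ • J) u = 0) ∧
        (∀ σ, σ ∉ S → Function.Bijective (L + σ • J)) ∧
        (∀ σ ∈ S,
          FiniteDimensional ℝ (LinearMap.ker (L + σ • J).toLinearMap) ∧
          FiniteDimensional ℝ (LinearMap.ker (L' + σ • J).toLinearMap) ∧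
          0 < Module.finrank ℝ (LinearMap.ker (L + σ • J).toLinearMap) ∧
          Module.finrank ℝ (LinearMap.ker (L + σ • J).toLinearMap) =
            Module.finrank ℝ (LinearMap.ker (L' + σ • J).toLinearMap)) ∧
        (∀ σ, σ ∉ S → ∀ T, ∃! u : MixedOrder.H0 A Ω, (L + σ • J) u = T) ∧
        (∀ σ ∈ S, ∀ T, (¬ ∃ u : MixedOrder.H0 A Ω, (L + σ • J) u = T) ∨
          {u : MixedOrder.H0 A Ω | (L + σ • J) u = T}.Infinite) ∧
        (∀ (σ : ℝ) (T : StrongDual ℝ (MixedOrder.H0 A Ω)),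
          (∃ u : MixedOrder.H0 A Ω, (L + σ • J) u = T) ↔
            ∀ w : MixedOrder.H0 A Ω, (L' + σ • J) w = 0 → T w = 0) := by
  obtain ⟨s₀, hs₀, hμ0⟩ := hμ
  obtain ⟨R, C, p, hR, hC, hp, hLi, hLd⟩ := hLam
  obtain ⟨K, hK0, hK⟩ := hK
  have hT : ∀ φ : 𝓓(Ω, ℝ), ∃ u : H0 A Ω, u.IsTest φ := fun φ =>
    H0.exists_isTest φ (energy_fracGrad_lt_top hn hs₀ hμ0 A hLam0
      (fun s hs x ξ => (hell s hs x ξ).2) hR hC hp hLi hLd φ)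
  obtain ⟨C₁, hC₁, hgrad⟩ := H0.exists_lintegral_gradient_le (A := A) hμ1
    (fun s hs x ξ => (hell s hs x ξ).1) hlam_pos hlam
  obtain ⟨D, hD⟩ := H0.exists_norm_fn_le hn hΩ hT hgrad
  let ι : H0 A Ω →L[ℝ] Lp ℝ 1 (volume : Measure (E n)) := (H0.fnLinear A Ω).mkContinuous D hD
  have hι : ∀ u, ι u = u.fn := fun u => rfl
  have hsep := H0.eq_zero_of_norm_eq_zero hD
  have hcomp : CompleteSpace (H0 A Ω) := H0.completeSpace ι hι hT
  have hιc : IsCompactOperator ι := H0.isCompactOperator_of_gradient_le hΩ hT hC₁ hgrad ι hι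
  set f := weight bm am bv a₀ with hfdef
  -- the dominating functions `bm`, `am`, `bv` are nonnegative because `(0, 1]` is nonempty
  have h1 : (1 : ℝ) ∈ Ioc (0 : ℝ) 1 := ⟨one_pos, le_rfl⟩
  have hw := fun x => weight_bounds (a₀ := a₀) (x := x)
    (fun i j => (abs_nonneg _).trans (hbm 1 h1 x i j))
    (fun i => (abs_nonneg _).trans (ham 1 h1 x i)) (fun i => (abs_nonneg _).trans (hbv 1 h1 x i))
  have hf0 : ∀ x, 0 ≤ f x := fun x => (abs_nonneg _).trans (hw x).2.2
  -- `|α · ξ|² ≤ K (αᵀ A⁻¹ α)(ξᵀ A ξ)`, and the weight dominates `αᵀ A⁻¹ α` for `α = a, b`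
  have hlow : ∀ {α : ℝ → E n → Fin n → ℝ} {α' : E n → Fin n → ℝ},
      (∀ s ∈ Ioc (0 : ℝ) 1, ∀ x i, |α s x i| ≤ α' x i) →
      (∀ x, ∑ i, ∑ j, bm x i j * (α' x i * α' x j) ≤ f x) →
      ∀ s ∈ Ioc (0 : ℝ) 1, ∀ x (ξ : E n),
        (∑ i, α s x i * ξ i) ^ 2 ≤ K * f x * matForm (A.mat s x) ξ ξ := by
    intro α α' hα hα' s hs x ξ
    refine (sq_sum_mul_le (A.posDef_mat s hs x) hK0.le (hK s hs x) (hbm s hs x)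
      (hα s hs x) ξ).trans ?_
    exact mul_le_mul_of_nonneg_right (mul_le_mul_of_nonneg_left (hα' x) hK0.le)
      (matForm_self_nonneg A hs x ξ)
  have hfε := fun (ε : ℝ) (hε : 0 < ε) => H0.exists_integral_mul_sq_le hT hf hf0 hε
  obtain ⟨K₁, hK₁, hf1⟩ := hfε 1 one_pos
  obtain ⟨L, J, hL, hJ, σ₀, hcoer⟩ := exists_isWeakForm_coercive hT hsep hK0.le hK ha hb ha₀ hf.1
    hf0 (hlow ham fun x => (hw x).1) (hlow hbv fun x => (hw x).2.1) (fun x => (hw x).2.2)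
    (Cf := 1 + K₁ * D ^ 2) (fun u => (hf1 u).1) (fun u => (hf1 u).2.trans (by
      have h2 := mul_le_mul_of_nonneg_left (pow_le_pow_left₀ (norm_nonneg _) (hD u) 2) hK₁
      linarith))
  have hJsymm : ∀ u v, J u v = J v u := fun u v => by
    rw [(hJ u v).2, (hJ v u).2]
    exact integral_congr_ae (ae_of_all _ fun x => mul_right_comm _ _ _)
  have hJself : ∀ u, J u u = ∫ x in (Ω : Set (E n)), f x * u.val x ^ 2 := fun u => by
    rw [(hJ u u).2]
    exact integral_congr_ae (ae_of_all _ fun x => by ring)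
  have hJ0 : ∀ u, 0 ≤ J u u := fun u => by
    rw [hJself]
    exact integral_nonneg fun x => mul_nonneg (hf0 x) (sq_nonneg _)
  -- the norm that separates points has the given seminorm as its underlying structure
  let _ : NormedAddCommGroup (H0 A Ω) := NormedAddCommGroup.ofSeparation hsep
  have hJc : IsCompactOperator J := by
    refine isCompactOperator_of_apply_self_le hιc hJsymm hJ0 fun ε hε => ?_
    obtain ⟨Kε, hKε, h⟩ := hfε ε hε
    exact ⟨Kε, hKε, fun u => (hJself u).trans_le (h u).2⟩
  refine ⟨⟨hsep, hcomp, hT⟩, L, L.flip, J, hL, hL.flip, hJ, σ₀, ?_⟩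
  exact fredholm_alternative_pencil L L.flip J (fun u v => rfl) hJsymm hJ0 hJc σ₀ hcoer
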